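/- Let $n\ge 2$, let $\bar X$ be a smooth compact $(n+1)$-manifold with boundary $M=\partial \bar X$ and interior $X$, and let $g$ be a smooth Riemannian metric on $X$ that is hyperbolic (all sectional curvatures equal $-1$) and conformally compact: for some defining function $\rho$ (smooth on $\bar X$, $\rho>0$ on $X$, $\rho=0$ and $d\rho\neq0$ on $M$), $\rho^2g$ extends to a smooth Riemannian metric on $\bar X$. Let $\gamma$ be a representative of its conformal infinity with associated geodesic defining function $r$; that is, $r$ is a defining function for $M$, $r^2g$ extends to a smooth Riemannian metric $\bar g$ on $\bar X$, $\bar g|_{TM}=\gamma$, and $|dr|^2_{\bar g}=1$ in a neighborhood of $M$. Then there are a smooth symmetric 2-tensor $P_\gamma$ on $M$, a number $\varepsilon>0$ and a bijection $\Phi:M\times[0,\varepsilon)\to\{r<\varepsilon\}$, $\Phi(p,t)=\Phi_t(p)$, such that $\Phi(p,0)=p$, the curves $t\mapsto\Phi(p,t)$ are integral curves of $\partial_r=\nabla_{\bar g}r$, the maps $\Phi_t$ are differentiable, and the following hold. (a) If $n\ge3$, then $P_\gamma=\frac1{n-2}\bigl(\mathrm{Ric}_\gamma-\frac{R_\gamma}{2(n-1)}\gamma\bigr)$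 is the Schouten tensor of $\gamma$. If $n=2$, then $\gamma^{ij}(P_\gamma)_{ij}=\frac12R_\gamma$ and $\gamma^{jk}(P_\gamma)_{ij,k}=\frac12(R_\gamma)_{,i}$. (b) In the product structure given by $\Phi$, for $0<r<\varepsilon$, $$g=r^{-2}(dr^2+g_r),\qquad g_r=\gamma-r^2P_\gamma+\tfrac{r^4}{4}Q(P_\gamma),\qquad Q(P_\gamma)_{ij}=\gamma^{kl}(P_\gamma)_{ik}(P_\gamma)_{jl}.$$ (c) Let $p\in M$, $0<t<\varepsilon$, and let $e_1,\dots,e_n$ be a basis of $T_pM$ of eigenvectors of $P_\gamma$ with respect to $\gamma$, with eigenvalues $\lambda_1,\dots,\lambda_n$. Then $d\Phi_t(e_1),\dots,d\Phi_t(e_n)$ is a basis, consisting of principal directions, of the tangent space at $\Phi(p,t)$ of the level set $\{r=t\}$, and the corresponding outward principal curvatures $\kappa_i$ satisfy $\kappa_i\ne1$ and $$1-\frac{t^2}{2}\lambda_i=\frac{2}{1-\kappa_i}.$$ Here the outward principal curvatures are the eigenvalues, with respect to the metric induced by $g$, of the second fundamental form $II=-\frac12\mathcal L_Ng$, where $N$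 is the $g$-unit normal of the level set pointing in the direction of decreasing $r$. The number $\frac{2}{1-\kappa_i}$ is called the $i$-th hyperbolic principal curvature radius. -/

import Mathlib

open scoped Manifold ContDiff Topology Matrix
open Set Bundle Topology

noncomputable section

namespace HypPoincare

/-! ### Linear algebra in coordinates

`Coord m` is the Euclidean coordinate space. Bilinear forms on it are written as functions of two
vectors. -/

/-- The coordinate space `ℝ^m`. -/
abbrev Coord (m : ℕ) := EuclideanSpace ℝ (Fin m)

/-- The `i`-th standard basis vector. -/
def stdVec {m : ℕ} (i : Fin m) : Coord m := EuclideanSpace.single i (1 : ℝ)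

/-- The inverse matrix `B^{kl}` of the coefficient matrix `B_{kl} = B(e_k, e_l)`. -/
def invGram {m : ℕ} (B : Coord m → Coord m → ℝ) : Matrix (Fin m) (Fin m) ℝ :=
  (Matrix.of fun k l => B (stdVec k) (stdVec l))⁻¹

/-- Raising an index: `(B^♯ ℓ)^k = ∑ l, B^{kl} ℓ_l`. -/
def sharp {m : ℕ} (B : Coord m → Coord m → ℝ) (ℓ : Coord m → ℝ) : Coord m :=
  ∑ k, (∑ l, invGram B k l * ℓ (stdVec l)) • stdVec k

/-- The trace `B^{kl} T_{kl}` of the bilinear form `T` with respect to `B`. -/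
def metricTrace {m : ℕ} (B T : Coord m → Coord m → ℝ) : ℝ :=
  ∑ k, ∑ l, invGram B k l * T (stdVec k) (stdVec l)

/-- The square `Q(P)_{ij} = B^{kl} P_{ik} P_{jl}` of the bilinear form `P` with respect to `B`. -/
def metricSquare {m : ℕ} (B P : Coord m → Coord m → ℝ) (u v : Coord m) : ℝ :=
  ∑ k, ∑ l, invGram B k l * P u (stdVec k) * P v (stdVec l)

/-- On the subspace `W`, the vectors `f i` form a basis of eigenvectors of the bilinear form `T`
with respect to the bilinear form `B`, with eigenvalues `μ i`. -/
structure IsEigenframe {V : Type*} [AddCommGroup V] [Module ℝ V] {n : ℕ} (W : Submodule ℝ V)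
    (B T : V → V → ℝ) (f : Fin n → V) (μ : Fin n → ℝ) : Prop where
  linearIndependent : LinearIndependent ℝ f
  span_eq : Submodule.span ℝ (range f) = W
  eigen : ∀ i, ∀ w ∈ W, T (f i) w = μ i * B (f i) w

/-! ### Curvature of a metric given by its coefficients `G y u v` on an open subset of `ℝ^m` -/

/-- The Christoffel symbols `Γ^k_{ij} = ½ G^{kl} (∂_i G_{jl} + ∂_j G_{il} - ∂_l G_{ij})`,
contracted with `u^i v^j`. -/
def christoffel {m : ℕ} (G : Coord m → Coord m → Coord m → ℝ) (y u v : Coord m) : Coord m :=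
  sharp (G y) fun w =>
    (fderiv ℝ (fun z => G z v w) y u + fderiv ℝ (fun z => G z u w) y v
      - fderiv ℝ (fun z => G z u v) y w) / 2

/-- The curvature `R(u,v)w = ∇_u ∇_v w - ∇_v ∇_u w` for constant coordinate fields `u, v, w`. -/
def riemann {m : ℕ} (G : Coord m → Coord m → Coord m → ℝ) (y u v w : Coord m) : Coord m :=
  fderiv ℝ (fun z => christoffel G z v w) y u - fderiv ℝ (fun z => christoffel G z u w) y v
    + christoffel G y u (christoffel G y v w) - christoffel G y v (christoffel G y u w)

/-- The Ricci tensor `Ric(v,w) = tr (u ↦ R(u,v)w)`. -/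
def ricci {m : ℕ} (G : Coord m → Coord m → Coord m → ℝ) (y v w : Coord m) : ℝ :=
  ∑ i, riemann G y (stdVec i) v w i

/-- The scalar curvature. -/
def scalarCurv {m : ℕ} (G : Coord m → Coord m → Coord m → ℝ) (y : Coord m) : ℝ :=
  metricTrace (G y) (ricci G y)

/-- The Schouten tensor `(Ric - R / (2 (m - 1)) G) / (m - 2)`, for `m ≥ 3`. -/
def schouten {m : ℕ} (G : Coord m → Coord m → Coord m → ℝ) (y u v : Coord m) : ℝ :=
  (ricci G y u v - scalarCurv G y / (2 * ((m : ℝ) - 1)) * G y u v) / ((m : ℝ) - 2)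

/-- The divergence `G^{jk} ∇_k T_{ij}`, contracted with `w^i`, of the symmetric 2-tensor with
coefficients `T`. -/
def divergence {m : ℕ} (G T : Coord m → Coord m → Coord m → ℝ) (y w : Coord m) : ℝ :=
  metricTrace (G y) fun a b =>
    fderiv ℝ (fun z => T z w a) y b - T y (christoffel G y b w) a - T y w (christoffel G y b a)

/-! ### Tensors on manifolds and their coefficients in charts -/

section Manifold

variable {m : ℕ} {H : Type*} [TopologicalSpace H] (I : ModelWithCorners ℝ (Coord m) H)
  {M : Type*} [TopologicalSpace M] [ChartedSpace H M]

/-- Fields of bilinear forms on the tangent spaces of `M`. -/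
abbrev BilinField (M : Type*) [TopologicalSpace M] [ChartedSpace H M] :=
  ∀ x : M, TangentSpace I x →L[ℝ] TangentSpace I x →L[ℝ] ℝ

/-- Smooth Riemannian metrics on `M`. -/
abbrev RiemMetric (M : Type*) [TopologicalSpace M] [ChartedSpace H M] [IsManifold I ∞ M] :=
  ContMDiffRiemannianMetric I ∞ (Coord m) (fun x : M => TangentSpace I x)

variable {I}

/-- Smoothness on `s` of a field of bilinear forms. -/
def SmoothBilinOn [IsManifold I ∞ M] (T : BilinField I M) (s : Set M) : Prop :=
  ContMDiffOn I (I.prod 𝓘(ℝ, Coord m →L[ℝ] Coord m →L[ℝ] ℝ)) ∞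
    (fun x => TotalSpace.mk' (Coord m →L[ℝ] Coord m →L[ℝ] ℝ) x (T x)) s

/-- The coefficients of `T` in the chart at `x₀`: the pullback of `T` under the inverse chart. -/
def chartForm (T : BilinField I M) (x₀ : M) (y u v : Coord m) : ℝ :=
  T ((extChartAt I x₀).symm y)
    (mfderivWithin 𝓘(ℝ, Coord m) I (extChartAt I x₀).symm (range I) y u)
    (mfderivWithin 𝓘(ℝ, Coord m) I (extChartAt I x₀).symm (range I) y v)

/-- The components of the vector field `N` in the chart at `x₀`. -/
def chartField (N : ∀ x : M, TangentSpace I x) (x₀ : M) (y : Coord m) : Coord m :=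
  mfderiv I 𝓘(ℝ, Coord m) (extChartAt I x₀) ((extChartAt I x₀).symm y)
    (N ((extChartAt I x₀).symm y))

/-- The Lie derivative `(L_N T)(u, v)` at the interior point `x`, in the chart at `x`
(the tangent space at `x` is the coordinate space of this chart):
`N^k ∂_k T_{ij} + T_{kj} ∂_i N^k + T_{ik} ∂_j N^k`. -/
def lieDeriv (N : ∀ x : M, TangentSpace I x) (T : BilinField I M) (x : M)
    (u v : TangentSpace I x) : ℝ :=
  let y : Coord m := extChartAt I x x
  let T' := chartForm T x
  let N' := chartField N x
  fderiv ℝ (fun z => T' z u v) y (N' y) + T' y (fderiv ℝ N' y u) v + T' y u (fderiv ℝ N' y v)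

/-- The differential of a function. -/
def diff (I : ModelWithCorners ℝ (Coord m) H) {M : Type*} [TopologicalSpace M] [ChartedSpace H M]
    (r : M → ℝ) (x : M) : TangentSpace I x →L[ℝ] ℝ := mfderiv I 𝓘(ℝ, ℝ) r x

/-- The gradient of `r` with respect to `g`. -/
def grad (g : BilinField I M) (r : M → ℝ) (x : M) : TangentSpace I x :=
  sharp (fun u v => g x u v) (fun u => diff I r x u)

/-- The squared length `|dr|²` of the differential of `r` with respect to `g`. -/
def normSqDiff (g : BilinField I M) (r : M → ℝ) (x : M) : ℝ := diff I r x (grad g r x)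

/-- The unit normal of the level sets of `r` with respect to `g` that points to decreasing `r`. -/
def outwardNormal (g : BilinField I M) (r : M → ℝ) (x : M) : TangentSpace I x :=
  -((Real.sqrt (normSqDiff g r x))⁻¹ • grad g r x)

/-- The second fundamental form `II = -½ L_N g` of the level sets of `r` with respect to the
outward unit normal `N`. It is to be evaluated on vectors tangent to the level set. -/
def secondFundForm (g : BilinField I M) (r : M → ℝ) (x : M) (u v : TangentSpace I x) : ℝ :=
  -(1 / 2) * lieDeriv (outwardNormal g r) g x u v

/-- The `κ i` are the outward principal curvatures, with multiplicity, at `x` of the level set of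
`r` through `x`, and the `f i` form a basis of principal directions: on the tangent space
`ker dr` of the level set, the `f i` are eigenvectors of `II` with respect to the first
fundamental form `g`. -/
def IsPrincipalFrame {n : ℕ} (g : BilinField I M) (r : M → ℝ) (x : M)
    (f : Fin n → TangentSpace I x) (κ : Fin n → ℝ) : Prop :=
  IsEigenframe (LinearMap.ker (diff I r x).toLinearMap) (fun u v => g x u v)
    (fun u v => secondFundForm g r x u v) f κ

/-- In every chart and at every interior point, all sectional curvatures of `g` equal `K`:
`g(R(u,v)v, u) = K (g(u,u) g(v,v) - g(u,v)²)`. -/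
def HasConstCurvature (g : BilinField I M) (K : ℝ) : Prop :=
  ∀ x₀ : M, ∀ y ∈ (extChartAt I x₀).target ∩ interior (range I), ∀ u v : Coord m,
    chartForm g x₀ y (riemann (chartForm g x₀) y u v v) u =
      K * (chartForm g x₀ y u u * chartForm g x₀ y v v - chartForm g x₀ y u v ^ 2)

/-! ### Conformally compact manifolds -/

/-- `r` is a defining function for the boundary of the manifold with boundary `M`. -/
structure IsDefiningFunction (I : ModelWithCorners ℝ (Coord m) H) {M : Type*} [TopologicalSpace M]
    [ChartedSpace H M] (r : M → ℝ) : Prop where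
  smooth : ContMDiff I 𝓘(ℝ, ℝ) ∞ r
  pos : ∀ x ∈ I.interior M, 0 < r x
  zero : ∀ x ∈ I.boundary M, r x = 0
  diff_ne_zero : ∀ x ∈ I.boundary M, diff I r x ≠ 0

/-- The metric `gbar` on all of `M` extends `r² g`, where `g` is only relevant on the interior. -/
def IsCompactification [IsManifold I ∞ M] (g : BilinField I M) (r : M → ℝ)
    (gbar : RiemMetric I M) : Prop :=
  ∀ x ∈ I.interior M, gbar.inner x = r x ^ 2 • g x

/-- `g` is a Riemannian metric on the interior of the (compact) manifold with boundary `M` that is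
conformally compact and hyperbolic, that is, of constant sectional curvature `-1`. The values of
`g` at boundary points play no role. -/
structure IsHyperbolicPoincare [IsManifold I ∞ M] (g : BilinField I M) : Prop where
  symm : ∀ x ∈ I.interior M, ∀ u v, g x u v = g x v u
  pos : ∀ x ∈ I.interior M, ∀ u, u ≠ 0 → 0 < g x u u
  smooth : SmoothBilinOn g (I.interior M)
  conformallyCompact : ∃ (ρ : M → ℝ) (gbar : RiemMetric I M),
    IsDefiningFunction I ρ ∧ IsCompactification g ρ gbar
  hyperbolic : HasConstCurvature g (-1)

end Manifold

section Boundary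

variable {n : ℕ} {X : Type*} [TopologicalSpace X] [ChartedSpace (EuclideanHalfSpace (n + 1)) X]
  {M : Type*} [TopologicalSpace M] [ChartedSpace (EuclideanSpace ℝ (Fin n)) M]

/-- `ι` is a smooth embedding of the manifold `M` onto the boundary of `X`; it identifies `M`
with `∂X`. -/
structure IsBoundaryInclusion (ι : M → X) : Prop where
  smooth : ContMDiff (𝓡 n) (𝓡∂ (n + 1)) ∞ ι
  isEmbedding : IsEmbedding ι
  immersion : ∀ p, Function.Injective (mfderiv (𝓡 n) (𝓡∂ (n + 1)) ι p)
  range_eq : range ι = (𝓡∂ (n + 1)).boundary X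

variable [IsManifold (𝓡∂ (n + 1)) ∞ X] [IsManifold (𝓡 n) ∞ M]

/-- `r` is the geodesic defining function of `g` associated with the metric `γ` on the boundary:
it is a defining function, `gbar = r² g` extends to a metric on `X`, `gbar` restricts to `γ` on
the boundary, and `|dr|² = 1` with respect to `gbar` in a neighborhood of the boundary. -/
structure IsGeodesicDefiningFunction (ι : M → X) (g : BilinField (𝓡∂ (n + 1)) X)
    (γ : RiemMetric (𝓡 n) M) (r : X → ℝ) (gbar : RiemMetric (𝓡∂ (n + 1)) X) : Prop where
  defining : IsDefiningFunction (𝓡∂ (n + 1)) r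
  compactification : IsCompactification g r gbar
  restrict : ∀ p, ∀ u v : TangentSpace (𝓡 n) p, gbar.inner (ι p)
    (mfderiv (𝓡 n) (𝓡∂ (n + 1)) ι p u) (mfderiv (𝓡 n) (𝓡∂ (n + 1)) ι p v) = γ.inner p u v
  unit : ∃ U : Set X, IsOpen U ∧ (𝓡∂ (n + 1)).boundary X ⊆ U ∧
    ∀ x ∈ U, normSqDiff gbar.inner r x = 1

/-- `Φ` is the product structure `M × [0, ε) ≅ {r < ε}` induced by `r`: the curves
`t ↦ Φ p t` are the integral curves of `∂_r = ∇_gbar r` that start at the boundary points. -/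
structure IsNormalCollar (ι : M → X) (r : X → ℝ) (gbar : RiemMetric (𝓡∂ (n + 1)) X)
    (ε : ℝ) (Φ : M → ℝ → X) : Prop where
  start : ∀ p, Φ p 0 = ι p
  integralCurve : ∀ p, IsMIntegralCurveOn (I := 𝓡∂ (n + 1)) (Φ p) (grad gbar.inner r) (Ico 0 ε)
  bijOn : BijOn (fun q : M × ℝ => Φ q.1 q.2) (univ ×ˢ Ico 0 ε) {x | r x < ε}
  differentiable : ∀ t ∈ Ico 0 ε, MDifferentiable (𝓡 n) (𝓡∂ (n + 1)) (fun p => Φ p t)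

/-- The differential at `p` of `Φ_t = Φ(·, t) : M → {r = t}`. -/
def transport (Φ : M → ℝ → X) (t : ℝ) (p : M) :
    TangentSpace (𝓡 n) p →L[ℝ] TangentSpace (𝓡∂ (n + 1)) (Φ p t) :=
  mfderiv (𝓡 n) (𝓡∂ (n + 1)) (fun p' => Φ p' t) p

/-- In the product structure `Φ`, one has `g = r⁻² (dr² + g_r)` with
`g_r = γ - r² P + (r⁴ / 4) Q(P)`. -/
def HasNormalForm (g : BilinField (𝓡∂ (n + 1)) X) (γ : RiemMetric (𝓡 n) M) (r : X → ℝ)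
    (gbar : RiemMetric (𝓡∂ (n + 1)) X) (P : BilinField (𝓡 n) M) (ε : ℝ) (Φ : M → ℝ → X) : Prop :=
  ∀ p, ∀ t ∈ Ioo 0 ε, ∀ (a b : ℝ) (u v : TangentSpace (𝓡 n) p),
    g (Φ p t) (a • grad gbar.inner r (Φ p t) + transport Φ t p u)
        (b • grad gbar.inner r (Φ p t) + transport Φ t p v) =
      (t ^ 2)⁻¹ * (a * b + (γ.inner p u v - t ^ 2 * P p u v
        + t ^ 4 / 4 * metricSquare (fun x y => γ.inner p x y) (fun x y => P p x y) u v))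

/-- `P` is a smooth symmetric 2-tensor on `M` with the properties of the tensor `P_γ`: it is the
Schouten tensor of `γ` if `n ≥ 3`, and it has trace `R / 2` and divergence `dR / 2` if `n = 2`.
Curvature quantities at `p` are computed in the chart at `p`. -/
structure IsSchoutenType (γ : RiemMetric (𝓡 n) M) (P : BilinField (𝓡 n) M) : Prop where
  symm : ∀ p u v, P p u v = P p v u
  smooth : SmoothBilinOn P univ
  eq_schouten : 3 ≤ n → ∀ p, ∀ u v : TangentSpace (𝓡 n) p,
    P p u v = schouten (chartForm γ.inner p) (extChartAt (𝓡 n) p p) u v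
  trace_eq : n = 2 → ∀ p, metricTrace (fun u v => γ.inner p u v) (fun u v => P p u v) =
    scalarCurv (chartForm γ.inner p) (extChartAt (𝓡 n) p p) / 2
  divergence_eq : n = 2 → ∀ p, ∀ w : Coord n,
    divergence (chartForm γ.inner p) (chartForm P p) (extChartAt (𝓡 n) p p) w =
      fderiv ℝ (scalarCurv (chartForm γ.inner p)) (extChartAt (𝓡 n) p p) w / 2

end Boundary

end HypPoincare

end

open HypPoincare

set_option maxSynthPendingDepth 3
set_option linter.unusedSectionVars false
set_option synthInstance.maxHeartbeats 200000

noncomputable section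

namespace HypPoincare

/-! ### Calculus of bilinear expressions -/

section Calculus

variable {V V₁ V₂ W : Type*} [NormedAddCommGroup V] [NormedSpace ℝ V]
  [NormedAddCommGroup V₁] [NormedSpace ℝ V₁] [NormedAddCommGroup V₂] [NormedSpace ℝ V₂]
  [NormedAddCommGroup W] [NormedSpace ℝ W]

/-! Write `N` for the gradient of `r` with respect to `gbar = r² g`; near the boundary it is a unit
field. For a unit gradient the conformal change formula is short: the curvature of `g` is that of
`gbar`, plus `r⁻¹` times terms linear in `∇N`, plus `r⁻²` times the curvature tensor of a space
form. If `g` has curvature `-1`, the `r⁻²` terms cancel (`HypOn.curv_interior`). Hence the operator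
`A u = R(u, N) N` of `gbar` satisfies `∇N = -r A` (`HypOn.cov_eq`). Since `A` is a curvature of
`gbar`, it is smooth up to the boundary, and nothing has to be divided by `r` there: identities are
proved in the interior and extended by continuity. Two more follow. The curvature of `gbar` is the
Kulkarni-Nomizu product of `gbar` with the form of `A` (`HypOn.curv_eq`), and `A` satisfies the
Codazzi equation (`HypOn.codazzi`).

Boundary: `∇N = 0` where `r = 0`, so the boundary is totally geodesic, `A` restricts to it, and the
curvature of `γ` is the Kulkarni-Nomizu product of `γ` and the restricted form `P`
(`BoundaryOn.curv_boundary`). Contraction gives `Ric = (n - 2) P + (tr P) γ` and `R = 2 (n - 1) tr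
P`. This identifies `P` with the Schouten tensor for `n ≥ 3` and gives the trace for `n = 2`; the
contracted Codazzi equation gives the divergence.

Evolution: let `J u` be a field transported by the flow of `N`. By Codazzi and `A N = 0` the field
`A J u` is parallel along the flow lines (`FlowOn.hasDerivWithinAt_shape`), while `∇_N (J u) = -t A
J u`. So `J u` is the parallel transport of `u - (t² / 2) A u`. Its inner products are the
polynomial `γ - t² P + (t⁴ / 4) Q(P)` (`FlowOn.inner_eq`), a perfect square on eigenvectors.

Principal curvatures: the outward normal for `g` is `-r N`, and the Lie derivative of `r⁻² gbar`
along it gives `II = -(r⁻² gbar + gbar(A·, ·))` on the level sets. On an eigenvector with eigenvalue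
`λ` all forms are multiples of `γ`, and `κ` is a quotient of two of them.

The collar needs the flow of a field that points inwards on a half space, including its first
derivative in the initial point (`exists_halfSpace_flow`). Compactness of the boundary gives a
common `ε`, and uniqueness of integral curves glues the local flows. -/

theorem fderivWithin_apply₁ {T : V → V₁ →L[ℝ] W} {f : V → V₁} {s : Set V} {y : V}
    (hs : UniqueDiffWithinAt ℝ s y) (hT : DifferentiableWithinAt ℝ T s y)
    (hf : DifferentiableWithinAt ℝ f s y) (u : V) :
    fderivWithin ℝ (fun z => T z (f z)) s y u =
      fderivWithin ℝ T s y u (f y) + T y (fderivWithin ℝ f s y u) := by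
  rw [fderivWithin_clm_apply hs hT hf]
  simp [add_comm]

theorem fderivWithin_apply₂ {T : V → V₁ →L[ℝ] V₂ →L[ℝ] W} {f : V → V₁} {g : V → V₂}
    {s : Set V} {y : V} (hs : UniqueDiffWithinAt ℝ s y) (hT : DifferentiableWithinAt ℝ T s y)
    (hf : DifferentiableWithinAt ℝ f s y) (hg : DifferentiableWithinAt ℝ g s y) (u : V) :
    fderivWithin ℝ (fun z => T z (f z) (g z)) s y u =
      fderivWithin ℝ T s y u (f y) (g y) + T y (fderivWithin ℝ f s y u) (g y)
        + T y (f y) (fderivWithin ℝ g s y u) := by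
  rw [fderivWithin_apply₁ hs (hT.clm_apply hf) hg, fderivWithin_apply₁ hs hT hf]
  simp

theorem fderivWithin_apply_const {T : V → V₁ →L[ℝ] W} {s : Set V} {y : V}
    (hs : UniqueDiffWithinAt ℝ s y) (hT : DifferentiableWithinAt ℝ T s y) (v : V₁) (u : V) :
    fderivWithin ℝ (fun z => T z v) s y u = fderivWithin ℝ T s y u v := by
  rw [fderivWithin_apply₁ hs hT (differentiableWithinAt_const v)]
  simp

theorem fderivWithin_apply_const₂ {T : V → V₁ →L[ℝ] V₂ →L[ℝ] W} {s : Set V} {y : V}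
    (hs : UniqueDiffWithinAt ℝ s y) (hT : DifferentiableWithinAt ℝ T s y) (v : V₁) (w : V₂)
    (u : V) :
    fderivWithin ℝ (fun z => T z v w) s y u = fderivWithin ℝ T s y u v w := by
  rw [fderivWithin_apply₂ hs hT (differentiableWithinAt_const v) (differentiableWithinAt_const w)]
  simp

theorem ContDiffOn.differentiableWithinAt' {f : V → W} {s : Set V} (hf : ContDiffOn ℝ ∞ f s)
    {y : V} (hy : y ∈ s) : DifferentiableWithinAt ℝ f s y :=
  (hf y hy).differentiableWithinAt (by simp)

theorem ContDiffOn.fderivWithin' {f : V → W} {s : Set V} (hf : ContDiffOn ℝ ∞ f s)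
    (hs : UniqueDiffOn ℝ s) : ContDiffOn ℝ ∞ (fderivWithin ℝ f s) s :=
  hf.fderivWithin hs (by simp)

end Calculus

/-! ### Christoffel symbols of a metric on a set, with derivatives taken within the set -/

section Metric

variable {V : Type*} [NormedAddCommGroup V] [NormedSpace ℝ V]

/-- The Koszul combination `(D u v w + D v u w - D w u v) / 2`. -/
def koszul (D : V →L[ℝ] V →L[ℝ] V →L[ℝ] ℝ) : V →L[ℝ] V →L[ℝ] V →L[ℝ] ℝ :=
  (2⁻¹ : ℝ) • (D + D.flip
    - (ContinuousLinearMap.flipₗᵢ ℝ V V ℝ).toContinuousLinearEquiv.toContinuousLinearMap ∘L D.flip)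

theorem koszul_apply (D : V →L[ℝ] V →L[ℝ] V →L[ℝ] ℝ) (u v w : V) :
    koszul D u v w = (D u v w + D v u w - D w u v) / 2 := by
  simp [koszul]; ring

/-- The Christoffel symbols of the metric `B`, as a field of bilinear maps. -/
def chr (s : Set V) (B : V → V →L[ℝ] V →L[ℝ] ℝ) (y : V) : V →L[ℝ] V →L[ℝ] V :=
  (ContinuousLinearMap.compL ℝ V (V →L[ℝ] ℝ) V (B y).inverse) ∘L koszul (fderivWithin ℝ B s y)

/-- The curvature `R(u,v)w` of the connection with Christoffel symbols `Γ`. -/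
def curv (s : Set V) (Γ : V → V →L[ℝ] V →L[ℝ] V) (y u v w : V) : V :=
  fderivWithin ℝ Γ s y u v w - fderivWithin ℝ Γ s y v u w + Γ y u (Γ y v w) - Γ y v (Γ y u w)

/-- `B` is a smooth Riemannian metric on `s`, where `s` lies in the closure of its interior. -/
structure MetricOn (s : Set V) (B : V → V →L[ℝ] V →L[ℝ] ℝ) : Prop where
  uniq : UniqueDiffOn ℝ s
  dense : s ⊆ closure (interior s)
  smooth : ContDiffOn ℝ ∞ B s
  symm : ∀ y ∈ s, ∀ u v, B y u v = B y v u
  pos : ∀ y ∈ s, ∀ u, u ≠ 0 → 0 < B y u u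

variable [FiniteDimensional ℝ V]

theorem isInvertible_of_pos {B : V →L[ℝ] V →L[ℝ] ℝ} (h : ∀ u, u ≠ 0 → 0 < B u u) :
    B.IsInvertible := by
  have hinj : Function.Injective B.toLinearMap := by
    rw [← LinearMap.ker_eq_bot, LinearMap.ker_eq_bot']
    intro u hu
    by_contra hne
    have := h u hne
    have h0 : B u = 0 := hu
    rw [h0] at this
    simp at this
  have hfr : Module.finrank ℝ V = Module.finrank ℝ (V →L[ℝ] ℝ) := by
    rw [← (LinearMap.toContinuousLinearMap (𝕜 := ℝ) (E := V) (F' := ℝ)).finrank_eq]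
    exact Subspace.dual_finrank_eq.symm
  refine ⟨(LinearEquiv.ofInjectiveOfFinrankEq B.toLinearMap hinj hfr).toContinuousLinearEquiv, ?_⟩
  ext u v
  rfl

namespace MetricOn

variable {s : Set V} {B : V → V →L[ℝ] V →L[ℝ] ℝ}

theorem isInvertible (h : MetricOn s B) {y : V} (hy : y ∈ s) : (B y).IsInvertible :=
  isInvertible_of_pos (h.pos y hy)

theorem ext_left (h : MetricOn s B) {y : V} (hy : y ∈ s) {a b : V} (hab : ∀ w, B y a w = B y b w) :
    a = b := by
  by_contra hne
  have := h.pos y hy (a - b) (sub_ne_zero.mpr hne)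
  simp [hab] at this

theorem apply_inverse (h : MetricOn s B) {y : V} (hy : y ∈ s) (l : V →L[ℝ] ℝ) :
    B y ((B y).inverse l) = l := by
  obtain ⟨e, he⟩ := h.isInvertible hy
  rw [← he, ContinuousLinearMap.inverse_equiv]
  simp

theorem apply_chr (h : MetricOn s B) {y : V} (hy : y ∈ s) (u v w : V) :
    B y (chr s B y u v) w = (fderivWithin ℝ B s y u v w + fderivWithin ℝ B s y v u w
      - fderivWithin ℝ B s y w u v) / 2 := by
  rw [← koszul_apply, chr]
  simp [h.apply_inverse hy]

theorem contDiffOn_chr (h : MetricOn s B) : ContDiffOn ℝ ∞ (chr s B) s := by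
  have h1 : ContDiffOn ℝ ∞ (fun y => (B y).inverse) s := by
    intro y hy
    have := (h.isInvertible hy).contDiffAt_map_inverse (n := ∞)
    exact this.comp_contDiffWithinAt y (h.smooth y hy)
  have h2 : ContDiffOn ℝ ∞ (fun y => koszul (fderivWithin ℝ B s y)) s := by
    have h0 := ContDiffOn.fderivWithin' h.smooth h.uniq
    unfold koszul
    have hf : ContDiffOn ℝ ∞ (fun y => (fderivWithin ℝ B s y).flip) s :=
      (ContinuousLinearMap.flipₗᵢ ℝ V V (V →L[ℝ] ℝ)).contDiff.comp_contDiffOn h0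
    exact ((h0.add hf).sub (contDiffOn_const.clm_comp hf)).const_smul _
  exact ((ContinuousLinearMap.contDiff _).comp_contDiffOn h1).clm_comp h2

theorem fderivWithin_symm (h : MetricOn s B) {y : V} (hy : y ∈ s) (u v w : V) :
    fderivWithin ℝ B s y u v w = fderivWithin ℝ B s y u w v := by
  have hd := ContDiffOn.differentiableWithinAt' h.smooth hy
  rw [← fderivWithin_apply_const₂ (h.uniq y hy) hd, ← fderivWithin_apply_const₂ (h.uniq y hy) hd]
  rw [fderivWithin_congr (fun z hz => h.symm z hz v w) (h.symm y hy v w)]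

theorem chr_symm (h : MetricOn s B) {y : V} (hy : y ∈ s) (u v : V) :
    chr s B y u v = chr s B y v u := by
  refine h.ext_left hy fun w => ?_
  rw [h.apply_chr hy, h.apply_chr hy, h.fderivWithin_symm hy w u v]
  ring

theorem compat (h : MetricOn s B) {y : V} (hy : y ∈ s) (u v w : V) :
    fderivWithin ℝ B s y u v w = B y (chr s B y u v) w + B y v (chr s B y u w) := by
  rw [h.symm y hy v, h.apply_chr hy, h.apply_chr hy, h.fderivWithin_symm hy u w v,
    h.fderivWithin_symm hy w u v, h.fderivWithin_symm hy v u w]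
  ring

/-- Nondegeneracy makes the Koszul formula characterize the connection. This turns a guess for the
Christoffel symbols of a conformal metric into a verification. -/
theorem eq_chr (h : MetricOn s B) {y : V} (hy : y ∈ s) {u v a : V}
    (ha : ∀ w, B y a w = (fderivWithin ℝ B s y u v w + fderivWithin ℝ B s y v u w
      - fderivWithin ℝ B s y w u v) / 2) : a = chr s B y u v :=
  h.ext_left hy fun w => by rw [ha, h.apply_chr hy]

theorem curv_anti (Γ : V → V →L[ℝ] V →L[ℝ] V) (y u v w : V) :
    curv s Γ y u v w = - curv s Γ y v u w := by
  unfold curv; abel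

/-- Schwarz's theorem also holds at boundary points, because `s` lies in the closure of its
interior. -/
theorem isSymmSnd {F : Type*} [NormedAddCommGroup F] [NormedSpace ℝ F] (h : MetricOn s B)
    {f : V → F} (hf : ContDiffOn ℝ ∞ f s) {y : V} (hy : y ∈ s) (u v : V) :
    fderivWithin ℝ (fderivWithin ℝ f s) s y u v = fderivWithin ℝ (fderivWithin ℝ f s) s y v u :=
  ((hf y hy).isSymmSndFDerivWithinAt (by simpa using! ENat.LEInfty.out) h.uniq (h.dense hy) hy) u v

theorem curv_bianchi (h : MetricOn s B) {y : V} (hy : y ∈ s) (u v w : V) :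
    curv s (chr s B) y u v w + curv s (chr s B) y v w u + curv s (chr s B) y w u v = 0 := by
  have hd := ContDiffOn.differentiableWithinAt' h.contDiffOn_chr hy
  have hs : ∀ a b c, fderivWithin ℝ (chr s B) s y a b c = fderivWithin ℝ (chr s B) s y a c b := by
    intro a b c
    rw [← fderivWithin_apply_const₂ (h.uniq y hy) hd, ← fderivWithin_apply_const₂ (h.uniq y hy) hd]
    rw [fderivWithin_congr (fun z hz => h.chr_symm hz b c) (h.chr_symm hy b c)]
  unfold curv
  rw [hs u w v, hs v w u, hs w v u, h.chr_symm hy v w, h.chr_symm hy u w, h.chr_symm hy u v]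
  abel

/-- Differentiating metric compatibility once more expresses the second derivative of `B` through
the connection. Antisymmetrizing in the two directions of differentiation removes the left side and
leaves exactly the two curvature terms. -/
theorem curv_skew (h : MetricOn s B) {y : V} (hy : y ∈ s) (u v w x : V) :
    B y (curv s (chr s B) y u v w) x + B y (curv s (chr s B) y u v x) w = 0 := by
  have hB := ContDiffOn.differentiableWithinAt' h.smooth hy
  have hG := ContDiffOn.differentiableWithinAt' h.contDiffOn_chr hy
  have hDB := ContDiffOn.differentiableWithinAt' (ContDiffOn.fderivWithin' h.smooth h.uniq) hy
  have hU := h.uniq y hy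
  have key : ∀ a b, fderivWithin ℝ (fderivWithin ℝ B s) s y a b w x =
      fderivWithin ℝ B s y a (chr s B y b w) x + B y (fderivWithin ℝ (chr s B) s y a b w) x
      + (fderivWithin ℝ B s y a w (chr s B y b x) + B y w (fderivWithin ℝ (chr s B) s y a b x)) := by
    intro a b
    have hGb : ∀ c, DifferentiableWithinAt ℝ (fun z => chr s B z b c) s y := fun c =>
      (hG.clm_apply (differentiableWithinAt_const b)).clm_apply (differentiableWithinAt_const c)
    have e1 : fderivWithin ℝ (fun z => fderivWithin ℝ B s z b w x) s y a =
        fderivWithin ℝ (fderivWithin ℝ B s) s y a b w x := by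
      rw [fderivWithin_apply_const₂ (T := fun z => fderivWithin ℝ B s z b) hU
        (hDB.clm_apply (differentiableWithinAt_const b)), fderivWithin_apply_const hU hDB]
    rw [← e1, fderivWithin_congr (fun z hz => h.compat hz b w x) (h.compat hy b w x)]
    have e2 : ∀ c, fderivWithin ℝ (fun z => chr s B z b c) s y a =
        fderivWithin ℝ (chr s B) s y a b c := fun c => fderivWithin_apply_const₂ hU hG b c a
    rw [fderivWithin_fun_add hU
      ((hB.clm_apply (hGb w)).clm_apply (differentiableWithinAt_const x))
      ((hB.clm_apply (differentiableWithinAt_const w)).clm_apply (hGb x))]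
    rw [add_apply, fderivWithin_apply₂ hU hB (hGb w)
      (differentiableWithinAt_const x), fderivWithin_apply₂ hU hB (differentiableWithinAt_const w)
      (hGb x), e2, e2]
    simp
  have k1 := key u v
  have k2 := key v u
  rw [h.isSymmSnd h.smooth hy u v, k2] at k1
  simp only [h.compat hy] at k1
  rw [h.symm y hy (curv s (chr s B) y u v x) w]
  simp only [curv, map_add, map_sub, add_apply, sub_apply]
  linarith

end MetricOn

/-- A curvature-like form whose sectional curvatures vanish is zero. -/
theorem eq_zero_of_sectional {A : Type*} [AddCommGroup A] {F : A → A → A → A → ℝ}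
    (add2 : ∀ u v v' w x, F u (v + v') w x = F u v w x + F u v' w x)
    (add3 : ∀ u v w w' x, F u v (w + w') x = F u v w x + F u v w' x)
    (a12 : ∀ u v w x, F u v w x = - F v u w x) (a34 : ∀ u v w x, F u v w x = - F u v x w)
    (bian : ∀ u v w x, F u v w x + F v w u x + F w u v x = 0)
    (sec : ∀ u v, F u v v u = 0) (u v w x : A) : F u v w x = 0 := by
  -- Pair symmetry: add the Bianchi identities of the four cyclic arrangements and cancel with the
  -- two skew symmetries.
  have pair : ∀ u v w x, F u v w x = F w x u v := by
    intro u v w x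
    linarith [bian u v w x, bian v w x u, bian w x u v, bian x u v w, a34 u v w x, a34 v w u x,
      a34 w u v x, a34 v w x u, a34 w x v u, a34 x v w u, a34 x u w v, a34 u w x v, a34 w x u v,
      a12 u v w x, a12 v w u x, a12 w u v x, a34 x v w u, a12 x v w u, a12 x u v w, a12 u v x w,
      a12 v x u w, a34 v x u w, a34 u v x w, a12 u w x v, a34 w u v x, a34 x u v w]
  -- Polarize the sectional curvature in its second vector, then (in `h2`) in its first.
  have h1 : ∀ u v w, F u v w u = 0 := by
    intro u v w
    have e := sec u (v + w)
    rw [add2, add3, add3, sec, sec] at e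
    have := pair u w v u
    have := a12 v u u w
    have := a34 u v u w
    linarith
  have h2 : ∀ u v w x, F u v w x = - F x v w u := by
    intro u v w x
    have e := h1 (u + x) v w
    have e4 : ∀ a b c d d', F a b c (d + d') = F a b c d + F a b c d' := by
      intro a b c d d'
      rw [a34, add3, a34 a b c d, a34 a b c d']; ring
    have e1 : ∀ a a' b c d, F (a + a') b c d = F a b c d + F a' b c d := by
      intro a a' b c d
      rw [a12, add2, a12 a b c d, a12 a' b c d]; ring
    rw [e4, e1, e1, h1, h1] at e
    linarith
  -- By `h2` the form is alternating in all four arguments. A cyclic permutation of three of them is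
  -- even, so Bianchi reads `3 F = 0`.
  linarith [bian u v w x, h2 u v w x, h2 v w u x, h2 w u v x, bian x v w u, a12 u v w x,
    a12 v w u x, a12 w u v x, a34 u v w x, a34 v w u x, a34 w u v x, pair u v w x, pair v w u x,
    pair w u v x, h2 v u w x, h2 w v u x, h2 u w v x, pair x v w u, pair x w u v, pair x u v w,
    a34 x v w u, a34 x w u v, a34 x u v w, a12 x v w u, a12 x w u v, a12 x u v w]

end Metric

/-! ### Conformal change of a metric by a distance function -/

section Conformal

variable {V : Type*} [NormedAddCommGroup V] [NormedSpace ℝ V]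

theorem fderivWithin_of_isOpen_subset {F : Type*} [NormedAddCommGroup F] [NormedSpace ℝ F]
    {f : V → F} {O s : Set V} (hO : IsOpen O) (h : O ⊆ s) {y : V} (hy : y ∈ O) :
    fderivWithin ℝ f O y = fderivWithin ℝ f s y := by
  rw [fderivWithin_of_mem_nhds (hO.mem_nhds hy),
    fderivWithin_of_mem_nhds (Filter.mem_of_superset (hO.mem_nhds hy) h)]

theorem chr_of_isOpen_subset {B : V → V →L[ℝ] V →L[ℝ] ℝ} {O s : Set V} (hO : IsOpen O)
    (h : O ⊆ s) {y : V} (hy : y ∈ O) : chr O B y = chr s B y := by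
  rw [chr, chr, fderivWithin_of_isOpen_subset hO h hy]

theorem curv_of_isOpen_subset {B : V → V →L[ℝ] V →L[ℝ] ℝ} {O s : Set V} (hO : IsOpen O)
    (h : O ⊆ s) {y : V} (hy : y ∈ O) : curv O (chr O B) y = curv s (chr s B) y := by
  ext u v w
  have : fderivWithin ℝ (chr O B) O y = fderivWithin ℝ (chr s B) s y := by
    rw [← fderivWithin_of_isOpen_subset hO h hy]
    exact fderivWithin_congr (fun z hz => chr_of_isOpen_subset hO h hz)
      (chr_of_isOpen_subset hO h hy)
  rw [curv, curv, this, chr_of_isOpen_subset hO h hy]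

/-- The conformal metric `ρ⁻² B`. -/
def conf (ρ : V → ℝ) (B : V → V →L[ℝ] V →L[ℝ] ℝ) (y : V) : V →L[ℝ] V →L[ℝ] ℝ :=
  (ρ y ^ 2)⁻¹ • B y

/-- The covariant derivative `∇N` of a vector field `N` with respect to the metric `B`. -/
def cov (s : Set V) (B : V → V →L[ℝ] V →L[ℝ] ℝ) (N : V → V) (y : V) : V →L[ℝ] V :=
  fderivWithin ℝ N s y + (chr s B y).flip (N y)

theorem cov_apply (s : Set V) (B : V → V →L[ℝ] V →L[ℝ] ℝ) (N : V → V) (y u : V) :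
    cov s B N y u = fderivWithin ℝ N s y u + chr s B y u (N y) := by simp [cov]

variable [FiniteDimensional ℝ V]

/-- `N` is the gradient of the function `ρ` with respect to the metric `B` on `s`. -/
structure GradientOn (s : Set V) (B : V → V →L[ℝ] V →L[ℝ] ℝ) (ρ : V → ℝ) (N : V → V) : Prop
    extends MetricOn s B where
  smooth_fun : ContDiffOn ℝ ∞ ρ s
  grad : ∀ y ∈ s, ∀ v, B y (N y) v = fderivWithin ℝ ρ s y v

theorem MetricOn.mono {s O : Set V} {B : V → V →L[ℝ] V →L[ℝ] ℝ} (h : MetricOn s B) (hO : IsOpen O)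
    (hs : O ⊆ s) : MetricOn O B where
  uniq := hO.uniqueDiffOn
  dense := by rw [hO.interior_eq]; exact subset_closure
  smooth := h.smooth.mono hs
  symm y hy := h.symm y (hs hy)
  pos y hy := h.pos y (hs hy)

namespace GradientOn

variable {s O : Set V} {B : V → V →L[ℝ] V →L[ℝ] ℝ} {ρ : V → ℝ} {N : V → V}

theorem mono_open (h : GradientOn s B ρ N) (hO : IsOpen O) (hs : O ⊆ s) : GradientOn O B ρ N where
  toMetricOn := h.toMetricOn.mono hO hs
  smooth_fun := h.smooth_fun.mono hs
  grad y hy v := by rw [h.grad y (hs hy), fderivWithin_of_isOpen_subset hO hs hy]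

theorem contDiffOn_grad (h : GradientOn s B ρ N) : ContDiffOn ℝ ∞ N s := by
  have h1 : ContDiffOn ℝ ∞ (fun y => (B y).inverse) s := by
    intro y hy
    have := (h.isInvertible hy).contDiffAt_map_inverse (n := ∞)
    exact this.comp_contDiffWithinAt y (h.smooth y hy)
  refine (h1.clm_apply (ContDiffOn.fderivWithin' h.smooth_fun h.uniq)).congr fun y hy => ?_
  refine h.ext_left hy fun w => ?_
  rw [h.grad y hy, h.apply_inverse hy]

/-- The Hessian of `ρ` is `B(∇N, ·)`. -/
theorem hess (h : GradientOn s B ρ N) {y : V} (hy : y ∈ s) (u v : V) :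
    fderivWithin ℝ (fderivWithin ℝ ρ s) s y u v =
      B y (cov s B N y u) v + fderivWithin ℝ ρ s y (chr s B y u v) := by
  have hU := h.uniq y hy
  have hdd := ContDiffOn.differentiableWithinAt' (ContDiffOn.fderivWithin' h.smooth_fun h.uniq) hy
  rw [← fderivWithin_apply_const hU hdd, ← fderivWithin_congr (fun z hz => h.grad z hz v)
    (h.grad y hy v), fderivWithin_apply₂ hU (ContDiffOn.differentiableWithinAt' h.smooth hy)
    (ContDiffOn.differentiableWithinAt' h.contDiffOn_grad hy) (differentiableWithinAt_const v),
    h.compat hy, ← h.grad y hy, cov_apply]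
  simp
  ring

/-- Second derivatives commute and the connection has no torsion, so the Hessian is symmetric; hence
`∇N` is self-adjoint. -/
theorem cov_symm (h : GradientOn s B ρ N) {y : V} (hy : y ∈ s) (u v : V) :
    B y (cov s B N y u) v = B y (cov s B N y v) u := by
  have h1 := h.hess hy u v
  have h2 := h.hess hy v u
  rw [h.isSymmSnd h.smooth_fun hy, h2, h.chr_symm hy] at h1
  linarith

/-- Differentiate `|N|² = 1`. With `cov_symm` this also yields `∇_N N = 0`: the integral curves of a
unit gradient are geodesics. -/
theorem cov_apply_inner (h : GradientOn s B ρ N) (hunit : ∀ y ∈ s, B y (N y) (N y) = 1) {y : V}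
    (hy : y ∈ s) (u : V) : B y (cov s B N y u) (N y) = 0 := by
  have hU := h.uniq y hy
  have hN := ContDiffOn.differentiableWithinAt' h.contDiffOn_grad hy
  have e := fderivWithin_apply₂ hU (ContDiffOn.differentiableWithinAt' h.smooth hy) hN hN u
  rw [fderivWithin_congr hunit (hunit y hy), h.compat hy, fderivWithin_const_apply,
    h.symm y hy (N y), h.symm y hy (N y)] at e
  simp only [zero_apply] at e
  rw [cov_apply, map_add, add_apply]
  linarith

theorem cov_self (h : GradientOn s B ρ N) (hunit : ∀ y ∈ s, B y (N y) (N y) = 1) {y : V}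
    (hy : y ∈ s) : cov s B N y (N y) = 0 := by
  refine h.ext_left hy fun w => ?_
  rw [h.cov_symm hy, h.cov_apply_inner hunit hy]; simp

theorem conf_metricOn (h : GradientOn O B ρ N) (hpos : ∀ y ∈ O, 0 < ρ y) :
    MetricOn O (conf ρ B) where
  uniq := h.uniq
  dense := h.dense
  smooth := ((h.smooth_fun.pow 2).inv fun y hy => (pow_pos (hpos y hy) 2).ne').smul h.smooth
  symm y hy u v := by simp [conf, h.symm y hy u v]
  pos y hy u hu := by
    have := h.pos y hy u hu
    have := hpos y hy
    simp only [conf, smul_apply, smul_eq_mul]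
    positivity

theorem fderivWithin_conf (h : GradientOn O B ρ N) (hpos : ∀ y ∈ O, 0 < ρ y) {y : V} (hy : y ∈ O)
    (u v w : V) : fderivWithin ℝ (conf ρ B) O y u v w =
      (ρ y ^ 2)⁻¹ * (fderivWithin ℝ B O y u v w - 2 * (ρ y)⁻¹ * B y (N y) u * B y v w) := by
  have hU := h.uniq y hy
  have hρ := (ContDiffOn.differentiableWithinAt' h.smooth_fun hy).hasFDerivWithinAt
  have hB := ContDiffOn.differentiableWithinAt' h.smooth hy
  have hc := ContDiffOn.differentiableWithinAt' (h.conf_metricOn hpos).smooth hy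
  have hB' : HasFDerivWithinAt (fun z => B z v w)
      (fderivWithin ℝ (fun z => B z v w) O y) O y :=
    ((hB.clm_apply (differentiableWithinAt_const v)).clm_apply
      (differentiableWithinAt_const w)).hasFDerivWithinAt
  have hi := ((hasDerivAt_inv (pow_pos (hpos y hy) 2).ne').comp_hasFDerivWithinAt y
    (hρ.pow 2)).mul hB'
  rw [← fderivWithin_apply_const₂ hU hc]
  have e : (fun z => conf ρ B z v w) = fun z => (ρ z ^ 2)⁻¹ * B z v w := by
    ext z; simp [conf]
  rw [e]
  have e2 := hi.fderivWithin hU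
  have e3 := congrArg (fun L : V →L[ℝ] ℝ => L u) e2
  refine Eq.trans e3 ?_
  have := (hpos y hy).ne'
  simp only [add_apply, smul_apply, fderivWithin_apply_const₂ hU hB, h.grad y hy, smul_eq_mul,
    Function.comp]
  simp
  field_simp
  ring

theorem chr_conf (h : GradientOn O B ρ N) (hpos : ∀ y ∈ O, 0 < ρ y) {y : V} (hy : y ∈ O)
    (u v : V) : chr O (conf ρ B) y u v = chr O B y u v - (ρ y)⁻¹ •
      (B y (N y) u • v + B y (N y) v • u - B y u v • N y) := by
  symm
  refine (h.conf_metricOn hpos).eq_chr hy fun w => ?_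
  rw [h.fderivWithin_conf hpos hy, h.fderivWithin_conf hpos hy, h.fderivWithin_conf hpos hy]
  simp only [conf, smul_apply, map_sub, map_smul, map_add, sub_apply, add_apply, smul_eq_mul,
    h.apply_chr hy]
  ring

/-- Derivatives of `B`, of `dρ` and of `N` are all rewritten through the connection and `∇N`, so
that the cancellations in `curv_conf` become purely algebraic. -/
theorem fderivWithin_chr_conf (h : GradientOn O B ρ N) (hpos : ∀ y ∈ O, 0 < ρ y) {y : V}
    (hy : y ∈ O) (u v w : V) : fderivWithin ℝ (chr O (conf ρ B)) O y u v w =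
      fderivWithin ℝ (chr O B) O y u v w
      + ((ρ y)⁻¹ ^ 2 * B y (N y) u) • (B y (N y) v • w + B y (N y) w • v - B y v w • N y)
      - (ρ y)⁻¹ • ((B y (cov O B N y u) v + B y (N y) (chr O B y u v)) • w
        + (B y (cov O B N y u) w + B y (N y) (chr O B y u w)) • v
        - (B y (chr O B y u v) w + B y v (chr O B y u w)) • N y
        - B y v w • (cov O B N y u - chr O B y u (N y))) := by
  have hU := h.uniq y hy
  have hG := ContDiffOn.differentiableWithinAt' h.contDiffOn_chr hy
  have hB := ContDiffOn.differentiableWithinAt' h.smooth hy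
  have hρ := ContDiffOn.differentiableWithinAt' h.smooth_fun hy
  have hN := ContDiffOn.differentiableWithinAt' h.contDiffOn_grad hy
  have hdd := ContDiffOn.differentiableWithinAt' (ContDiffOn.fderivWithin' h.smooth_fun h.uniq) hy
  have hd : ∀ x, DifferentiableWithinAt ℝ (fun z => fderivWithin ℝ ρ O z x) O y := fun x =>
    hdd.clm_apply (differentiableWithinAt_const x)
  have hBvw : DifferentiableWithinAt ℝ (fun z => B z v w) O y :=
    (hB.clm_apply (differentiableWithinAt_const v)).clm_apply (differentiableWithinAt_const w)
  have hGvw : DifferentiableWithinAt ℝ (fun z => chr O B z v w) O y :=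
    (hG.clm_apply (differentiableWithinAt_const v)).clm_apply (differentiableWithinAt_const w)
  have hi := (hasDerivAt_inv (hpos y hy).ne').comp_hasFDerivWithinAt y hρ.hasFDerivWithinAt
  have hC := hGvw.hasFDerivWithinAt.sub (hi.smul ((((hd v).hasFDerivWithinAt.smul_const w).add
    ((hd w).hasFDerivWithinAt.smul_const v)).sub
      (hBvw.hasFDerivWithinAt.smul hN.hasFDerivWithinAt)))
  rw [← fderivWithin_apply_const₂ hU (ContDiffOn.differentiableWithinAt'
    (h.conf_metricOn hpos).contDiffOn_chr hy)]
  have e : ∀ z ∈ O, chr O (conf ρ B) z v w = chr O B z v w - (ρ z)⁻¹ •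
      (fderivWithin ℝ ρ O z v • w + fderivWithin ℝ ρ O z w • v - B z v w • N z) := by
    intro z hz
    rw [h.chr_conf hpos hz, h.grad z hz, h.grad z hz]
  rw [fderivWithin_congr e (e y hy)]
  have e3 := congrArg (fun L : V →L[ℝ] V => L u) (hC.fderivWithin hU)
  refine Eq.trans e3 ?_
  have c1 : fderivWithin ℝ N O y u = cov O B N y u - chr O B y u (N y) := by
    rw [cov_apply]; abel
  simp only [sub_apply, add_apply, smul_apply, ContinuousLinearMap.smulRight_apply,
    fderivWithin_apply_const₂ hU hB, fderivWithin_apply_const₂ hU hG,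
    fderivWithin_apply_const hU hdd, h.hess hy, h.compat hy, c1, ← h.grad y hy, Function.comp]
  simp only [smul_eq_mul, Pi.sub_apply, Pi.smul_apply', Pi.add_apply, ← h.grad y hy]
  match_scalars <;> ring

/-- With `φ = -log ρ` the metric is `e^{2φ} B`. Here `∇dφ - dφ ⊗ dφ` reduces to `-ρ⁻¹ Hess ρ`, and
`|dφ|² = ρ⁻²` because `N` is a unit field. So only terms linear in `∇N` and a term of constant
curvature type remain. -/
theorem curv_conf (h : GradientOn O B ρ N) (hpos : ∀ y ∈ O, 0 < ρ y)
    (hunit : ∀ y ∈ O, B y (N y) (N y) = 1) {y : V} (hy : y ∈ O) (u v w : V) :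
    curv O (chr O (conf ρ B)) y u v w = curv O (chr O B) y u v w
      - (ρ y)⁻¹ • (B y (cov O B N y u) w • v - B y (cov O B N y v) w • u
        - B y v w • cov O B N y u + B y u w • cov O B N y v)
      - ((ρ y)⁻¹ ^ 2) • (B y v w • u - B y u w • v) := by
  have hG := h.chr_symm hy v u
  have hu := hunit y hy
  have hc := h.cov_symm hy v u
  unfold curv
  rw [h.fderivWithin_chr_conf hpos hy, h.fderivWithin_chr_conf hpos hy]
  simp only [h.chr_conf hpos hy, map_sub, map_add, map_smul, smul_eq_mul,
    hG, hu, hc, h.symm y hy v u, h.symm y hy u (N y), h.symm y hy v (N y),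
    h.symm y hy v (chr O B y u w), h.symm y hy u (chr O B y v w),
    h.symm y hy (chr O B y u v) w]
  match_scalars <;> ring

end GradientOn

end Conformal

/-! ### The structure of a compactified hyperbolic metric -/

section Hyperbolic

variable {V : Type*} [NormedAddCommGroup V] [NormedSpace ℝ V] [FiniteDimensional ℝ V]

/-- `ρ` is a distance function for the metric `B` on `s`, with gradient `N`, such that `ρ⁻² B` has
constant sectional curvature `-1` in the interior of `s`. -/
structure HypOn (s : Set V) (B : V → V →L[ℝ] V →L[ℝ] ℝ) (ρ : V → ℝ) (N : V → V) : Prop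
    extends GradientOn s B ρ N where
  unit : ∀ y ∈ s, B y (N y) (N y) = 1
  pos_int : ∀ y ∈ interior s, 0 < ρ y
  sec : ∀ y ∈ interior s, ∀ u v, conf ρ B y
    (curv (interior s) (chr (interior s) (conf ρ B)) y u v v) u =
      -(conf ρ B y u u * conf ρ B y v v - conf ρ B y u v ^ 2)

/-- The curvature operator `u ↦ R(u, N) N` of the connection `Γ`. -/
def shape (s : Set V) (Γ : V → V →L[ℝ] V →L[ℝ] V) (N : V → V) (y : V) : V →L[ℝ] V :=
  ((fderivWithin ℝ Γ s y).flip (N y)).flip (N y) - (fderivWithin ℝ Γ s y (N y)).flip (N y)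
    + (Γ y).flip (Γ y (N y) (N y)) - (Γ y (N y)) ∘L ((Γ y).flip (N y))

theorem shape_apply (s : Set V) (Γ : V → V →L[ℝ] V →L[ℝ] V) (N : V → V) (y u : V) :
    shape s Γ N y u = curv s Γ y u (N y) (N y) := by
  simp [shape, curv]

theorem continuousOn_curv {s : Set V} {Γ : V → V →L[ℝ] V →L[ℝ] V} (hs : UniqueDiffOn ℝ s)
    (hΓ : ContDiffOn ℝ ∞ Γ s) {f g h : V → V} (hf : ContDiffOn ℝ ∞ f s) (hg : ContDiffOn ℝ ∞ g s)
    (hh : ContDiffOn ℝ ∞ h s) : ContDiffOn ℝ ∞ (fun y => curv s Γ y (f y) (g y) (h y)) s := by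
  have hd := ContDiffOn.fderivWithin' hΓ hs
  exact ((((hd.clm_apply hf).clm_apply hg).clm_apply hh).sub
    (((hd.clm_apply hg).clm_apply hf).clm_apply hh)).add
    ((hΓ.clm_apply hf).clm_apply ((hΓ.clm_apply hg).clm_apply hh)) |>.sub
    ((hΓ.clm_apply hg).clm_apply ((hΓ.clm_apply hf).clm_apply hh))

/-- The Ricci identity: in the antisymmetrized second covariant derivative of `N` the second partial
derivatives cancel by Schwarz, and the rest is curvature. -/
theorem cov_exterior {s : Set V} {B : V → V →L[ℝ] V →L[ℝ] ℝ} {N : V → V} (h : MetricOn s B)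
    (hN : ContDiffOn ℝ ∞ N s) {y : V} (hy : y ∈ s) (u v : V) :
    fderivWithin ℝ (cov s B N) s y u v + chr s B y u (cov s B N y v)
      - (fderivWithin ℝ (cov s B N) s y v u + chr s B y v (cov s B N y u)) =
      curv s (chr s B) y u v (N y) := by
  have hU := h.uniq y hy
  have hG := ContDiffOn.differentiableWithinAt' h.contDiffOn_chr hy
  have hNd := ContDiffOn.differentiableWithinAt' hN hy
  have hdd := ContDiffOn.differentiableWithinAt' (ContDiffOn.fderivWithin' hN h.uniq) hy
  have hflip : ContDiffOn ℝ ∞ (fun z => (chr s B z).flip) s :=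
    (ContinuousLinearMap.flipₗᵢ ℝ V V V).contDiff.comp_contDiffOn h.contDiffOn_chr
  have hcov : DifferentiableWithinAt ℝ (cov s B N) s y :=
    hdd.add ((ContDiffOn.differentiableWithinAt' hflip hy).clm_apply hNd)
  have key : ∀ a b, fderivWithin ℝ (cov s B N) s y a b =
      fderivWithin ℝ (fderivWithin ℝ N s) s y a b + (fderivWithin ℝ (chr s B) s y a b (N y)
        + chr s B y b (fderivWithin ℝ N s y a)) := by
    intro a b
    rw [← fderivWithin_apply_const hU hcov]
    simp only [cov_apply]
    rw [fderivWithin_fun_add hU (hdd.clm_apply (differentiableWithinAt_const b))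
      ((hG.clm_apply (differentiableWithinAt_const b)).clm_apply hNd), add_apply,
      fderivWithin_apply_const hU hdd, fderivWithin_apply₂ hU hG (differentiableWithinAt_const b)
      hNd]
    simp
  rw [key, key, h.isSymmSnd hN hy v u, cov_apply, cov_apply, curv]
  simp only [map_add]
  abel

/-! ### Curvature, shape operator and Codazzi equation up to the boundary. -/

namespace HypOn

variable {s : Set V} {B : V → V →L[ℝ] V →L[ℝ] ℝ} {ρ : V → ℝ} {N : V → V}

theorem gradientOn_interior (h : HypOn s B ρ N) : GradientOn (interior s) B ρ N :=
  h.toGradientOn.mono_open isOpen_interior interior_subset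

/-- Every identity that requires division by `ρ` is proved in the interior, where `ρ > 0`, and
reaches the zero set of `ρ` by density. -/
theorem eqOn_of_interior (h : HypOn s B ρ N) {F : Type*} [TopologicalSpace F] [T2Space F]
    {f g : V → F} (hf : ContinuousOn f s) (hg : ContinuousOn g s)
    (hfg : ∀ y ∈ interior s, f y = g y) : ∀ y ∈ s, f y = g y :=
  Set.EqOn.of_subset_closure (s := interior s) hfg hf hg interior_subset h.dense

/-- The difference of the curvature tensor and the model tensor of curvature `-1` has all curvature
symmetries and vanishing sectional curvatures, so `eq_zero_of_sectional` applies. -/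
theorem curv_conf_eq (h : HypOn s B ρ N) {y : V} (hy : y ∈ interior s) (u v w : V) :
    curv (interior s) (chr (interior s) (conf ρ B)) y u v w =
      -(conf ρ B y v w • u - conf ρ B y u w • v) := by
  set O := interior s
  have hc : MetricOn O (conf ρ B) := h.gradientOn_interior.conf_metricOn h.pos_int
  set R := curv O (chr O (conf ρ B)) y with hR
  set G := conf ρ B y with hG
  have hsym := hc.symm y hy
  have Radd2 : ∀ u v v' w, R u (v + v') w = R u v w + R u v' w := by
    intro u v v' w; simp only [hR, curv, map_add, add_apply]; abel
  have Radd3 : ∀ u v w w', R u v (w + w') = R u v w + R u v w' := by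
    intro u v v' w; simp only [hR, curv, map_add]; abel
  have hz := eq_zero_of_sectional
    (F := fun u v w x => G (R u v w) x + (G v w * G u x - G u w * G v x))
    (fun u v v' w x => by simp only [Radd2, map_add, add_apply]; ring)
    (fun u v v' w x => by simp only [Radd3, map_add, add_apply]; ring)
    (fun u v w x => by
      have : R u v w = - R v u w := MetricOn.curv_anti _ _ _ _ _
      simp only [this, map_neg, neg_apply]; ring)
    (fun u v w x => by
      have := hc.curv_skew hy u v w x
      change G (R u v w) x + G (R u v x) w = 0 at this
      linarith)
    (fun u v w x => by
      have := congrArg (fun a => G a x) (hc.curv_bianchi hy u v w)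
      change G (R u v w + R v w u + R w u v) x = G 0 x at this
      simp only [map_add, add_apply, map_zero, zero_apply] at this
      have e1 : G u v = G v u := hsym u v
      have e2 : G u w = G w u := hsym u w
      have e3 : G v w = G w v := hsym v w
      rw [e1, e2, e3]
      linarith)
    (fun u v => by
      have := h.sec y hy u v
      change G (R u v v) u = -(G u u * G v v - G u v ^ 2) at this
      have e1 : G u v = G v u := hsym u v
      rw [this, e1]; ring)
    u v w
  refine hc.ext_left hy fun x => ?_
  have := hz x
  simp only [map_neg, map_sub, map_smul, neg_apply, sub_apply, smul_apply, smul_eq_mul]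
  change G (R u v w) x = _
  linarith

/-- The `ρ⁻²` term of the conformal change formula equals the curvature `-1` tensor of `ρ⁻² B` and
drops out. -/
theorem curv_interior (h : HypOn s B ρ N) {y : V} (hy : y ∈ interior s) (u v w : V) :
    curv s (chr s B) y u v w =
      (ρ y)⁻¹ • (B y (cov s B N y u) w • v - B y (cov s B N y v) w • u
        - B y v w • cov s B N y u + B y u w • cov s B N y v) := by
  have e := h.gradientOn_interior.curv_conf h.pos_int
    (fun y hy => h.unit y (interior_subset hy)) hy u v w
  rw [h.curv_conf_eq hy, curv_of_isOpen_subset isOpen_interior interior_subset hy] at e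
  have hcov : cov (interior s) B N y = cov s B N y := by
    rw [cov, cov, fderivWithin_of_isOpen_subset isOpen_interior interior_subset hy,
      chr_of_isOpen_subset isOpen_interior interior_subset hy]
  rw [hcov] at e
  rw [sub_sub, eq_sub_iff_add_eq] at e
  rw [← e]
  simp only [conf, smul_apply, smul_eq_mul]
  match_scalars <;> simp

theorem contDiffOn_shape (h : HypOn s B ρ N) : ContDiffOn ℝ ∞ (shape s (chr s B) N) s := by
  rw [contDiffOn_clm_apply]
  intro u
  simp only [shape_apply]
  exact continuousOn_curv h.uniq h.contDiffOn_chr contDiffOn_const h.contDiffOn_grad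
    h.contDiffOn_grad

theorem contDiffOn_cov (h : HypOn s B ρ N) : ContDiffOn ℝ ∞ (cov s B N) s := by
  have hflip : ContDiffOn ℝ ∞ (fun z => (chr s B z).flip) s :=
    (ContinuousLinearMap.flipₗᵢ ℝ V V V).contDiff.comp_contDiffOn h.contDiffOn_chr
  exact (ContDiffOn.fderivWithin' h.contDiffOn_grad h.uniq).add (hflip.clm_apply h.contDiffOn_grad)

/-- Put `v = w = N` in `curv_interior`. Since `∇N` annihilates `N` and takes values orthogonal to
`N`, only `R(u, N) N = -ρ⁻¹ ∇_u N` survives. The left side is smooth up to the boundary, so this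
also shows that `∇N` vanishes where `ρ = 0`, and that `shape` is the smooth extension of `-ρ⁻¹ ∇N`.
-/
theorem cov_eq (h : HypOn s B ρ N) {y : V} (hy : y ∈ s) (u : V) :
    cov s B N y u = -(ρ y • shape s (chr s B) N y u) := by
  refine h.eqOn_of_interior (f := fun y => cov s B N y u)
    (g := fun y => -(ρ y • shape s (chr s B) N y u)) ?_ ?_ ?_ y hy
  · exact (h.contDiffOn_cov.clm_apply contDiffOn_const).continuousOn
  · exact (h.smooth_fun.smul (h.contDiffOn_shape.clm_apply contDiffOn_const)).neg.continuousOn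
  · intro y hy
    have hy' := interior_subset hy
    have hρ := (h.pos_int y hy).ne'
    rw [shape_apply, h.curv_interior hy, h.cov_symm hy' (N y), h.cov_self h.unit hy', h.unit y hy',
      smul_smul, mul_inv_cancel₀ hρ]
    simp [h.cov_apply_inner h.unit hy']

theorem shape_symm (h : HypOn s B ρ N) {y : V} (hy : y ∈ s) (u v : V) :
    B y (shape s (chr s B) N y u) v = B y (shape s (chr s B) N y v) u := by
  have hs : ∀ a b, ContinuousOn (fun y => B y (shape s (chr s B) N y a) b) s := fun a b =>
    ((h.smooth.clm_apply (h.contDiffOn_shape.clm_apply contDiffOn_const)).clm_apply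
      contDiffOn_const).continuousOn
  refine h.eqOn_of_interior (hs u v) (hs v u) ?_ y hy
  intro y hy
  have hy' := interior_subset hy
  have := h.cov_symm hy' u v
  rw [h.cov_eq hy', h.cov_eq hy'] at this
  simp only [map_neg, map_smul, neg_apply, smul_apply, smul_eq_mul, neg_inj] at this
  exact mul_left_cancel₀ (h.pos_int y hy).ne' this

theorem shape_normal (s : Set V) (B : V → V →L[ℝ] V →L[ℝ] ℝ) (N : V → V) (y : V) :
    shape s (chr s B) N y (N y) = 0 := by
  rw [shape_apply]
  have := MetricOn.curv_anti (s := s) (chr s B) y (N y) (N y) (N y)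
  have h2 : (2 : ℝ) • curv s (chr s B) y (N y) (N y) (N y) = 0 := by
    rw [two_smul]; nth_rewrite 1 [this]; simp
  simpa using h2

/-- Inserting `∇N = -ρ A` cancels the factor `ρ⁻¹` of `curv_interior`. The result is the
Kulkarni-Nomizu form that reflects conformal flatness. -/
theorem curv_eq (h : HypOn s B ρ N) {y : V} (hy : y ∈ s) (u v w : V) :
    curv s (chr s B) y u v w = - B y (shape s (chr s B) N y u) w • v
      + B y (shape s (chr s B) N y v) w • u + B y v w • shape s (chr s B) N y u
      - B y u w • shape s (chr s B) N y v := by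
  have hs : ∀ a, ContDiffOn ℝ ∞ (fun y => shape s (chr s B) N y a) s := fun a =>
    h.contDiffOn_shape.clm_apply contDiffOn_const
  have hBs : ∀ a b, ContDiffOn ℝ ∞ (fun y => B y (shape s (chr s B) N y a) b) s := fun a b =>
    (h.smooth.clm_apply (hs a)).clm_apply contDiffOn_const
  have hB : ∀ a b, ContDiffOn ℝ ∞ (fun y => B y a b) s := fun a b =>
    (h.smooth.clm_apply contDiffOn_const).clm_apply contDiffOn_const
  refine h.eqOn_of_interior (f := fun y => curv s (chr s B) y u v w)
    (g := fun y => - B y (shape s (chr s B) N y u) w • v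
      + B y (shape s (chr s B) N y v) w • u + B y v w • shape s (chr s B) N y u
      - B y u w • shape s (chr s B) N y v) (continuousOn_curv h.uniq h.contDiffOn_chr contDiffOn_const
    contDiffOn_const contDiffOn_const).continuousOn
    (((((hBs u w).neg.smul contDiffOn_const).add ((hBs v w).smul contDiffOn_const)).add
      ((hB v w).smul (hs u))).sub ((hB u w).smul (hs v))).continuousOn ?_ y hy
  intro y hy
  have hy' := interior_subset hy
  have hρ := (h.pos_int y hy).ne'
  rw [h.curv_interior hy]
  simp only [h.cov_eq hy', map_neg, map_smul, neg_apply, smul_apply, smul_eq_mul]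
  match_scalars <;> field_simp

/-- Insert `∇N = -ρ A` in the Ricci identity. The terms in which `ρ` is differentiated are exactly
`R(u, v) N` as given by `curv_eq` with `A N = 0`; what is left is `ρ` times the Codazzi defect of
`A`. -/
theorem codazzi (h : HypOn s B ρ N) {y : V} (hy : y ∈ s) (u v : V) :
    fderivWithin ℝ (shape s (chr s B) N) s y u v + chr s B y u (shape s (chr s B) N y v) =
      fderivWithin ℝ (shape s (chr s B) N) s y v u + chr s B y v (shape s (chr s B) N y u) := by
  have hc : ∀ a b, ContinuousOn (fun y => fderivWithin ℝ (shape s (chr s B) N) s y a b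
      + chr s B y a (shape s (chr s B) N y b)) s := fun a b =>
    ((((ContDiffOn.fderivWithin' h.contDiffOn_shape h.uniq).clm_apply
      contDiffOn_const).clm_apply contDiffOn_const).add ((h.contDiffOn_chr.clm_apply
      contDiffOn_const).clm_apply
        (h.contDiffOn_shape.clm_apply contDiffOn_const))).continuousOn
  refine h.eqOn_of_interior (hc u v) (hc v u) ?_ y hy
  intro y hy
  have hy' := interior_subset hy
  have hρ := (h.pos_int y hy).ne'
  have hU := h.uniq y hy'
  have hS := ContDiffOn.differentiableWithinAt' h.contDiffOn_shape hy'
  have hr := ContDiffOn.differentiableWithinAt' h.smooth_fun hy'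
  have e := cov_exterior h.toMetricOn h.contDiffOn_grad hy' u v
  have key : ∀ a b, fderivWithin ℝ (cov s B N) s y a b =
      -(ρ y • fderivWithin ℝ (shape s (chr s B) N) s y a b
        + B y (N y) a • shape s (chr s B) N y b) := by
    intro a b
    have hd := (hr.hasFDerivWithinAt.smul (hS.clm_apply
      (differentiableWithinAt_const b)).hasFDerivWithinAt).neg.fderivWithin hU
    rw [← fderivWithin_apply_const hU (ContDiffOn.differentiableWithinAt' h.contDiffOn_cov hy'),
      fderivWithin_congr (fun z hz => h.cov_eq hz b) (h.cov_eq hy' b)]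
    refine (congrArg (fun L : V →L[ℝ] V => L a) hd).trans ?_
    simp [fderivWithin_apply_const hU hS, h.grad y hy']
  rw [key, key, h.cov_eq hy', h.cov_eq hy', h.curv_eq hy', h.shape_symm hy' u,
    h.shape_symm hy' v, HypOn.shape_normal s B N _, h.symm y hy' v (N y), h.symm y hy' u (N y)] at e
  simp only [map_neg, map_smul, map_zero, zero_apply, zero_smul, neg_zero] at e
  refine smul_right_injective V hρ ?_
  simp only [smul_add]
  rw [← sub_eq_zero] at e ⊢
  rw [← neg_eq_zero, ← e]
  module

end HypOn

end Hyperbolic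

/-! ### Isometric immersions -/

section Immersion

variable {V₁ V : Type*} [NormedAddCommGroup V₁] [NormedSpace ℝ V₁] [FiniteDimensional ℝ V₁]
  [NormedAddCommGroup V] [NormedSpace ℝ V] [FiniteDimensional ℝ V]

/-- The pullback of a field of bilinear forms under `ψ`. -/
def pull (s₁ : Set V₁) (ψ : V₁ → V) (T : V → V →L[ℝ] V →L[ℝ] ℝ) (y : V₁) :
    V₁ →L[ℝ] V₁ →L[ℝ] ℝ :=
  (T (ψ y)).bilinearComp (fderivWithin ℝ ψ s₁ y) (fderivWithin ℝ ψ s₁ y)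

theorem pull_apply (s₁ : Set V₁) (ψ : V₁ → V) (T : V → V →L[ℝ] V →L[ℝ] ℝ) (y u v : V₁) :
    pull s₁ ψ T y u v = T (ψ y) (fderivWithin ℝ ψ s₁ y u) (fderivWithin ℝ ψ s₁ y v) := rfl

theorem contDiffOn_pull {s₁ : Set V₁} {s : Set V} {ψ : V₁ → V} {T : V → V →L[ℝ] V →L[ℝ] ℝ}
    (hs : UniqueDiffOn ℝ s₁) (hψ : ContDiffOn ℝ ∞ ψ s₁) (hT : ContDiffOn ℝ ∞ T s)
    (hm : MapsTo ψ s₁ s) : ContDiffOn ℝ ∞ (pull s₁ ψ T) s₁ := by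
  have hD := ContDiffOn.fderivWithin' hψ hs
  have hc := hT.comp hψ hm
  rw [contDiffOn_clm_apply]
  intro u
  rw [contDiffOn_clm_apply]
  intro v
  exact (hc.clm_apply (hD.clm_apply contDiffOn_const)).clm_apply (hD.clm_apply contDiffOn_const)

/-- `ψ` is a smooth isometric immersion of `(s₁, G)` into `(s, B)`. -/
structure IsometricOn (s₁ : Set V₁) (s : Set V) (G : V₁ → V₁ →L[ℝ] V₁ →L[ℝ] ℝ)
    (B : V → V →L[ℝ] V →L[ℝ] ℝ) (ψ : V₁ → V) : Prop where
  source : MetricOn s₁ G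
  target : MetricOn s B
  smooth : ContDiffOn ℝ ∞ ψ s₁
  mapsTo : MapsTo ψ s₁ s
  isometric : ∀ y ∈ s₁, G y = pull s₁ ψ B y

namespace IsometricOn

variable {s₁ : Set V₁} {s : Set V} {G : V₁ → V₁ →L[ℝ] V₁ →L[ℝ] ℝ}
  {B : V → V →L[ℝ] V →L[ℝ] ℝ} {ψ : V₁ → V}

theorem apply (h : IsometricOn s₁ s G B ψ) {y : V₁} (hy : y ∈ s₁) (u v : V₁) :
    G y u v = B (ψ y) (fderivWithin ℝ ψ s₁ y u) (fderivWithin ℝ ψ s₁ y v) := by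
  rw [h.isometric y hy, pull_apply]

theorem injective (h : IsometricOn s₁ s G B ψ) {y : V₁} (hy : y ∈ s₁) :
    Function.Injective (fderivWithin ℝ ψ s₁ y) := by
  intro a b hab
  refine h.source.ext_left hy fun w => ?_
  rw [h.apply hy, h.apply hy, hab]

theorem contDiffOn_fderivWithin (h : IsometricOn s₁ s G B ψ) :
    ContDiffOn ℝ ∞ (fderivWithin ℝ ψ s₁) s₁ := ContDiffOn.fderivWithin' h.smooth h.source.uniq

theorem differentiableWithinAt_fderivWithin (h : IsometricOn s₁ s G B ψ) {y : V₁} (hy : y ∈ s₁) :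
    DifferentiableWithinAt ℝ (fderivWithin ℝ ψ s₁) s₁ y :=
  ContDiffOn.differentiableWithinAt' h.contDiffOn_fderivWithin hy

theorem fderivWithin_comp' (h : IsometricOn s₁ s G B ψ) {F : Type*} [NormedAddCommGroup F]
    [NormedSpace ℝ F] {T : V → F} (hT : ContDiffOn ℝ ∞ T s) {y : V₁} (hy : y ∈ s₁) (u : V₁) :
    fderivWithin ℝ (fun z => T (ψ z)) s₁ y u =
      fderivWithin ℝ T s (ψ y) (fderivWithin ℝ ψ s₁ y u) := by
  have := fderivWithin_comp y (ContDiffOn.differentiableWithinAt' hT (h.mapsTo hy))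
    (ContDiffOn.differentiableWithinAt' h.smooth hy) h.mapsTo (h.source.uniq y hy)
  exact congrArg (fun L : V₁ →L[ℝ] F => L u) this

theorem differentiableWithinAt_comp (h : IsometricOn s₁ s G B ψ) {F : Type*} [NormedAddCommGroup F]
    [NormedSpace ℝ F] {T : V → F} (hT : ContDiffOn ℝ ∞ T s) {y : V₁} (hy : y ∈ s₁) :
    DifferentiableWithinAt ℝ (fun z => T (ψ z)) s₁ y :=
  ContDiffOn.differentiableWithinAt' (hT.comp h.smooth h.mapsTo) hy

/-- The covariant second derivative of `ψ`. -/
def covHess (s₁ : Set V₁) (s : Set V) (B : V → V →L[ℝ] V →L[ℝ] ℝ) (ψ : V₁ → V) (y u v : V₁) : V :=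
  fderivWithin ℝ (fderivWithin ℝ ψ s₁) s₁ y u v
    + chr s B (ψ y) (fderivWithin ℝ ψ s₁ y u) (fderivWithin ℝ ψ s₁ y v)

theorem covHess_symm (h : IsometricOn s₁ s G B ψ) {y : V₁} (hy : y ∈ s₁) (u v : V₁) :
    covHess s₁ s B ψ y u v = covHess s₁ s B ψ y v u := by
  rw [covHess, covHess, h.source.isSymmSnd h.smooth hy, h.target.chr_symm (h.mapsTo hy)]

theorem fderivWithin_metric (h : IsometricOn s₁ s G B ψ) {y : V₁} (hy : y ∈ s₁) (u v w : V₁) :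
    fderivWithin ℝ G s₁ y u v w =
      B (ψ y) (covHess s₁ s B ψ y u v) (fderivWithin ℝ ψ s₁ y w)
      + B (ψ y) (fderivWithin ℝ ψ s₁ y v) (covHess s₁ s B ψ y u w) := by
  have hU := h.source.uniq y hy
  have hD := h.differentiableWithinAt_fderivWithin hy
  have hDv : ∀ a, DifferentiableWithinAt ℝ (fun z => fderivWithin ℝ ψ s₁ z a) s₁ y := fun a =>
    hD.clm_apply (differentiableWithinAt_const a)
  rw [← fderivWithin_apply_const₂ hU (ContDiffOn.differentiableWithinAt' h.source.smooth hy),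
    fderivWithin_congr (fun z hz => h.apply hz v w) (h.apply hy v w),
    fderivWithin_apply₂ hU (h.differentiableWithinAt_comp h.target.smooth hy) (hDv v) (hDv w),
    h.fderivWithin_comp' h.target.smooth hy, h.target.compat (h.mapsTo hy),
    fderivWithin_apply_const hU hD, fderivWithin_apply_const hU hD, covHess, covHess]
  simp only [map_add, add_apply]
  ring

/-- In the Koszul combination of the derivatives of `G`, the symmetry of `covHess` leaves a single
term. So the tangential part of the second derivative of an isometric immersion is intrinsic. -/
theorem covHess_tangential (h : IsometricOn s₁ s G B ψ) {y : V₁} (hy : y ∈ s₁) (u v w : V₁) :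
    B (ψ y) (covHess s₁ s B ψ y u v) (fderivWithin ℝ ψ s₁ y w) =
      B (ψ y) (fderivWithin ℝ ψ s₁ y (chr s₁ G y u v)) (fderivWithin ℝ ψ s₁ y w) := by
  rw [← h.apply hy, h.source.apply_chr hy, h.fderivWithin_metric hy, h.fderivWithin_metric hy,
    h.fderivWithin_metric hy, h.covHess_symm hy w u, h.covHess_symm hy w v, h.covHess_symm hy v u]
  have hs := h.target.symm (ψ y) (h.mapsTo hy)
  rw [hs (fderivWithin ℝ ψ s₁ y v), hs (fderivWithin ℝ ψ s₁ y u)]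
  ring

/-- `ψ` maps the Levi-Civita connection of `G` to the one of `B`: it is totally geodesic. -/
def IsAffine (s₁ : Set V₁) (s : Set V) (G : V₁ → V₁ →L[ℝ] V₁ →L[ℝ] ℝ)
    (B : V → V →L[ℝ] V →L[ℝ] ℝ) (ψ : V₁ → V) : Prop :=
  ∀ y ∈ s₁, ∀ u v, covHess s₁ s B ψ y u v = fderivWithin ℝ ψ s₁ y (chr s₁ G y u v)

theorem IsAffine.snd (ha : IsAffine s₁ s G B ψ) {y : V₁} (hy : y ∈ s₁) (u v : V₁) :
    fderivWithin ℝ (fderivWithin ℝ ψ s₁) s₁ y u v = fderivWithin ℝ ψ s₁ y (chr s₁ G y u v)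
      - chr s B (ψ y) (fderivWithin ℝ ψ s₁ y u) (fderivWithin ℝ ψ s₁ y v) := by
  rw [← ha y hy, covHess]; abel

/-- Differentiate the second order equation of an affine map once more and antisymmetrize: the third
derivatives of `ψ` cancel, and the two curvatures remain. This is the Gauss equation without second
fundamental form. -/
theorem curv_naturality (h : IsometricOn s₁ s G B ψ) (ha : IsAffine s₁ s G B ψ) {y : V₁}
    (hy : y ∈ s₁) (u v w : V₁) :
    curv s (chr s B) (ψ y) (fderivWithin ℝ ψ s₁ y u) (fderivWithin ℝ ψ s₁ y v)
      (fderivWithin ℝ ψ s₁ y w) = fderivWithin ℝ ψ s₁ y (curv s₁ (chr s₁ G) y u v w) := by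
  have hU := h.source.uniq y hy
  have hD := h.differentiableWithinAt_fderivWithin hy
  have hDD := ContDiffOn.differentiableWithinAt'
    (ContDiffOn.fderivWithin' h.contDiffOn_fderivWithin h.source.uniq) hy
  have hDv : ∀ a, DifferentiableWithinAt ℝ (fun z => fderivWithin ℝ ψ s₁ z a) s₁ y := fun a =>
    hD.clm_apply (differentiableWithinAt_const a)
  have hG := ContDiffOn.differentiableWithinAt' h.source.contDiffOn_chr hy
  have hGv : ∀ a b, DifferentiableWithinAt ℝ (fun z => chr s₁ G z a b) s₁ y := fun a b =>
    (hG.clm_apply (differentiableWithinAt_const a)).clm_apply (differentiableWithinAt_const b)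
  have hC := h.differentiableWithinAt_comp h.target.contDiffOn_chr hy
  have key : ∀ a b, fderivWithin ℝ (fderivWithin ℝ (fderivWithin ℝ ψ s₁) s₁) s₁ y a b w =
      fderivWithin ℝ (fderivWithin ℝ ψ s₁) s₁ y a (chr s₁ G y b w)
      + fderivWithin ℝ ψ s₁ y (fderivWithin ℝ (chr s₁ G) s₁ y a b w)
      - (fderivWithin ℝ (chr s B) s (ψ y) (fderivWithin ℝ ψ s₁ y a) (fderivWithin ℝ ψ s₁ y b)
          (fderivWithin ℝ ψ s₁ y w)
        + chr s B (ψ y) (fderivWithin ℝ (fderivWithin ℝ ψ s₁) s₁ y a b) (fderivWithin ℝ ψ s₁ y w)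
        + chr s B (ψ y) (fderivWithin ℝ ψ s₁ y b)
          (fderivWithin ℝ (fderivWithin ℝ ψ s₁) s₁ y a w)) := by
    intro a b
    rw [← fderivWithin_apply_const₂ hU hDD,
      fderivWithin_congr (fun z hz => ha.snd hz b w) (ha.snd hy b w),
      fderivWithin_fun_sub hU (hD.clm_apply (hGv b w)) ((hC.clm_apply (hDv b)).clm_apply (hDv w)),
      sub_apply, fderivWithin_apply₁ hU hD (hGv b w), fderivWithin_apply_const₂ hU hG,
      fderivWithin_apply₂ hU hC (hDv b) (hDv w), h.fderivWithin_comp' h.target.contDiffOn_chr hy,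
      fderivWithin_apply_const hU hD, fderivWithin_apply_const hU hD]
  have k1 := key u v
  have k2 := key v u
  rw [h.source.isSymmSnd h.contDiffOn_fderivWithin hy u v, k2] at k1
  simp only [ha.snd hy, map_sub, sub_apply] at k1
  rw [h.source.chr_symm hy v u, h.target.chr_symm (h.mapsTo hy) (fderivWithin ℝ ψ s₁ y v)
    (fderivWithin ℝ ψ s₁ y u)] at k1
  simp only [curv, map_sub, map_add]
  rw [← sub_eq_zero] at k1 ⊢
  rw [← k1]
  abel

/-- Differentiate `A ∘ dψ = dψ ∘ A₁` and antisymmetrize. Affineness replaces second derivatives of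
`ψ` by Christoffel symbols, and `dψ` is injective. -/
theorem codazzi_naturality (h : IsometricOn s₁ s G B ψ) (ha : IsAffine s₁ s G B ψ)
    {A : V → V →L[ℝ] V} {A₁ : V₁ → V₁ →L[ℝ] V₁} (hA : ContDiffOn ℝ ∞ A s)
    (hA₁ : ContDiffOn ℝ ∞ A₁ s₁)
    (hrel : ∀ y ∈ s₁, ∀ u, A (ψ y) (fderivWithin ℝ ψ s₁ y u) = fderivWithin ℝ ψ s₁ y (A₁ y u))
    {y : V₁} (hy : y ∈ s₁)
    (hcod : ∀ u v, fderivWithin ℝ A s (ψ y) u v + chr s B (ψ y) u (A (ψ y) v) =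
      fderivWithin ℝ A s (ψ y) v u + chr s B (ψ y) v (A (ψ y) u)) (u v : V₁) :
    fderivWithin ℝ A₁ s₁ y u v + chr s₁ G y u (A₁ y v) =
      fderivWithin ℝ A₁ s₁ y v u + chr s₁ G y v (A₁ y u) := by
  have hU := h.source.uniq y hy
  have hD := h.differentiableWithinAt_fderivWithin hy
  have hDv : ∀ a, DifferentiableWithinAt ℝ (fun z => fderivWithin ℝ ψ s₁ z a) s₁ y := fun a =>
    hD.clm_apply (differentiableWithinAt_const a)
  have hA₁d := ContDiffOn.differentiableWithinAt' hA₁ hy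
  have key : ∀ a b, fderivWithin ℝ A s (ψ y) (fderivWithin ℝ ψ s₁ y a) (fderivWithin ℝ ψ s₁ y b)
      + A (ψ y) (fderivWithin ℝ (fderivWithin ℝ ψ s₁) s₁ y a b) =
      fderivWithin ℝ (fderivWithin ℝ ψ s₁) s₁ y a (A₁ y b)
        + fderivWithin ℝ ψ s₁ y (fderivWithin ℝ A₁ s₁ y a b) := by
    intro a b
    have e := congrArg (fun L : V₁ →L[ℝ] V => L a)
      (fderivWithin_congr (𝕜 := ℝ) (fun z hz => hrel z hz b) (hrel y hy b))
    rw [fderivWithin_apply₁ hU (h.differentiableWithinAt_comp hA hy) (hDv b),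
      h.fderivWithin_comp' hA hy, fderivWithin_apply_const hU hD,
      fderivWithin_apply₁ hU hD (hA₁d.clm_apply (differentiableWithinAt_const b)),
      fderivWithin_apply_const hU hA₁d] at e
    exact e
  have k1 := key u v
  have k2 := key v u
  have hc := hcod (fderivWithin ℝ ψ s₁ y u) (fderivWithin ℝ ψ s₁ y v)
  rw [hrel y hy, hrel y hy] at hc
  simp only [ha.snd hy, map_sub, hrel y hy] at k1 k2
  rw [h.source.chr_symm hy v u, h.target.chr_symm (h.mapsTo hy) (fderivWithin ℝ ψ s₁ y v)
    (fderivWithin ℝ ψ s₁ y u)] at k2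
  refine h.injective hy ?_
  simp only [map_add]
  linear_combination (norm := module) hc - k1 + k2

theorem isAffine_of_surjective (h : IsometricOn s₁ s G B ψ)
    (hs : ∀ y ∈ s₁, Function.Surjective (fderivWithin ℝ ψ s₁ y)) : IsAffine s₁ s G B ψ := by
  intro y hy u v
  refine h.target.ext_left (h.mapsTo hy) fun w => ?_
  obtain ⟨w, rfl⟩ := hs y hy w
  exact h.covHess_tangential hy u v w

end IsometricOn

/-- A local isometry that respects the distance functions respects the shape operators. -/
theorem HypOn.shape_naturality {s₁ : Set V₁} {s : Set V} {G : V₁ → V₁ →L[ℝ] V₁ →L[ℝ] ℝ}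
    {B : V → V →L[ℝ] V →L[ℝ] ℝ} {ψ : V₁ → V} {ρ₁ : V₁ → ℝ} {ρ : V → ℝ} {N₁ : V₁ → V₁} {N : V → V}
    (h₁ : HypOn s₁ G ρ₁ N₁) (h : HypOn s B ρ N) (hψ : IsometricOn s₁ s G B ψ)
    (hρ : ∀ y ∈ s₁, ρ₁ y = ρ (ψ y)) (hfin : Module.finrank ℝ V₁ = Module.finrank ℝ V)
    {y : V₁} (hy : y ∈ s₁) (u : V₁) :
    shape s (chr s B) N (ψ y) (fderivWithin ℝ ψ s₁ y u) =
      fderivWithin ℝ ψ s₁ y (shape s₁ (chr s₁ G) N₁ y u) := by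
  have hsurj : ∀ y ∈ s₁, Function.Surjective (fderivWithin ℝ ψ s₁ y) := fun y hy =>
    (LinearMap.injective_iff_surjective_of_finrank_eq_finrank
      (f := (fderivWithin ℝ ψ s₁ y).toLinearMap) hfin).mp (hψ.injective hy)
  have ha := hψ.isAffine_of_surjective hsurj
  -- A local isometry that intertwines the functions intertwines their gradients.
  have hN : ∀ y ∈ s₁, N (ψ y) = fderivWithin ℝ ψ s₁ y (N₁ y) := by
    intro y hy
    refine h.ext_left (hψ.mapsTo hy) fun w => ?_
    obtain ⟨w, rfl⟩ := hsurj y hy w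
    rw [← hψ.apply hy, h₁.grad y hy, h.grad _ (hψ.mapsTo hy), ← hψ.fderivWithin_comp'
      h.smooth_fun hy, fderivWithin_congr hρ (hρ y hy)]
  have hψD := hψ.contDiffOn_fderivWithin
  refine h₁.eqOn_of_interior
    (f := fun y => shape s (chr s B) N (ψ y) (fderivWithin ℝ ψ s₁ y u))
    (g := fun y => fderivWithin ℝ ψ s₁ y (shape s₁ (chr s₁ G) N₁ y u))
    ((h.contDiffOn_shape.comp hψ.smooth hψ.mapsTo).clm_apply
      (hψD.clm_apply contDiffOn_const)).continuousOn
    (hψD.clm_apply (h₁.contDiffOn_shape.clm_apply contDiffOn_const)).continuousOn ?_ y hy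
  intro y hyi
  have hy := interior_subset hyi
  have hU := hψ.source.uniq y hy
  have hpos := h₁.pos_int y hyi
  have hD := hψ.differentiableWithinAt_fderivWithin hy
  have hN₁ := ContDiffOn.differentiableWithinAt' h₁.contDiffOn_grad hy
  have e := congrArg (fun L : V₁ →L[ℝ] V => L u) (fderivWithin_congr (𝕜 := ℝ) hN (hN y hy))
  rw [hψ.fderivWithin_comp' h.contDiffOn_grad hy, fderivWithin_apply₁ hU hD hN₁, ha.snd hy] at e
  -- Hence it intertwines `∇N₁` and `∇N`, which are `-ρ` times the shape operators; `ρ` can be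
  -- divided out because `y` is interior.
  have e1 : cov s B N (ψ y) (fderivWithin ℝ ψ s₁ y u) =
      fderivWithin ℝ ψ s₁ y (cov s₁ G N₁ y u) := by
    rw [cov_apply, cov_apply, e, hN y hy, map_add]; abel
  rw [h.cov_eq (hψ.mapsTo hy), h₁.cov_eq hy, map_neg, map_smul, neg_inj, ← hρ y hy] at e1
  exact smul_right_injective V hpos.ne' e1

/-! ### The boundary of a compactified hyperbolic metric -/

/-- `ψ` is an isometric immersion of a hypersurface into the zero set of the distance function. -/
structure BoundaryOn (s₁ : Set V₁) (s : Set V) (G : V₁ → V₁ →L[ℝ] V₁ →L[ℝ] ℝ)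
    (B : V → V →L[ℝ] V →L[ℝ] ℝ) (ψ : V₁ → V) (ρ : V → ℝ) (N : V → V) : Prop
    extends IsometricOn s₁ s G B ψ where
  hyp : HypOn s B ρ N
  zero : ∀ y ∈ s₁, ρ (ψ y) = 0
  finrank_eq : Module.finrank ℝ V = Module.finrank ℝ V₁ + 1

namespace BoundaryOn

variable {s₁ : Set V₁} {s : Set V} {G : V₁ → V₁ →L[ℝ] V₁ →L[ℝ] ℝ}
  {B : V → V →L[ℝ] V →L[ℝ] ℝ} {ψ : V₁ → V} {ρ : V → ℝ} {N : V → V}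

theorem diff_eq_zero (h : BoundaryOn s₁ s G B ψ ρ N) {y : V₁} (hy : y ∈ s₁) (u : V₁) :
    fderivWithin ℝ ρ s (ψ y) (fderivWithin ℝ ψ s₁ y u) = 0 := by
  rw [← h.fderivWithin_comp' h.hyp.smooth_fun hy, fderivWithin_congr h.zero (h.zero y hy)]
  simp

theorem normal_tangent (h : BoundaryOn s₁ s G B ψ ρ N) {y : V₁} (hy : y ∈ s₁) (u : V₁) :
    B (ψ y) (N (ψ y)) (fderivWithin ℝ ψ s₁ y u) = 0 := by
  rw [h.hyp.grad _ (h.mapsTo hy), h.diff_eq_zero hy]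

/-- The image of `dψ` lies in the hyperplane orthogonal to `N` and has the same dimension. -/
theorem exists_tangent (h : BoundaryOn s₁ s G B ψ ρ N) {y : V₁} (hy : y ∈ s₁) {a : V}
    (ha : B (ψ y) (N (ψ y)) a = 0) : ∃ b, fderivWithin ℝ ψ s₁ y b = a := by
  have hle : (fderivWithin ℝ ψ s₁ y).toLinearMap.range ≤
      (B (ψ y) (N (ψ y))).toLinearMap.ker := by
    rintro _ ⟨b, rfl⟩
    exact h.normal_tangent hy b
  have h1 : Module.finrank ℝ (fderivWithin ℝ ψ s₁ y).toLinearMap.range = Module.finrank ℝ V₁ :=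
    LinearMap.finrank_range_of_inj (h.injective hy)
  have h2 := (B (ψ y) (N (ψ y))).toLinearMap.finrank_range_add_finrank_ker
  have h3 : Module.finrank ℝ (B (ψ y) (N (ψ y))).toLinearMap.range = 1 := by
    have : (B (ψ y) (N (ψ y))).toLinearMap.range = ⊤ := by
      rw [LinearMap.range_eq_top]
      refine LinearMap.surjective fun h0 => ?_
      have := h.hyp.unit _ (h.mapsTo hy)
      have h00 := congrArg (fun L : V →ₗ[ℝ] ℝ => L (N (ψ y))) h0
      change B (ψ y) (N (ψ y)) (N (ψ y)) = 0 at h00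
      linarith
    rw [this]; simp
  have heq := Submodule.eq_of_le_of_finrank_eq hle (by have := h.finrank_eq; omega)
  have : a ∈ (B (ψ y) (N (ψ y))).toLinearMap.ker := ha
  rw [← heq] at this
  exact this

theorem ext (h : BoundaryOn s₁ s G B ψ ρ N) {y : V₁} (hy : y ∈ s₁) {a b : V}
    (hN : B (ψ y) (N (ψ y)) a = B (ψ y) (N (ψ y)) b)
    (hT : ∀ w, B (ψ y) a (fderivWithin ℝ ψ s₁ y w) = B (ψ y) b (fderivWithin ℝ ψ s₁ y w)) :
    a = b := by
  obtain ⟨c, hc⟩ := h.exists_tangent hy (a := a - b) (by rw [map_sub, hN, sub_self])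
  by_contra hne
  have hp := h.target.pos _ (h.mapsTo hy) (a - b) (sub_ne_zero.mpr hne)
  have : B (ψ y) (a - b) (a - b) = B (ψ y) a (a - b) - B (ψ y) b (a - b) := by
    rw [map_sub (B (ψ y)), sub_apply]
  rw [this, ← hc, hT c, sub_self] at hp
  exact lt_irrefl _ hp

/-- The boundary is totally geodesic: differentiating `dρ(dψ v) = 0` gives the normal part of the
covariant second derivative as minus the Hessian of `ρ`, which is a multiple of `ρ` by
`HypOn.cov_eq` and so vanishes here. -/
theorem isAffine (h : BoundaryOn s₁ s G B ψ ρ N) : IsometricOn.IsAffine s₁ s G B ψ := by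
  intro y hy u v
  refine h.ext hy ?_ fun w => h.covHess_tangential hy u v w
  have hU := h.source.uniq y hy
  have hD := h.differentiableWithinAt_fderivWithin hy
  rw [h.normal_tangent hy, h.hyp.grad _ (h.mapsTo hy), IsometricOn.covHess, map_add]
  have e := congrArg (fun L : V₁ →L[ℝ] ℝ => L u) (fderivWithin_congr (𝕜 := ℝ)
    (fun z hz => h.diff_eq_zero hz v) (h.diff_eq_zero hy v))
  have hdρ := ContDiffOn.fderivWithin' h.hyp.smooth_fun h.hyp.uniq
  rw [fderivWithin_apply₁ hU (h.differentiableWithinAt_comp hdρ hy)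
    (hD.clm_apply (differentiableWithinAt_const v)), h.fderivWithin_comp' hdρ hy,
    fderivWithin_apply_const hU hD, h.hyp.hess (h.mapsTo hy), h.hyp.cov_eq (h.mapsTo hy),
    h.zero y hy] at e
  simp at e
  linarith

/-- The form `B(A·, ·)` of the shape operator. -/
def shapeForm (s : Set V) (B : V → V →L[ℝ] V →L[ℝ] ℝ) (N : V → V) (y : V) : V →L[ℝ] V →L[ℝ] ℝ :=
  (B y) ∘L (shape s (chr s B) N y)

theorem shapeForm_apply (s : Set V) (B : V → V →L[ℝ] V →L[ℝ] ℝ) (N : V → V) (y u v : V) :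
    shapeForm s B N y u v = B y (shape s (chr s B) N y u) v := rfl

theorem contDiffOn_shapeForm {s : Set V} (h : HypOn s B ρ N) :
    ContDiffOn ℝ ∞ (shapeForm s B N) s := h.smooth.clm_comp h.contDiffOn_shape

/-- The shape operator induced on the boundary. -/
def bshape (s₁ : Set V₁) (s : Set V) (G : V₁ → V₁ →L[ℝ] V₁ →L[ℝ] ℝ)
    (B : V → V →L[ℝ] V →L[ℝ] ℝ) (ψ : V₁ → V) (N : V → V) (y : V₁) : V₁ →L[ℝ] V₁ :=
  (G y).inverse ∘L pull s₁ ψ (shapeForm s B N) y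

theorem apply_bshape (h : BoundaryOn s₁ s G B ψ ρ N) {y : V₁} (hy : y ∈ s₁) (u v : V₁) :
    G y (bshape s₁ s G B ψ N y u) v = pull s₁ ψ (shapeForm s B N) y u v := by
  simp [bshape, h.source.apply_inverse hy]

theorem contDiffOn_bshape (h : BoundaryOn s₁ s G B ψ ρ N) :
    ContDiffOn ℝ ∞ (bshape s₁ s G B ψ N) s₁ := by
  have h1 : ContDiffOn ℝ ∞ (fun y => (G y).inverse) s₁ := by
    intro y hy
    have := (h.source.isInvertible hy).contDiffAt_map_inverse (n := ∞)
    exact this.comp_contDiffWithinAt y (h.source.smooth y hy)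
  exact h1.clm_comp (contDiffOn_pull h.source.uniq h.smooth (contDiffOn_shapeForm h.hyp) h.mapsTo)

/-- The shape operator is self-adjoint and annihilates `N`, so it preserves the tangent space of the
boundary. -/
theorem map_bshape (h : BoundaryOn s₁ s G B ψ ρ N) {y : V₁} (hy : y ∈ s₁) (u : V₁) :
    shape s (chr s B) N (ψ y) (fderivWithin ℝ ψ s₁ y u) =
      fderivWithin ℝ ψ s₁ y (bshape s₁ s G B ψ N y u) := by
  have hy' := h.mapsTo hy
  refine h.ext hy ?_ fun w => ?_
  · rw [h.normal_tangent hy, h.target.symm _ hy', h.hyp.shape_symm hy', HypOn.shape_normal s B N _]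
    simp
  · rw [← h.apply hy, h.apply_bshape hy, pull_apply, shapeForm_apply]

theorem pull_symm (h : BoundaryOn s₁ s G B ψ ρ N) {y : V₁} (hy : y ∈ s₁) (u v : V₁) :
    pull s₁ ψ (shapeForm s B N) y u v = pull s₁ ψ (shapeForm s B N) y v u := by
  simp only [pull_apply, shapeForm_apply]
  exact h.hyp.shape_symm (h.mapsTo hy) _ _

theorem curv_boundary (h : BoundaryOn s₁ s G B ψ ρ N) {y : V₁} (hy : y ∈ s₁) (u v w : V₁) :
    curv s₁ (chr s₁ G) y u v w = - pull s₁ ψ (shapeForm s B N) y u w • v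
      + pull s₁ ψ (shapeForm s B N) y v w • u + G y v w • bshape s₁ s G B ψ N y u
      - G y u w • bshape s₁ s G B ψ N y v := by
  refine h.injective hy ?_
  rw [← h.curv_naturality h.isAffine hy, h.hyp.curv_eq (h.mapsTo hy)]
  simp only [map_add, map_sub, map_smul, ← h.map_bshape hy, ← h.apply hy]
  rfl

theorem codazzi_boundary (h : BoundaryOn s₁ s G B ψ ρ N) {y : V₁} (hy : y ∈ s₁) (u v : V₁) :
    fderivWithin ℝ (bshape s₁ s G B ψ N) s₁ y u v + chr s₁ G y u (bshape s₁ s G B ψ N y v) =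
      fderivWithin ℝ (bshape s₁ s G B ψ N) s₁ y v u
        + chr s₁ G y v (bshape s₁ s G B ψ N y u) :=
  h.codazzi_naturality h.isAffine h.hyp.contDiffOn_shape h.contDiffOn_bshape
    (fun _ hy u => h.map_bshape hy u) hy (fun u v => h.hyp.codazzi (h.mapsTo hy) u v) u v

end BoundaryOn

end Immersion

/-! ### Coordinate expressions -/

section Coordinates

variable {m : ℕ}

theorem sum_stdVec (x : Coord m) : ∑ k, x k • stdVec k = x := by
  ext j
  simp [stdVec, Pi.single_apply]

theorem stdVec_apply (i j : Fin m) : (stdVec i : Coord m) j = if j = i then 1 else 0 := by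
  simp [stdVec, PiLp.single_apply]

theorem apply_eq_sum {F : Type*} [NormedAddCommGroup F] [NormedSpace ℝ F] (L : Coord m →L[ℝ] F)
    (x : Coord m) : L x = ∑ k, x k • L (stdVec k) := by
  conv_lhs => rw [← sum_stdVec x]
  simp

theorem invGram_mul {B : Coord m →L[ℝ] Coord m →L[ℝ] ℝ} (hpos : ∀ u, u ≠ 0 → 0 < B u u) :
    invGram (fun u v => B u v) * (Matrix.of fun k l => B (stdVec k) (stdVec l)) = 1 := by
  refine Matrix.nonsing_inv_mul _ ((Matrix.isUnit_iff_isUnit_det _).mp ?_)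
  rw [← Matrix.mulVec_injective_iff_isUnit]
  refine (injective_iff_map_eq_zero (Matrix.mulVecLin _)).mpr fun x hx => ?_
  have h1 : ∀ k, B (stdVec k) (WithLp.toLp 2 x) = 0 := by
    intro k
    have := congrFun hx k
    rw [apply_eq_sum]
    simpa [Matrix.mulVec, dotProduct, mul_comm] using! this
  have h2 : B (WithLp.toLp 2 x) (WithLp.toLp 2 x) = 0 := by
    rw [apply_eq_sum B]
    simp [h1]
  have h3 : WithLp.toLp 2 x = 0 := by
    by_contra hne
    exact (hpos _ hne).ne' h2
  simpa using h3

/-- All contractions with the inverse matrix (`sharp`, `metricTrace`, `metricSquare`) become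
coordinate-free through this identity. -/
theorem sum_invGram {B : Coord m →L[ℝ] Coord m →L[ℝ] ℝ} (hpos : ∀ u, u ≠ 0 → 0 < B u u)
    (hsymm : ∀ u v, B u v = B v u) (k : Fin m) (x : Coord m) :
    ∑ l, invGram (fun u v => B u v) k l * B x (stdVec l) = x k := by
  have h := invGram_mul hpos
  have : ∀ l, B x (stdVec l) = ∑ j, B (stdVec l) (stdVec j) * x j := by
    intro l
    rw [hsymm, apply_eq_sum]
    simp [mul_comm]
  simp only [this, Finset.mul_sum]
  rw [Finset.sum_comm]
  have h2 : ∀ j, ∑ l, invGram (fun u v => B u v) k l * (B (stdVec l) (stdVec j) * x j) =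
      (if k = j then 1 else 0) * x j := by
    intro j
    have := congrFun (congrFun h k) j
    rw [Matrix.mul_apply, Matrix.one_apply] at this
    rw [← this, Finset.sum_mul]
    simp [mul_assoc]
  simp [h2]

theorem sharp_eq {B : Coord m →L[ℝ] Coord m →L[ℝ] ℝ} (hpos : ∀ u, u ≠ 0 → 0 < B u u)
    (hsymm : ∀ u v, B u v = B v u) {l : Coord m → ℝ} {a : Coord m} (hl : ∀ v, B a v = l v) :
    sharp (fun u v => B u v) l = a := by
  rw [sharp]
  simp only [← hl, sum_invGram hpos hsymm]
  exact sum_stdVec a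

theorem metricTrace_eq {B : Coord m →L[ℝ] Coord m →L[ℝ] ℝ} (hpos : ∀ u, u ≠ 0 → 0 < B u u)
    (hsymm : ∀ u v, B u v = B v u) {T : Coord m → Coord m → ℝ} {A : Coord m → Coord m}
    (hT : ∀ u v, T u v = B (A u) v) :
    metricTrace (fun u v => B u v) T = ∑ k, A (stdVec k) k := by
  simp only [metricTrace, hT, sum_invGram hpos hsymm]

theorem metricSquare_eq {B : Coord m →L[ℝ] Coord m →L[ℝ] ℝ} (hpos : ∀ u, u ≠ 0 → 0 < B u u)
    (hsymm : ∀ u v, B u v = B v u) {P : Coord m → Coord m → ℝ} {u v a b : Coord m}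
    (ha : ∀ w, P u w = B a w) (hb : ∀ w, P v w = B b w) :
    metricSquare (fun u v => B u v) P u v = B a b := by
  rw [metricSquare, apply_eq_sum (B a)]
  refine Finset.sum_congr rfl fun k _ => ?_
  rw [smul_eq_mul, ← sum_invGram hpos hsymm k b, Finset.sum_mul]
  exact Finset.sum_congr rfl fun l _ => by rw [ha, hb]; ring

theorem trace_eq_sum (f : Coord m →ₗ[ℝ] Coord m) :
    LinearMap.trace ℝ (Coord m) f = ∑ k, f (stdVec k) k := by
  rw [LinearMap.trace_eq_matrix_trace ℝ (EuclideanSpace.basisFun (Fin m) ℝ).toBasis, Matrix.trace]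
  simp [LinearMap.toMatrix_apply, stdVec]

variable {s : Set (Coord m)} {B : Coord m → Coord m →L[ℝ] Coord m →L[ℝ] ℝ}

theorem christoffel_eq (h : MetricOn s B) {y : Coord m} (hy : y ∈ interior s) (u v : Coord m) :
    christoffel (fun y u v => B y u v) y u v = chr s B y u v := by
  have hy' := interior_subset hy
  have hn := mem_interior_iff_mem_nhds.mp hy
  have hU := h.uniq y hy'
  have hB := ContDiffOn.differentiableWithinAt' h.smooth hy'
  refine sharp_eq (h.pos y hy') (h.symm y hy') fun w => ?_
  rw [h.apply_chr hy']
  have e : ∀ a b c, fderiv ℝ (fun z => B z a b) y c = fderivWithin ℝ B s y c a b := by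
    intro a b c
    rw [← fderivWithin_of_mem_nhds hn, fderivWithin_apply_const₂ hU hB]
  simp only [e]

theorem riemann_eq (h : MetricOn s B) {y : Coord m} (hy : y ∈ interior s) (u v w : Coord m) :
    riemann (fun y u v => B y u v) y u v w = curv s (chr s B) y u v w := by
  have hy' := interior_subset hy
  have hn := mem_interior_iff_mem_nhds.mp hy
  have hU := h.uniq y hy'
  have hG := ContDiffOn.differentiableWithinAt' h.contDiffOn_chr hy'
  have e : ∀ a b c, fderiv ℝ (fun z => christoffel (fun y u v => B y u v) z a b) y c =
      fderivWithin ℝ (chr s B) s y c a b := by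
    intro a b c
    rw [← fderivWithin_apply_const₂ hU hG, fderivWithin_of_mem_nhds hn]
    congr 1
    refine Filter.EventuallyEq.fderiv_eq ?_
    filter_upwards [isOpen_interior.mem_nhds hy] with z hz using christoffel_eq h hz a b
  rw [riemann, curv, e, e]
  simp only [christoffel_eq h hy]

end Coordinates

/-! ### Ricci tensor, scalar curvature and divergence on the boundary. -/

namespace BoundaryOn

variable {n : ℕ} {V : Type*} [NormedAddCommGroup V] [NormedSpace ℝ V] [FiniteDimensional ℝ V]
  {s₁ : Set (Coord n)} {s : Set V} {G : Coord n → Coord n →L[ℝ] Coord n →L[ℝ] ℝ}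
  {B : V → V →L[ℝ] V →L[ℝ] ℝ} {ψ : Coord n → V} {ρ : V → ℝ} {N : V → V}

/-- Trace of the Gauss equation in its first argument: one term contributes `n P`, one the trace of
`P` times the metric, and the sums `e1` and `e2` each remove one `P`. -/
theorem ricci_eq (h : BoundaryOn s₁ s G B ψ ρ N) (hs : IsOpen s₁) {y : Coord n} (hy : y ∈ s₁)
    (v w : Coord n) : ricci (fun y u v => G y u v) y v w =
      ((n : ℝ) - 2) * pull s₁ ψ (shapeForm s B N) y v w
        + (∑ k, bshape s₁ s G B ψ N y (stdVec k) k) * G y v w := by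
  have e : ∀ i, riemann (fun y u v => G y u v) y (stdVec i) v w i =
      - (pull s₁ ψ (shapeForm s B N) y (stdVec i) w * v i)
      + pull s₁ ψ (shapeForm s B N) y v w + G y v w * bshape s₁ s G B ψ N y (stdVec i) i
      - G y (stdVec i) w * bshape s₁ s G B ψ N y v i := by
    intro i
    rw [riemann_eq h.source (by rwa [hs.interior_eq]), h.curv_boundary hy]
    simp [stdVec_apply]
  have e1 : ∑ i, pull s₁ ψ (shapeForm s B N) y (stdVec i) w * v i =
      pull s₁ ψ (shapeForm s B N) y v w := by
    rw [h.pull_symm hy v, apply_eq_sum]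
    exact Finset.sum_congr rfl fun i _ => by rw [h.pull_symm hy, smul_eq_mul, mul_comm]
  have e2 : ∑ i, G y (stdVec i) w * bshape s₁ s G B ψ N y v i =
      pull s₁ ψ (shapeForm s B N) y v w := by
    rw [← h.apply_bshape hy, h.source.symm y hy, apply_eq_sum (G y w)]
    exact Finset.sum_congr rfl fun i _ => by rw [h.source.symm y hy, smul_eq_mul, mul_comm]
  rw [ricci]
  simp only [e, Finset.sum_sub_distrib, Finset.sum_add_distrib, Finset.sum_neg_distrib, e1, e2,
    ← Finset.mul_sum, Finset.sum_const, Finset.card_univ, Fintype.card_fin, nsmul_eq_mul]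
  ring

theorem scalarCurv_eq (h : BoundaryOn s₁ s G B ψ ρ N) (hs : IsOpen s₁) {y : Coord n}
    (hy : y ∈ s₁) : scalarCurv (fun y u v => G y u v) y =
      2 * ((n : ℝ) - 1) * ∑ k, bshape s₁ s G B ψ N y (stdVec k) k := by
  set t := ∑ k, bshape s₁ s G B ψ N y (stdVec k) k with ht
  rw [scalarCurv, metricTrace_eq (h.source.pos y hy) (h.source.symm y hy)
    (A := fun u => ((n : ℝ) - 2) • bshape s₁ s G B ψ N y u + t • u)]
  · simp only [PiLp.add_apply, PiLp.smul_apply, smul_eq_mul, Finset.sum_add_distrib,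
      ← Finset.mul_sum, ← ht, stdVec_apply]
    simp
    ring
  · intro u v
    rw [h.ricci_eq hs hy, ← ht, map_add, map_smul, map_smul]
    simp [h.apply_bshape hy]

theorem schouten_eq (h : BoundaryOn s₁ s G B ψ ρ N) (hs : IsOpen s₁) (hn : 3 ≤ n) {y : Coord n}
    (hy : y ∈ s₁) (u v : Coord n) : schouten (fun y u v => G y u v) y u v =
      pull s₁ ψ (shapeForm s B N) y u v := by
  have h3 : (3 : ℝ) ≤ n := by exact_mod_cast hn
  have h2 : (n : ℝ) - 2 ≠ 0 := by linarith
  have h1 : (n : ℝ) - 1 ≠ 0 := by linarith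
  rw [schouten, h.ricci_eq hs hy, h.scalarCurv_eq hs hy]
  field_simp
  ring

theorem metricTrace_eq_scalarCurv (h : BoundaryOn s₁ s G B ψ ρ N) (hs : IsOpen s₁) (hn : n = 2)
    {y : Coord n} (hy : y ∈ s₁) :
    metricTrace (fun u v => G y u v) (fun u v => pull s₁ ψ (shapeForm s B N) y u v) =
      scalarCurv (fun y u v => G y u v) y / 2 := by
  rw [h.scalarCurv_eq hs hy, metricTrace_eq (h.source.pos y hy) (h.source.symm y hy)
    (fun u v => (h.apply_bshape hy u v).symm),
    show (n : ℝ) = 2 by exact_mod_cast hn]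
  ring

/-- The contracted Codazzi equation says `div P = d (tr P)`, and the trace is half the scalar
curvature in dimension two. -/
theorem divergence_eq_scalarCurv (h : BoundaryOn s₁ s G B ψ ρ N) (hs : IsOpen s₁) (hn : n = 2)
    {T : Coord n → Coord n → Coord n → ℝ}
    (hT : ∀ y ∈ s₁, ∀ u v, T y u v = pull s₁ ψ (shapeForm s B N) y u v)
    {y : Coord n} (hy : y ∈ s₁) (w : Coord n) :
    divergence (fun y u v => G y u v) T y w =
      fderiv ℝ (scalarCurv (fun y u v => G y u v)) y w / 2 := by
  set A := bshape s₁ s G B ψ N with hA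
  have hAd := ContDiffOn.differentiableWithinAt' h.contDiffOn_bshape hy
  have hU := h.source.uniq y hy
  have hGd := ContDiffOn.differentiableWithinAt' h.source.smooth hy
  have hchr : ∀ u v, christoffel (fun y u v => G y u v) y u v = chr s₁ G y u v :=
    fun u v => christoffel_eq h.source (by rwa [hs.interior_eq]) u v
  have hTA : ∀ y ∈ s₁, ∀ u v, T y u v = G y (A y u) v := fun y hy u v => by
    rw [hT y hy, hA, h.apply_bshape hy]
  have hdT : ∀ a b c, fderiv ℝ (fun z => T z a b) y c =
      fderivWithin ℝ G s₁ y c (A y a) b + G y (fderivWithin ℝ A s₁ y c a) b := by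
    intro a b c
    rw [← fderivWithin_of_isOpen hs hy, fderivWithin_congr (fun z hz => hTA z hz a b)
      (hTA y hy a b), fderivWithin_apply₂ hU hGd (hAd.clm_apply (differentiableWithinAt_const a))
      (differentiableWithinAt_const b), fderivWithin_apply_const hU hAd]
    simp [hA]
  have hsymT : ∀ u v, G y (A y u) v = G y (A y v) u := fun u v => by
    rw [hA, h.apply_bshape hy, h.apply_bshape hy, h.pull_symm hy]
  have hcod := fun a b => h.codazzi_boundary hy a b
  have hdiv : divergence (fun y u v => G y u v) T y w = ∑ k, (fun a =>
      fderivWithin ℝ A s₁ y w a + chr s₁ G y w (A y a) - A y (chr s₁ G y w a)) (stdVec k) k := by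
    rw [divergence]
    have hsum : ∀ F : Coord n → Coord n → ℝ, metricTrace (fun u v => G y u v) F =
        metricTrace (fun u v => G y u v) fun a b => F b a := by
      intro F
      have hsy : ∀ k l, invGram (fun u v => G y u v) k l = invGram (fun u v => G y u v) l k := by
        intro k l
        have hM : (Matrix.of fun k l : Fin n => G y (stdVec k) (stdVec l)).transpose =
            Matrix.of fun k l => G y (stdVec k) (stdVec l) := by
          ext i j
          exact h.source.symm y hy _ _
        have := congrFun (congrFun (Matrix.transpose_nonsing_inv
          (Matrix.of fun k l : Fin n => G y (stdVec k) (stdVec l))) l) k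
        rw [hM] at this
        exact this
      rw [metricTrace, metricTrace, Finset.sum_comm]
      exact Finset.sum_congr rfl fun l _ => Finset.sum_congr rfl fun k _ => by rw [hsy]
    -- After exchanging the two slots of the trace, the direction of differentiation comes first.
    -- Codazzi then trades `(∇_a A) w` for `(∇_w A) a`, whose trace over `a` is taken.
    rw [hsum]
    refine metricTrace_eq (h.source.pos y hy) (h.source.symm y hy) (A := fun a =>
      fderivWithin ℝ A s₁ y w a + chr s₁ G y w (A y a) - A y (chr s₁ G y w a)) fun a b => ?_
    rw [hdT, hchr, hchr, hTA y hy, hTA y hy, h.source.compat hy]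
    have hc := hcod a w
    rw [← hA] at hc
    have hw : fderivWithin ℝ A s₁ y a w = fderivWithin ℝ A s₁ y w a + chr s₁ G y w (A y a)
        - chr s₁ G y a (A y w) := by rw [← hc]; abel
    rw [hw, hsymT (chr s₁ G y a w) b, h.source.symm y hy (A y b), h.source.chr_symm hy a w,
      h.source.symm y hy (chr s₁ G y w a) (A y b), hsymT b]
    simp only [map_add, map_sub, add_apply, sub_apply]
    ring
  -- The connection terms form the commutator of `chr s₁ G y w` with `A y`, which has trace zero.
  have htr : ∑ k, (fun a => fderivWithin ℝ A s₁ y w a + chr s₁ G y w (A y a)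
      - A y (chr s₁ G y w a)) (stdVec k) k = ∑ k, fderivWithin ℝ A s₁ y w (stdVec k) k := by
    have hc := LinearMap.trace_mul_comm ℝ (chr s₁ G y w).toLinearMap (A y).toLinearMap
    rw [trace_eq_sum, trace_eq_sum] at hc
    simp only [PiLp.add_apply, PiLp.sub_apply, Finset.sum_sub_distrib, Finset.sum_add_distrib]
    have : ∑ k, (chr s₁ G y w (A y (stdVec k))) k = ∑ k, (A y (chr s₁ G y w (stdVec k))) k := hc
    rw [this]
    ring
  have hscal : fderiv ℝ (scalarCurv (fun y u v => G y u v)) y w =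
      2 * ∑ k, fderivWithin ℝ A s₁ y w (stdVec k) k := by
    have hev : scalarCurv (fun y u v => G y u v) =ᶠ[𝓝 y] fun z => 2 * ∑ k, A z (stdVec k) k := by
      filter_upwards [hs.mem_nhds hy] with z hz
      rw [h.scalarCurv_eq hs hz, show (n : ℝ) = 2 by exact_mod_cast hn]
      ring
    have hAt : HasFDerivAt A (fderivWithin ℝ A s₁ y) y :=
      hAd.hasFDerivWithinAt.hasFDerivAt (hs.mem_nhds hy)
    rw [hev.fderiv_eq]
    have hk : ∀ k : Fin n, HasFDerivAt (fun z => A z (stdVec k) k)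
        ((EuclideanSpace.proj k : Coord n →L[ℝ] ℝ) ∘L (fderivWithin ℝ A s₁ y).flip (stdVec k)) y := by
      intro k
      have := hAt.clm_apply (hasFDerivAt_const (stdVec k) y)
      have h2 := (EuclideanSpace.proj k : Coord n →L[ℝ] ℝ).hasFDerivAt.comp y this
      refine h2.congr_fderiv ?_
      ext a
      simp
    have := ((HasFDerivAt.fun_sum fun k (_ : k ∈ Finset.univ) => hk k).const_mul (2 : ℝ)).fderiv
    rw [this]
    simp
  rw [hdiv, htr, hscal]
  ring

end BoundaryOn

/-! ### Local flows of vector fields on a half space -/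

section Flow

open Metric NNReal

variable {E : Type*} [NormedAddCommGroup E] [NormedSpace ℝ E]

/-- Picard-Lindelöf with Lipschitz dependence on the initial value and with confinement to the ball
of radius `a`. The confinement keeps trajectories where a field coincides with its Lipschitz
extension. -/
theorem exists_flow_mem_closedBall [CompleteSpace E] {f : ℝ → E → E} {tmin tmax : ℝ}
    {t₀ : Icc tmin tmax} {x₀ : E} {a r L K : ℝ≥0} (hf : IsPicardLindelof f t₀ x₀ a r L K) :
    ∃ α : E → ℝ → E, (∀ x ∈ closedBall x₀ r, α x t₀ = x ∧
      ∀ t ∈ Icc tmin tmax, α x t ∈ closedBall x₀ a ∧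
        HasDerivWithinAt (α x) (f t (α x t)) (Icc tmin tmax) t) ∧
      ∃ L' : ℝ≥0, ∀ t ∈ Icc tmin tmax, LipschitzOnWith L' (α · t) (closedBall x₀ r) := by
  classical
  have (x) (hx : x ∈ closedBall x₀ r) := ODE.FunSpace.exists_isFixedPt_next hf hx
  choose α hα using this
  -- The value `0` outside the ball of initial points is never used.
  refine ⟨fun x => if hx : x ∈ closedBall x₀ r then (α x hx).compProj else 0,
    fun x hx ↦ ⟨?_, fun t ht ↦ ⟨?_, ?_⟩⟩, ?_⟩
  · beta_reduce
    rw [dif_pos hx, ODE.FunSpace.compProj_val, ← hα, ODE.FunSpace.next_apply₀]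
  · beta_reduce
    rw [dif_pos hx]
    exact (α x hx).compProj_mem_closedBall hf.mul_max_le
  · beta_reduce
    rw [dif_pos hx, ODE.FunSpace.compProj_apply]
    apply ODE.hasDerivWithinAt_picard_Icc t₀.2 hf.continuousOn_uncurry
      (α x hx |>.continuous_compProj.continuousOn)
      (fun _ ht' ↦ α x hx |>.compProj_mem_closedBall hf.mul_max_le)
      x ht |>.congr_of_mem _ ht
    intro t' ht'
    nth_rw 1 [← hα]
    rw [ODE.FunSpace.compProj_of_mem ht', ODE.FunSpace.next_apply]
  · obtain ⟨L', h⟩ := ODE.FunSpace.exists_forall_closedBall_funSpace_dist_le_mul hf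
    refine ⟨L', fun t ht ↦ LipschitzOnWith.of_dist_le_mul fun x hx y hy ↦ ?_⟩
    beta_reduce
    rw [dif_pos hx, dif_pos hy, ODE.FunSpace.compProj_apply, ODE.FunSpace.compProj_apply,
      ← ODE.FunSpace.toContinuousMap_apply_eq_apply, ← ODE.FunSpace.toContinuousMap_apply_eq_apply]
    have : Nonempty (Icc tmin tmax) := ⟨t₀⟩
    apply ContinuousMap.dist_le_iff_of_nonempty.mp
    exact h x y hx hy (α x hx) (α y hy) (hα x hx) (hα y hy)

/-- The local flow of a Lipschitz vector field `f`, coupled with the linear equation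
`J' = A(α) J` along its integral curves. -/
theorem exists_linearized_flow [CompleteSpace E] {f : E → E} {A : E → E →L[ℝ] E} {K₁ K₂ : ℝ≥0}
    (hf : LipschitzWith K₁ f) (hA : LipschitzWith K₂ A) (y₀ : E) {η : ℝ} (hη : 0 < η) :
    ∃ R > 0, ∃ δ > 0, ∃ (α : E → ℝ → E) (J : E → ℝ → E →L[ℝ] E) (L : ℝ≥0),
      (∀ x ∈ closedBall y₀ R, α x 0 = x ∧ J x 0 = ContinuousLinearMap.id ℝ E ∧
        ∀ t ∈ Icc (-δ) δ, α x t ∈ closedBall y₀ η ∧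
          HasDerivWithinAt (α x) (f (α x t)) (Icc (-δ) δ) t ∧
          HasDerivWithinAt (J x) (A (α x t) ∘L J x t) (Icc (-δ) δ) t) ∧
      ∀ t ∈ Icc (-δ) δ, LipschitzOnWith L (α · t) (closedBall y₀ R) := by
  lift η to ℝ≥0 using hη.le
  set z₀ : E × (E →L[ℝ] E) := (y₀, ContinuousLinearMap.id ℝ E) with hz₀
  set F : E × (E →L[ℝ] E) → E × (E →L[ℝ] E) := fun z => (f z.1, A z.1 ∘L z.2) with hF
  -- The product `A(α) J` is Lipschitz only on bounded sets. On the ball of radius `η` about `z₀`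
  -- one has `‖J‖ ≤ B` and `‖A‖ ≤ C`.
  set B : ℝ≥0 := ‖ContinuousLinearMap.id ℝ E‖₊ + η with hB
  set C : ℝ≥0 := ‖A y₀‖₊ + K₂ * η with hC
  have hJ : ∀ z ∈ closedBall z₀ η, ‖z.2‖ ≤ B := by
    intro z hz
    have h1 : ‖z.2 - ContinuousLinearMap.id ℝ E‖ ≤ η := by
      have := (mem_closedBall_iff_norm.1 hz)
      exact (norm_snd_le (z - z₀)).trans this
    have h2 := norm_sub_norm_le z.2 (ContinuousLinearMap.id ℝ E)
    simp only [hB, NNReal.coe_add, coe_nnnorm]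
    linarith
  have hAb : ∀ z ∈ closedBall z₀ η, ‖A z.1‖ ≤ C := by
    intro z hz
    have h1 : ‖z.1 - y₀‖ ≤ η :=
      (norm_fst_le (z - z₀)).trans (mem_closedBall_iff_norm.1 hz)
    have h2 := hA.norm_sub_le z.1 y₀
    have h3 := norm_sub_norm_le (A z.1) (A y₀)
    have h4 : (K₂ : ℝ) * ‖z.1 - y₀‖ ≤ K₂ * η := by gcongr
    simp only [hC, NNReal.coe_add, NNReal.coe_mul, coe_nnnorm]
    linarith
  have hlip : LipschitzOnWith (max K₁ (C + K₂ * B)) F (closedBall z₀ η) := by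
    refine LipschitzOnWith.of_dist_le_mul fun z hz w hw => ?_
    rw [Prod.dist_eq, max_le_iff]
    have hd : dist z.1 w.1 ≤ dist z w := by rw [Prod.dist_eq]; exact le_max_left _ _
    have hd2 : dist z.2 w.2 ≤ dist z w := by rw [Prod.dist_eq]; exact le_max_right _ _
    constructor
    · calc dist (f z.1) (f w.1) ≤ K₁ * dist z.1 w.1 := hf.dist_le_mul _ _
        _ ≤ (max K₁ (C + K₂ * B) : ℝ≥0) * dist z w := by
          gcongr; exact le_max_left _ _
    · have e : A z.1 ∘L z.2 - A w.1 ∘L w.2 = A z.1 ∘L (z.2 - w.2) + (A z.1 - A w.1) ∘L w.2 := by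
        ext v; simp
      calc dist (A z.1 ∘L z.2) (A w.1 ∘L w.2)
          = ‖A z.1 ∘L (z.2 - w.2) + (A z.1 - A w.1) ∘L w.2‖ := by rw [dist_eq_norm, e]
        _ ≤ ‖A z.1‖ * ‖z.2 - w.2‖ + ‖A z.1 - A w.1‖ * ‖w.2‖ :=
          (norm_add_le _ _).trans (add_le_add (ContinuousLinearMap.opNorm_comp_le _ _)
            (ContinuousLinearMap.opNorm_comp_le _ _))
        _ ≤ C * dist z w + (K₂ * dist z w) * B := by
          have h1 := hAb z hz
          have h2 := hJ w hw
          have h3 : ‖A z.1 - A w.1‖ ≤ K₂ * dist z w := by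
            rw [← dist_eq_norm]
            exact (hA.dist_le_mul _ _).trans (by gcongr)
          rw [dist_eq_norm z.2] at hd2
          gcongr
        _ = ((C + K₂ * B : ℝ≥0) : ℝ) * dist z w := by push_cast; ring
        _ ≤ (max K₁ (C + K₂ * B) : ℝ≥0) * dist z w := by
          gcongr; exact le_max_right _ _
  set N : ℝ≥0 := ‖F z₀‖₊ + (max K₁ (C + K₂ * B)) * η with hN
  have hNb : ∀ z ∈ closedBall z₀ η, ‖F z‖ ≤ N := by
    intro z hz
    have h1 := hlip.dist_le_mul z hz z₀ (mem_closedBall_self hη.le)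
    rw [dist_eq_norm] at h1
    have h3 := norm_sub_norm_le (F z) (F z₀)
    have h4 : ((max K₁ (C + K₂ * B) : ℝ≥0) : ℝ) * dist z z₀
        ≤ (max K₁ (C + K₂ * B) : ℝ≥0) * η := by
      gcongr; exact mem_closedBall.1 hz
    simp only [hN, NNReal.coe_add, NNReal.coe_mul, coe_nnnorm] at *
    linarith
  -- The speed is at most `N`, so a solution moves by at most `N δ ≤ η / 2`: the room left when it
  -- starts in the ball of radius `η / 2`.
  set δ : ℝ := η / (2 * (N + 1)) with hδ
  have hN0 : (0 : ℝ) ≤ N := N.2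
  have hδ0 : 0 < δ := by positivity
  have hP : IsPicardLindelof (fun _ => F) (tmin := -δ) (tmax := δ)
      ⟨0, by constructor <;> linarith⟩ z₀ η (η / 2) N
      (max K₁ (C + K₂ * B)) := by
    refine IsPicardLindelof.of_time_independent hNb hlip ?_
    simp only [sub_zero, zero_sub, neg_neg, max_self]
    push_cast
    have : (N : ℝ) * δ ≤ (N + 1) * δ := by nlinarith
    have e : ((N : ℝ) + 1) * δ = η / 2 := by rw [hδ]; field_simp
    linarith
  obtain ⟨Θ, hΘ, L, hL⟩ := exists_flow_mem_closedBall hP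
  have hmem : ∀ x ∈ closedBall y₀ (η / 2),
      ((x, ContinuousLinearMap.id ℝ E) : E × (E →L[ℝ] E)) ∈
        closedBall z₀ ((η / 2 : ℝ≥0) : ℝ) := by
    intro x hx
    rw [hz₀, mem_closedBall, Prod.dist_eq, dist_self]
    push_cast
    exact max_le (mem_closedBall.1 hx) (by positivity)
  refine ⟨η / 2, by positivity, δ, hδ0,
    fun x t => (Θ (x, ContinuousLinearMap.id ℝ E) t).1,
    fun x t => (Θ (x, ContinuousLinearMap.id ℝ E) t).2, L, fun x hx => ?_, fun t ht => ?_⟩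
  · obtain ⟨h0, h⟩ := hΘ _ (hmem x hx)
    change Θ _ 0 = _ at h0
    refine ⟨by simp only [h0], by simp only [h0], fun t ht => ?_⟩
    obtain ⟨h1, h2⟩ := h t ht
    refine ⟨?_, h2.fst, h2.snd⟩
    rw [mem_closedBall, Prod.dist_eq] at h1
    exact (le_max_left _ _).trans h1
  · refine LipschitzOnWith.of_dist_le_mul fun x hx y hy => ?_
    have := (hL t ht).dist_le_mul _ (hmem x hx) _ (hmem y hy)
    rw [Prod.dist_eq, Prod.dist_eq, dist_self, max_eq_left (dist_nonneg)] at this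
    exact (le_max_left _ _).trans this

/-- Mean value inequality on the part of `D` within distance `‖y - x‖` of `x`, where the derivative
differs from `A x` by at most `K ‖y - x‖`. -/
theorem norm_taylor_le {f : E → E} {D : Set E} (hD : Convex ℝ D) {A : E → E →L[ℝ] E} {K : ℝ≥0}
    (hf : ∀ x ∈ D, HasFDerivWithinAt f (A x) D x) (hA : LipschitzOnWith K A D) {x y : E}
    (hx : x ∈ D) (hy : y ∈ D) : ‖f y - f x - A x (y - x)‖ ≤ K * ‖y - x‖ ^ 2 := by
  have hc : Convex ℝ (D ∩ closedBall x ‖y - x‖) := hD.inter (convex_closedBall _ _)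
  have h := hc.norm_image_sub_le_of_norm_hasFDerivWithin_le' (f := f) (f' := A) (φ := A x)
    (C := K * ‖y - x‖) (x := x) (y := y) (fun z hz => (hf z hz.1).mono inter_subset_left)
    (fun z hz => by
      have := hA.norm_sub_le hz.1 hx
      refine this.trans ?_
      gcongr
      exact mem_closedBall_iff_norm.1 hz.2)
    ⟨hx, mem_closedBall_self (norm_nonneg _)⟩ ⟨hy, by simp [dist_eq_norm]⟩
  refine h.trans (le_of_eq (by ring))

/-- Two trajectories of a vector field differ to first order by the solution of the linearized
equation. -/
theorem norm_flow_sub_le {f : E → E} {D : Set E} (hD : Convex ℝ D) {A : E → E →L[ℝ] E}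
    {K C : ℝ≥0} {L δ : ℝ} (hf : ∀ x ∈ D, HasFDerivWithinAt f (A x) D x)
    (hA : LipschitzOnWith K A D) (hC : ∀ x ∈ D, ‖A x‖ ≤ C) {a b : ℝ → E} {J : ℝ → E →L[ℝ] E}
    (ha : ∀ t ∈ Icc 0 δ, a t ∈ D ∧ HasDerivWithinAt a (f (a t)) (Icc 0 δ) t)
    (hb : ∀ t ∈ Icc 0 δ, b t ∈ D ∧ HasDerivWithinAt b (f (b t)) (Icc 0 δ) t)
    (hJ : ∀ t ∈ Icc 0 δ, HasDerivWithinAt J (A (a t) ∘L J t) (Icc 0 δ) t)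
    (hJ0 : J 0 = ContinuousLinearMap.id ℝ E)
    (hL : ∀ t ∈ Icc 0 δ, ‖b t - a t‖ ≤ L * ‖b 0 - a 0‖) {t : ℝ} (ht : t ∈ Icc 0 δ) :
    ‖b t - a t - J t (b 0 - a 0)‖ ≤
      K * L ^ 2 / (C + 1) * (Real.exp ((C + 1) * t) - 1) * ‖b 0 - a 0‖ ^ 2 := by
  set h := b 0 - a 0
  set e : ℝ → E := fun t => b t - a t - J t h with he
  have hder : ∀ t ∈ Icc 0 δ,
      HasDerivWithinAt e (f (b t) - f (a t) - A (a t) (J t h)) (Icc 0 δ) t := fun t ht =>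
    ((hb t ht).2.sub (ha t ht).2).sub
      (((hJ t ht).clm_apply (hasDerivWithinAt_const t _ h)).congr_deriv (by simp))
  -- Grönwall for the error `e`: it starts at `0`, and its derivative is `A(a) e` plus a Taylor
  -- remainder of size `K L² ‖h‖²`. Using `C + 1` in place of `C` keeps the Grönwall constant
  -- nonzero.
  have hg := norm_le_gronwallBound_of_norm_deriv_right_le (f := e)
    (f' := fun t => f (b t) - f (a t) - A (a t) (J t h)) (δ := 0) (K := C + 1)
    (ε := K * L ^ 2 * ‖h‖ ^ 2) (a := 0) (b := δ)
    (fun t ht => (hder t ht).continuousWithinAt)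
    (fun t ht => ((hder t (Ico_subset_Icc_self ht)).mono_of_mem_nhdsWithin
      (Icc_mem_nhdsGE_of_mem ht)))
    (by simp [he, hJ0, h])
    (fun t ht => by
      have ht' := Ico_subset_Icc_self ht
      have h1 := norm_taylor_le hD hf hA (ha t ht').1 (hb t ht').1
      have h2 : f (b t) - f (a t) - A (a t) (J t h)
          = A (a t) (e t) + (f (b t) - f (a t) - A (a t) (b t - a t)) := by
        simp only [he, map_sub]; abel
      rw [h2]
      refine (norm_add_le _ _).trans (add_le_add ?_ (h1.trans ?_))
      · refine ((A (a t)).le_opNorm _).trans ?_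
        gcongr
        linarith [hC _ (ha t ht').1]
      · have := hL t ht'
        have h3 : ‖b t - a t‖ ^ 2 ≤ (L * ‖h‖) ^ 2 := by gcongr
        rw [mul_assoc, ← mul_pow]
        gcongr)
    t ht
  have hC0 : (C : ℝ) + 1 ≠ 0 := by positivity
  rw [sub_zero, gronwallBound_of_K_ne_0 hC0] at hg
  refine hg.trans (le_of_eq ?_)
  ring

/-- The local flow of a smooth vector field on a relatively open subset of a half space, near a
point where the field points to the inside. -/
theorem exists_halfSpace_flow {k : ℕ} {O : Set (Coord (k + 1))} (hO : IsOpen O)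
    {f : Coord (k + 1) → Coord (k + 1)} (hf : ContDiffOn ℝ ∞ f ({y | 0 ≤ y 0} ∩ O))
    {y₀ : Coord (k + 1)} (hy₀ : y₀ ∈ {y : Coord (k + 1) | 0 ≤ y 0} ∩ O) (hpos : 0 < f y₀ 0) :
    ∃ R > 0, ∃ δ > 0, ∃ (α : Coord (k + 1) → ℝ → Coord (k + 1))
      (J : Coord (k + 1) → ℝ → Coord (k + 1) →L[ℝ] Coord (k + 1)),
      ∀ x ∈ closedBall y₀ R ∩ {y | 0 ≤ y 0}, α x 0 = x ∧ J x 0 = ContinuousLinearMap.id ℝ _ ∧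
        (∀ t ∈ Icc 0 δ, α x t ∈ {y : Coord (k + 1) | 0 ≤ y 0} ∩ O ∧
          HasDerivWithinAt (α x) (f (α x t)) (Icc 0 δ) t ∧
          HasDerivWithinAt (J x) (fderivWithin ℝ f ({y | 0 ≤ y 0} ∩ O) (α x t) ∘L J x t)
            (Icc 0 δ) t ∧
          HasFDerivWithinAt (fun x' => α x' t) (J x t) (closedBall y₀ R ∩ {y | 0 ≤ y 0}) x) ∧
        ∃ τ ∈ Icc 0 δ, (τ = δ ∨ (α x (-τ)) 0 = 0) ∧
          ∀ t ∈ Icc (-τ) 0, α x t ∈ {y : Coord (k + 1) | 0 ≤ y 0} ∩ O ∧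
            HasDerivWithinAt (α x) (f (α x t)) (Icc (-τ) 0) t := by
  set H : Set (Coord (k + 1)) := {y | 0 ≤ y 0} with hH
  set s := H ∩ O with hs
  have hHc : Convex ℝ H := by
    have : H = (EuclideanSpace.proj (0 : Fin (k + 1)) : Coord (k + 1) →L[ℝ] ℝ) ⁻¹' Ici 0 := rfl
    rw [this]
    exact (convex_Ici (𝕜 := ℝ) (0 : ℝ)).linear_preimage _
  have hHu : UniqueDiffOn ℝ H := uniqueDiffOn_convex hHc (by
    have hv : IsOpen {y : Coord (k + 1) | 0 < y 0} :=
      isOpen_lt continuous_const (EuclideanSpace.proj (0 : Fin (k + 1))).continuous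
    have hvH : {y : Coord (k + 1) | 0 < y 0} ⊆ H := fun y hy =>
      show (0 : ℝ) ≤ y 0 from le_of_lt (show (0 : ℝ) < y 0 from hy)
    exact ⟨stdVec 0, interior_maximal hvH hv
      (show (0 : ℝ) < (stdVec 0 : Coord (k + 1)) 0 by simp [stdVec])⟩)
  have hsu : UniqueDiffOn ℝ s := hHu.inter hO
  set A := fderivWithin ℝ f s with hA
  have hAs : ContDiffOn ℝ ∞ A s := ContDiffOn.fderivWithin' hf hsu
  obtain ⟨η₀, hη₀, hball⟩ := Metric.isOpen_iff.1 hO y₀ hy₀.2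
  have hsub : H ∩ ball y₀ η₀ ⊆ s := inter_subset_inter_right _ hball
  have hcv : Convex ℝ (H ∩ ball y₀ η₀) := hHc.inter (convex_ball _ _)
  obtain ⟨K₁, t₁, ht₁, hl₁⟩ := ((((hf.of_le (by simp)) y₀ hy₀ :
    ContDiffWithinAt ℝ 1 f s y₀).mono hsub)).exists_lipschitzOnWith hcv
  obtain ⟨K₂, t₂, ht₂, hl₂⟩ := ((((hAs.of_le (by simp)) y₀ hy₀ :
    ContDiffWithinAt ℝ 1 A s y₀).mono hsub)).exists_lipschitzOnWith hcv
  have hnb : 𝓝[H ∩ ball y₀ η₀] y₀ = 𝓝[H] y₀ :=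
    nhdsWithin_inter_of_mem' (mem_nhdsWithin_of_mem_nhds (ball_mem_nhds _ hη₀))
  rw [hnb] at ht₁ ht₂
  obtain ⟨η₁, hη₁, hb₁⟩ := Metric.mem_nhdsWithin_iff.1 (Filter.inter_mem ht₁ ht₂)
  set η₂ := min η₀ η₁ / 2 with hη₂
  have hη₂0 : 0 < η₂ := by positivity
  have hη₂0' : η₂ < η₀ := by
    have := min_le_left η₀ η₁; have : 0 < min η₀ η₁ := by positivity
    linarith
  have hη₂1 : η₂ < η₁ := by
    have := min_le_right η₀ η₁; have : 0 < min η₀ η₁ := by positivity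
    linarith
  set D := H ∩ closedBall y₀ η₂ with hD
  have hDc : Convex ℝ D := hHc.inter (convex_closedBall _ _)
  have hDs : D ⊆ s := fun y hy => hsub ⟨hy.1, closedBall_subset_ball hη₂0' hy.2⟩
  have hDt : D ⊆ t₁ ∩ t₂ := fun y hy => hb₁ ⟨closedBall_subset_ball hη₂1 hy.2, hy.1⟩
  have hf₁ : LipschitzOnWith K₁ f D := hl₁.mono fun y hy => (hDt hy).1
  have hA₁ : LipschitzOnWith K₂ A D := hl₂.mono fun y hy => (hDt hy).2
  -- The field and its derivative are extended to Lipschitz maps on the whole space, where the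
  -- equation is solved. The relevant trajectories are then shown to stay in `D`, where nothing was
  -- changed.
  obtain ⟨f', hf', hff'⟩ := hf₁.extend_finite_dimension
  obtain ⟨A', hA', hAA'⟩ := hA₁.extend_finite_dimension
  have hy₀D : y₀ ∈ D := ⟨hy₀.1, mem_closedBall_self hη₂0.le⟩
  have hpos' : ∀ᶠ y in 𝓝 y₀, 0 < f' y 0 := by
    have hc : Continuous fun y => f' y 0 :=
      (EuclideanSpace.proj (0 : Fin (k + 1)) : Coord (k + 1) →L[ℝ] ℝ).continuous.comp hf'.continuous
    refine hc.continuousAt.eventually (lt_mem_nhds ?_)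
    beta_reduce; rw [← hff' hy₀D]; exact hpos
  obtain ⟨η₃, hη₃, hb₃⟩ := Metric.eventually_nhds_iff_ball.1 hpos'
  set η := min η₂ (η₃ / 2) with hη
  have hη0 : 0 < η := by positivity
  obtain ⟨R, hR, δ, hδ, α, J, L, hα, hL⟩ := exists_linearized_flow hf' hA' y₀ hη0
  have hcb : closedBall y₀ η ⊆ closedBall y₀ η₂ := closedBall_subset_closedBall (min_le_left _ _)
  have hposα : ∀ y ∈ closedBall y₀ η, 0 < f' y 0 := fun y hy => hb₃ y
    (closedBall_subset_ball (by have := min_le_right η₂ (η₃ / 2); linarith) hy)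
  -- The field points inwards, so the coordinate `y 0` increases along trajectories: those that
  -- start in the half space remain there in positive time.
  have hmono : ∀ x ∈ closedBall y₀ R, StrictMonoOn (fun t => α x t 0) (Icc (-δ) δ) := by
    intro x hx
    have hd : ∀ t ∈ Icc (-δ) δ,
        HasDerivWithinAt (fun t => α x t 0) (f' (α x t) 0) (Icc (-δ) δ) t := fun t ht =>
      (EuclideanSpace.proj (0 : Fin (k + 1)) : Coord (k + 1) →L[ℝ] ℝ).hasFDerivAt.comp_hasDerivWithinAt
        t ((hα x hx).2.2 t ht).2.1
    refine strictMonoOn_of_hasDerivWithinAt_pos (convex_Icc _ _)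
      (fun t ht => (hd t ht).continuousWithinAt)
      (fun t ht => (hd t (interior_subset ht)).mono interior_subset)
      (fun t ht => hposα _ ((hα x hx).2.2 t (interior_subset ht)).1)
  have h0m : (0 : ℝ) ∈ Icc (-δ) δ := by constructor <;> linarith
  have hplus : Icc 0 δ ⊆ Icc (-δ) δ := Icc_subset_Icc_left (by linarith)
  have hfwd : ∀ x ∈ closedBall y₀ R ∩ H, ∀ t ∈ Icc 0 δ, α x t ∈ D := by
    intro x hx t ht
    refine ⟨?_, hcb ((hα x hx.1).2.2 t (hplus ht)).1⟩
    have := (hmono x hx.1).monotoneOn h0m (hplus ht) ht.1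
    simp only [(hα x hx.1).1] at this
    exact le_trans hx.2 this
  have hder : ∀ x ∈ closedBall y₀ R ∩ H, ∀ t ∈ Icc 0 δ, α x t ∈ D ∧
      HasDerivWithinAt (α x) (f (α x t)) (Icc 0 δ) t := fun x hx t ht =>
    ⟨hfwd x hx t ht, by
      rw [hff' (hfwd x hx t ht)]; exact ((hα x hx.1).2.2 t (hplus ht)).2.1.mono hplus⟩
  have hJd : ∀ x ∈ closedBall y₀ R ∩ H, ∀ t ∈ Icc 0 δ,
      HasDerivWithinAt (J x) (A (α x t) ∘L J x t) (Icc 0 δ) t := fun x hx t ht => by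
      rw [hAA' (hfwd x hx t ht)]; exact ((hα x hx.1).2.2 t (hplus ht)).2.2.mono hplus
  refine ⟨R, hR, δ, hδ, α, J, fun x hx => ⟨(hα x hx.1).1, (hα x hx.1).2.1, fun t ht =>
    ⟨hDs (hfwd x hx t ht), (hder x hx t ht).2, hJd x hx t ht, ?_⟩, ?_⟩⟩
  · have hAb : ∀ z ∈ D, ‖A z‖ ≤ ((‖A y₀‖₊ + K₂ * η₂.toNNReal : ℝ≥0) : ℝ) := by
      intro z hz
      have h1 : ‖z - y₀‖ ≤ η₂ := mem_closedBall_iff_norm.1 hz.2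
      have h2 := hA₁.norm_sub_le hz hy₀D
      have h3 := norm_sub_norm_le (A z) (A y₀)
      have h4 : (K₂ : ℝ) * ‖z - y₀‖ ≤ K₂ * η₂ := by gcongr
      have hη' := Real.coe_toNNReal η₂ hη₂0.le
      simp only [NNReal.coe_add, NNReal.coe_mul, coe_nnnorm, hη']
      linarith
    -- The deviation of the flow from its linearization is quadratic in `x' - x`, so `J x t` is the
    -- derivative in the initial point, also when `x` lies on the boundary.
    have key : ∀ x' ∈ closedBall y₀ R ∩ H, _ := fun x' hx' =>
      norm_flow_sub_le (L := L) hDc (fun z hz =>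
        ((hf.differentiableOn (by simp) z (hDs hz)).hasFDerivWithinAt.mono hDs)) hA₁ hAb
        (hder x hx) (hder x' hx') (hJd x hx) (hα x hx.1).2.1
        (fun t ht => by
          have := (hL t (hplus ht)).norm_sub_le hx'.1 hx.1
          simpa only [(hα x hx.1).1, (hα x' hx'.1).1] using this) ht
    simp only [(hα x hx.1).1] at key
    refine HasFDerivWithinAt.of_isLittleO ?_
    refine (Asymptotics.IsBigO.of_bound (g := fun x' => ‖x' - x‖ ^ 2)
      (K₂ * L ^ 2 / ((‖A y₀‖₊ + K₂ * η₂.toNNReal : ℝ≥0) + 1)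
        * (Real.exp (((‖A y₀‖₊ + K₂ * η₂.toNNReal : ℝ≥0) + 1) * t) - 1)) ?_).trans_isLittleO
      ((Asymptotics.isLittleO_pow_sub_sub x one_lt_two).mono nhdsWithin_le_nhds)
    filter_upwards [self_mem_nhdsWithin] with x' hx'
    have := key x' hx'
    rw [(hα x' hx'.1).1] at this
    simpa using this
  · have hm := hmono x hx.1
    have hα0 : α x 0 0 = x 0 := by rw [(hα x hx.1).1]
    have bwd : ∀ τ ∈ Icc 0 δ, 0 ≤ α x (-τ) 0 → ∀ t ∈ Icc (-τ) 0, α x t ∈ s ∧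
        HasDerivWithinAt (α x) (f (α x t)) (Icc (-τ) 0) t := by
      intro τ hτ hτ0 t ht
      have hsubI : Icc (-τ) 0 ⊆ Icc (-δ) δ := Icc_subset_Icc (by linarith [hτ.2]) hδ.le
      have hh := (hα x hx.1).2.2 t (hsubI ht)
      have hDm : α x t ∈ D := ⟨hτ0.trans (hm.monotoneOn
        (by constructor <;> linarith [hτ.1, hτ.2]) (hsubI ht) ht.1), hcb hh.1⟩
      exact ⟨hDs hDm, by rw [hff' hDm]; exact hh.2.1.mono hsubI⟩
    -- Backwards, a trajectory either stays in the half space up to time `-δ` or meets its boundary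
    -- at an earlier time given by the intermediate value theorem.
    by_cases hneg : 0 ≤ α x (-δ) 0
    · exact ⟨δ, ⟨hδ.le, le_rfl⟩, Or.inl rfl, bwd δ ⟨hδ.le, le_rfl⟩ hneg⟩
    · have hcont : ContinuousOn (fun t => α x t 0) (Icc (-δ) 0) := fun t ht =>
        ((EuclideanSpace.proj (0 : Fin (k + 1)) : Coord (k + 1) →L[ℝ] ℝ).continuous.continuousAt.comp_continuousWithinAt
        (((hα x hx.1).2.2 t ⟨ht.1, ht.2.trans hδ.le⟩).2.1.continuousWithinAt.mono
          (Icc_subset_Icc_right hδ.le)))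
      obtain ⟨σ, hσ, hσ0⟩ := intermediate_value_Icc (by linarith : -δ ≤ 0) hcont
        (show (0 : ℝ) ∈ _ from ⟨(not_le.1 hneg).le, by rw [hα0]; exact hx.2⟩)
      simp only at hσ0
      refine ⟨-σ, ⟨by linarith [hσ.2], by linarith [hσ.1]⟩, Or.inr (by rw [neg_neg]; exact hσ0),
        bwd _ ⟨by linarith [hσ.2], by linarith [hσ.1]⟩ (by rw [neg_neg, hσ0])⟩

end Flow

/-! ### Evolution along the integral curves of the gradient -/

section Evolution

variable {V : Type*} [NormedAddCommGroup V] [NormedSpace ℝ V]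

theorem eqOn_Icc_of_hasDerivWithinAt {F : Type*} [NormedAddCommGroup F] [NormedSpace ℝ F]
    {f g f' : ℝ → F} {δ : ℝ} (hf : ∀ t ∈ Icc 0 δ, HasDerivWithinAt f (f' t) (Icc 0 δ) t)
    (hg : ∀ t ∈ Icc 0 δ, HasDerivWithinAt g (f' t) (Icc 0 δ) t) (h0 : f 0 = g 0) :
    ∀ t ∈ Icc 0 δ, f t = g t :=
  eq_of_has_deriv_right_eq
    (fun t ht => (hf t (Ico_subset_Icc_self ht)).mono_of_mem_nhdsWithin (Icc_mem_nhdsGE_of_mem ht))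
    (fun t ht => (hg t (Ico_subset_Icc_self ht)).mono_of_mem_nhdsWithin (Icc_mem_nhdsGE_of_mem ht))
    (fun t ht => (hf t ht).continuousWithinAt) (fun t ht => (hg t ht).continuousWithinAt) h0

variable [FiniteDimensional ℝ V] {s : Set V} {B : V → V →L[ℝ] V →L[ℝ] ℝ} {ρ : V → ℝ} {N : V → V}

theorem MetricOn.hasDerivWithinAt_inner (h : MetricOn s B) {α a b : ℝ → V} {α' a' b' : V}
    {I : Set ℝ} {t : ℝ} (ht : t ∈ I) (hα : ∀ t ∈ I, α t ∈ s) (hd : HasDerivWithinAt α α' I t)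
    (ha : HasDerivWithinAt a a' I t) (hb : HasDerivWithinAt b b' I t) :
    HasDerivWithinAt (fun t => B (α t) (a t) (b t))
      (B (α t) (a' + chr s B (α t) α' (a t)) (b t) + B (α t) (a t) (b' + chr s B (α t) α' (b t)))
      I t := by
  have hB : HasDerivWithinAt (fun t => B (α t)) (fderivWithin ℝ B s (α t) α') I t :=
    (ContDiffOn.differentiableWithinAt' h.smooth (hα t ht)).hasFDerivWithinAt.comp_hasDerivWithinAt
      t hd hα
  refine ((hB.clm_apply ha).clm_apply hb).congr_deriv ?_
  simp only [add_apply, h.compat (hα t ht), map_add]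
  ring

/-- The curve `α` is an integral curve of `N` in `s`, defined for times in `[0, δ]`, and `J` is the
differential of the flow of `N` along this curve. -/
structure FlowOn (s : Set V) (N : V → V) (δ : ℝ) (α : ℝ → V) (J : ℝ → V →L[ℝ] V) : Prop where
  mem : ∀ t ∈ Icc 0 δ, α t ∈ s
  deriv : ∀ t ∈ Icc 0 δ, HasDerivWithinAt α (N (α t)) (Icc 0 δ) t
  deriv_flow : ∀ t ∈ Icc 0 δ,
    HasDerivWithinAt J (fderivWithin ℝ N s (α t) ∘L J t) (Icc 0 δ) t
  start : J 0 = ContinuousLinearMap.id ℝ V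

namespace FlowOn

variable {δ : ℝ} {α : ℝ → V} {J : ℝ → V →L[ℝ] V}

theorem hasDerivWithinAt_apply (hα : FlowOn s N δ α J) {t : ℝ} (ht : t ∈ Icc 0 δ) (u : V) :
    HasDerivWithinAt (fun t => J t u) (fderivWithin ℝ N s (α t) (J t u)) (Icc 0 δ) t :=
  ((hα.deriv_flow t ht).clm_apply (hasDerivWithinAt_const t _ u)).congr_deriv (by simp)

/-- The field `A J u` is parallel along the curve. Indeed `∇_N (J u) = ∇_{J u} N` for a field
transported by the flow, so Codazzi turns `∇_N (A J u)` into `(∇_{J u} A) N + A ∇_{J u} N = ∇_{J u}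
(A N)`, and `A N = 0`. -/
theorem hasDerivWithinAt_shape (hα : FlowOn s N δ α J) (h : HypOn s B ρ N) {t : ℝ}
    (ht : t ∈ Icc 0 δ) (u : V) :
    HasDerivWithinAt (fun t => shape s (chr s B) N (α t) (J t u))
      (-chr s B (α t) (N (α t)) (shape s (chr s B) N (α t) (J t u))) (Icc 0 δ) t := by
  have hy := hα.mem t ht
  have hSd := ContDiffOn.differentiableWithinAt' h.contDiffOn_shape hy
  have hS : HasDerivWithinAt (fun t => shape s (chr s B) N (α t))
      (fderivWithin ℝ (shape s (chr s B) N) s (α t) (N (α t))) (Icc 0 δ) t :=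
    hSd.hasFDerivWithinAt.comp_hasDerivWithinAt t (hα.deriv t ht) hα.mem
  refine (hS.clm_apply (hα.hasDerivWithinAt_apply ht u)).congr_deriv ?_
  have h1 := h.codazzi hy (N (α t)) (J t u)
  have h2 := fderivWithin_apply₁ (h.uniq _ hy) hSd
    (ContDiffOn.differentiableWithinAt' h.contDiffOn_grad hy) (J t u)
  have h3 : fderivWithin ℝ (fun z => shape s (chr s B) N z (N z)) s (α t) = 0 := by
    rw [fderivWithin_congr (fun z hz => HypOn.shape_normal s B N z) (HypOn.shape_normal s B N _),
      fderivWithin_const_apply]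
  rw [h3, zero_apply] at h2
  rw [HypOn.shape_normal s B N _, map_zero, add_zero] at h1
  rw [eq_neg_iff_add_eq_zero, add_right_comm, h1, h2]

theorem fun_eq (hα : FlowOn s N δ α J) (h : HypOn s B ρ N) (h0 : ρ (α 0) = 0) :
    ∀ t ∈ Icc 0 δ, ρ (α t) = t :=
  eqOn_Icc_of_hasDerivWithinAt (f' := fun _ => 1) (fun t ht => by
    have hy := hα.mem t ht
    refine ((ContDiffOn.differentiableWithinAt' h.smooth_fun
      hy).hasFDerivWithinAt.comp_hasDerivWithinAt t (hα.deriv t ht) hα.mem).congr_deriv ?_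
    rw [← h.grad _ hy, h.unit _ hy]) (fun t _ => hasDerivWithinAt_id t _) h0

theorem inner_normal (hα : FlowOn s N δ α J) (h : HypOn s B ρ N) (u : V) :
    ∀ t ∈ Icc 0 δ, B (α t) (N (α t)) (J t u) = B (α 0) (N (α 0)) u := by
  refine eqOn_Icc_of_hasDerivWithinAt (f' := fun _ => 0) (fun t ht => ?_)
    (fun t _ => hasDerivWithinAt_const t _ _) (by simp [hα.start])
  have hy := hα.mem t ht
  have hN : HasDerivWithinAt (fun t => N (α t)) (fderivWithin ℝ N s (α t) (N (α t))) (Icc 0 δ) t :=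
    (ContDiffOn.differentiableWithinAt' h.contDiffOn_grad hy).hasFDerivWithinAt.comp_hasDerivWithinAt
      t (hα.deriv t ht) hα.mem
  refine (h.hasDerivWithinAt_inner ht hα.mem (hα.deriv t ht) hN
    (hα.hasDerivWithinAt_apply ht u)).congr_deriv ?_
  rw [h.chr_symm hy (N (α t)) (J t u), ← cov_apply, ← cov_apply, h.cov_eq hy, h.cov_eq hy,
    HypOn.shape_normal s B N _, map_neg, map_smul, h.symm _ hy (N (α t))]
  simp [h.shape_symm hy (J t u) (N (α t)), HypOn.shape_normal s B N _]

theorem inner_shape_shape (hα : FlowOn s N δ α J) (h : HypOn s B ρ N) (u v : V) :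
    ∀ t ∈ Icc 0 δ, B (α t) (shape s (chr s B) N (α t) (J t u)) (shape s (chr s B) N (α t) (J t v)) =
      B (α 0) (shape s (chr s B) N (α 0) u) (shape s (chr s B) N (α 0) v) := by
  refine eqOn_Icc_of_hasDerivWithinAt (f' := fun _ => 0) (fun t ht => ?_)
    (fun t _ => hasDerivWithinAt_const t _ _) (by simp [hα.start])
  refine (h.hasDerivWithinAt_inner ht hα.mem (hα.deriv t ht) (hα.hasDerivWithinAt_shape h ht u)
    (hα.hasDerivWithinAt_shape h ht v)).congr_deriv ?_
  simp

/-- Since `A J u` is parallel, only `∇_N (J v) = -t A J v` contributes to the derivative, which is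
`-t` times the constant of `inner_shape_shape`. -/
theorem inner_shape (hα : FlowOn s N δ α J) (h : HypOn s B ρ N) (h0 : ρ (α 0) = 0) (u v : V) :
    ∀ t ∈ Icc 0 δ, B (α t) (shape s (chr s B) N (α t) (J t u)) (J t v) =
      B (α 0) (shape s (chr s B) N (α 0) u) v - t ^ 2 / 2 *
        B (α 0) (shape s (chr s B) N (α 0) u) (shape s (chr s B) N (α 0) v) := by
  refine eqOn_Icc_of_hasDerivWithinAt (f' := fun t => -(t *
        B (α 0) (shape s (chr s B) N (α 0) u) (shape s (chr s B) N (α 0) v)))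
    (fun t ht => ?_) (fun t _ => ?_) (by simp [hα.start])
  · have hy := hα.mem t ht
    refine (h.hasDerivWithinAt_inner ht hα.mem (hα.deriv t ht) (hα.hasDerivWithinAt_shape h ht u)
      (hα.hasDerivWithinAt_apply ht v)).congr_deriv ?_
    rw [h.chr_symm hy (N (α t)) (J t v), ← cov_apply, h.cov_eq hy, map_neg, map_smul,
      hα.inner_shape_shape h u v t ht, hα.fun_eq h h0 t ht]
    simp
  · refine ((((hasDerivAt_id t).pow 2).div_const 2).mul_const _).const_sub _
      |>.hasDerivWithinAt.congr_deriv ?_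
    simp

/-- The derivative is `-2 t B(A J u, J v)`, a known polynomial by `inner_shape`; integrating it
produces the coefficients `-1` and `1 / 4`. -/
theorem inner_eq (hα : FlowOn s N δ α J) (h : HypOn s B ρ N) (h0 : ρ (α 0) = 0) (u v : V) :
    ∀ t ∈ Icc 0 δ, B (α t) (J t u) (J t v) =
      B (α 0) u v - t ^ 2 * B (α 0) (shape s (chr s B) N (α 0) u) v + t ^ 4 / 4 *
        B (α 0) (shape s (chr s B) N (α 0) u) (shape s (chr s B) N (α 0) v) := by
  refine eqOn_Icc_of_hasDerivWithinAt (f' := fun t => -(2 * t) *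
      (B (α 0) (shape s (chr s B) N (α 0) u) v - t ^ 2 / 2 *
        B (α 0) (shape s (chr s B) N (α 0) u) (shape s (chr s B) N (α 0) v)))
    (fun t ht => ?_) (fun t _ => ?_) (by simp [hα.start])
  · have hy := hα.mem t ht
    refine (h.hasDerivWithinAt_inner ht hα.mem (hα.deriv t ht) (hα.hasDerivWithinAt_apply ht u)
      (hα.hasDerivWithinAt_apply ht v)).congr_deriv ?_
    rw [h.chr_symm hy (N (α t)) (J t v), h.chr_symm hy (N (α t)) (J t u), ← cov_apply, ← cov_apply,
      h.cov_eq hy, h.cov_eq hy, h.symm _ hy (J t u), map_neg, map_smul, neg_apply, smul_apply,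
      map_neg, map_smul, neg_apply, smul_apply, h.shape_symm hy (J t v),
      hα.inner_shape h h0 u v t ht, hα.fun_eq h h0 t ht]
    simp only [smul_eq_mul]; ring
  · refine ((((hasDerivAt_id t).pow 2).mul_const _).const_sub _).add
      ((((hasDerivAt_id t).pow 4).div_const 4).mul_const _) |>.hasDerivWithinAt.congr_deriv ?_
    simp; ring

end FlowOn

end Evolution

/-- The differential of the flow is injective. -/
theorem FlowOn.injective {V : Type*} [NormedAddCommGroup V] [NormedSpace ℝ V]
    [FiniteDimensional ℝ V] {s : Set V} {N : V → V} (hs : UniqueDiffOn ℝ s)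
    (hN : ContDiffOn ℝ ∞ N s) {δ : ℝ} {α : ℝ → V} {J : ℝ → V →L[ℝ] V} (hα : FlowOn s N δ α J) {t : ℝ} (ht : t ∈ Icc 0 δ) :
    Function.Injective (J t) := by
  refine (injective_iff_map_eq_zero (J t)).2 fun u hu => ?_
  have hsub : Icc 0 t ⊆ Icc 0 δ := Icc_subset_Icc_right ht.2
  have hcont : ContinuousOn (fun τ => ‖fderivWithin ℝ N s (α τ)‖) (Icc 0 δ) :=
    ((ContDiffOn.fderivWithin' hN hs).continuousOn.comp
      (fun τ hτ => (hα.deriv τ hτ).continuousWithinAt) hα.mem).norm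
  obtain ⟨C, hC⟩ := isCompact_Icc.bddAbove_image hcont
  have hC' : ∀ τ ∈ Icc 0 δ, ‖fderivWithin ℝ N s (α τ)‖ ≤ C := fun τ hτ =>
    hC ⟨τ, hτ, rfl⟩
  -- A solution of the linearized equation that vanishes at time `t` vanishes at all earlier times,
  -- hence at time `0`, where `J` is the identity.
  have h := ODE_solution_unique_of_mem_Icc_left (v := fun τ w => fderivWithin ℝ N s (α τ) w)
    (s := fun _ => univ) (K := C.toNNReal) (f := fun τ => J τ u) (g := fun _ => 0) (a := 0) (b := t)
    (fun τ hτ => ?_)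
    (fun τ hτ => (hα.hasDerivWithinAt_apply (hsub hτ) u).continuousWithinAt.mono hsub)
    (fun τ hτ => (hα.hasDerivWithinAt_apply (hsub (Ioc_subset_Icc_self hτ)) u).mono_of_mem_nhdsWithin
      (Filter.mem_of_superset (Icc_mem_nhdsLE_of_mem hτ) hsub))
    (fun _ _ => trivial) continuousOn_const
    (fun τ _ => by simpa using hasDerivWithinAt_const τ (Iic τ) (0 : V)) (fun _ _ => trivial) hu
  · have := h ⟨le_rfl, ht.1⟩
    simpa [hα.start] using this
  · refine LipschitzOnWith.mono ?_ (subset_univ _)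
    rw [lipschitzOnWith_univ]
    refine (fderivWithin ℝ N s (α τ)).lipschitz.weaken ?_
    rw [← NNReal.coe_le_coe]
    exact (hC' τ (hsub (Ioc_subset_Icc_self hτ))).trans (Real.le_coe_toNNReal C)

/-! ### Coefficients of tensors in charts -/

section Charts

variable {m : ℕ} {H : Type*} [TopologicalSpace H] {I : ModelWithCorners ℝ (Coord m) H}
  {M : Type*} [TopologicalSpace M] [ChartedSpace H M]

/-- The differential of the inverse of the chart at `x₀`. -/
def chartInv (I : ModelWithCorners ℝ (Coord m) H) {M : Type*} [TopologicalSpace M]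
    [ChartedSpace H M] (x₀ : M) (y : Coord m) :
    Coord m →L[ℝ] TangentSpace I ((extChartAt I x₀).symm y) :=
  mfderivWithin 𝓘(ℝ, Coord m) I (extChartAt I x₀).symm (range I) y

/-- The differential of the chart at `x₀`. -/
def chartDiff (I : ModelWithCorners ℝ (Coord m) H) {M : Type*} [TopologicalSpace M]
    [ChartedSpace H M] (x₀ x : M) : TangentSpace I x →L[ℝ] Coord m :=
  mfderiv I 𝓘(ℝ, Coord m) (extChartAt I x₀) x

/-- The coefficients of `T` in the chart at `x₀`, as a field of bilinear forms. -/
def coeff (T : BilinField I M) (x₀ : M) (y : Coord m) : Coord m →L[ℝ] Coord m →L[ℝ] ℝ :=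
  ContinuousLinearMap.bilinearComp (E := Coord m) (F := Coord m) (G := ℝ)
    (T ((extChartAt I x₀).symm y)) (chartInv I x₀ y) (chartInv I x₀ y)

theorem chartForm_eq (T : BilinField I M) (x₀ : M) :
    chartForm T x₀ = fun y u v => coeff T x₀ y u v := rfl

theorem coeff_apply (T : BilinField I M) (x₀ : M) (y u v : Coord m) :
    coeff T x₀ y u v =
      T ((extChartAt I x₀).symm y) (chartInv I x₀ y u) (chartInv I x₀ y v) := rfl

/-- The part of the range of the chart at `x₀` that corresponds to `U`. -/
def chartSet (I : ModelWithCorners ℝ (Coord m) H) {M : Type*} [TopologicalSpace M]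
    [ChartedSpace H M] (x₀ : M) (U : Set M) : Set (Coord m) :=
  (extChartAt I x₀).target ∩ (extChartAt I x₀).symm ⁻¹' U

theorem chartSet_eq (x₀ : M) {U : Set M} (hU : IsOpen U) :
    ∃ O, IsOpen O ∧ chartSet I x₀ U = range I ∩ O := by
  refine ⟨I.symm ⁻¹' ((chartAt H x₀).target ∩ (chartAt H x₀).symm ⁻¹' U),
    ((chartAt H x₀).isOpen_inter_preimage_symm hU).preimage I.continuous_symm, ?_⟩
  rw [chartSet, extChartAt_target]
  ext y
  simp only [mem_inter_iff, mem_preimage, extChartAt_coe_symm, Function.comp]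
  tauto

theorem mem_chartSet {x₀ x : M} {U : Set M} (hx : x ∈ (extChartAt I x₀).source) (hU : x ∈ U) :
    extChartAt I x₀ x ∈ chartSet I x₀ U :=
  ⟨(extChartAt I x₀).map_source hx, by rwa [mem_preimage, (extChartAt I x₀).left_inv hx]⟩

theorem uniqueDiffOn_chartSet (x₀ : M) {U : Set M} (hU : IsOpen U) :
    UniqueDiffOn ℝ (chartSet I x₀ U) := by
  obtain ⟨O, hO, h⟩ := chartSet_eq (I := I) x₀ hU
  rw [h]
  exact I.uniqueDiffOn.inter hO

theorem chartSet_dense (x₀ : M) {U : Set M} (hU : IsOpen U) :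
    chartSet I x₀ U ⊆ closure (interior (chartSet I x₀ U)) := by
  obtain ⟨O, hO, h⟩ := chartSet_eq (I := I) x₀ hU
  rw [h, interior_inter, hO.interior_eq]
  exact fun y hy => hO.closure_inter ⟨I.range_subset_closure_interior hy.1, hy.2⟩

theorem chartSet_mem_nhdsWithin {x₀ : M} {U : Set M} (hU : IsOpen U) {y : Coord m}
    (hy : y ∈ chartSet I x₀ U) : chartSet I x₀ U ∈ 𝓝[range I] y := by
  obtain ⟨O, hO, h⟩ := chartSet_eq (I := I) x₀ hU
  rw [h] at hy ⊢
  exact inter_mem_nhdsWithin _ (hO.mem_nhds hy.2)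

theorem interior_chartSet_subset (x₀ : M) (U : Set M) :
    interior (chartSet I x₀ U) ⊆ interior (range I) :=
  interior_mono fun _ hy => extChartAt_target_subset_range x₀ hy.1

variable [IsManifold I ∞ M]

theorem chartDiff_chartInv {x₀ : M} {y : Coord m} (hy : y ∈ (extChartAt I x₀).target)
    (u : Coord m) : chartDiff I x₀ ((extChartAt I x₀).symm y) (chartInv I x₀ y u) = u := by
  have : IsManifold I 1 M := IsManifold.of_le (n := ∞) (by simp)
  exact congrArg (fun L => L u) (mfderiv_extChartAt_comp_mfderivWithin_extChartAt_symm hy)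

theorem chartInv_chartDiff {x₀ : M} {y : Coord m} (hy : y ∈ (extChartAt I x₀).target)
    (u : TangentSpace I ((extChartAt I x₀).symm y)) :
    chartInv I x₀ y (chartDiff I x₀ ((extChartAt I x₀).symm y) u) = u := by
  have : IsManifold I 1 M := IsManifold.of_le (n := ∞) (by simp)
  exact congrArg (fun L => L u) (mfderivWithin_extChartAt_symm_comp_mfderiv_extChartAt hy)

/-- Smoothness of a tensor is defined through bundle trivializations; those of the tangent bundle
are the chart differentials, so it can be tested on `coeff`. -/
theorem trivializationAt_eq_coeff (T : BilinField I M) {x₀ x : M}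
    (hx : x ∈ (extChartAt I x₀).source) :
    (trivializationAt (Coord m →L[ℝ] Coord m →L[ℝ] ℝ)
      (fun x : M => TangentSpace I x →L[ℝ] TangentSpace I x →L[ℝ] ℝ) x₀ ⟨x, T x⟩).2 =
      coeff T x₀ (extChartAt I x₀ x) := by
  have : IsManifold I 1 M := IsManifold.of_le (n := ∞) (by simp)
  have hx' : x ∈ (chartAt H x₀).source := by rwa [extChartAt_source] at hx
  have hb : x ∈ (trivializationAt (Coord m) (TangentSpace I : M → Type _) x₀).baseSet := by
    rwa [TangentBundle.trivializationAt_baseSet]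
  ext u v
  rw [hom_trivializationAt_apply]
  refine (inCoordinates_apply_eq₂ (F₁ := Coord m) (F₂ := Coord m) (F₃ := ℝ)
    (E₁ := (TangentSpace I : M → Type _)) (E₂ := (TangentSpace I : M → Type _))
    (E₃ := Bundle.Trivial M ℝ) hb hb (mem_univ _)).trans ?_
  have h1 := TangentBundle.symmL_trivializationAt (I := I) hx'
  have h2 : ∀ w, (trivializationAt (Coord m) (TangentSpace I : M → Type _) x₀).symm x w =
      mfderivWithin 𝓘(ℝ, Coord m) I (extChartAt I x₀).symm (range I) (extChartAt I x₀ x) w := by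
    intro w
    exact (Trivialization.symmL_apply _ hb w).symm.trans (congrArg (fun L => L w) h1)
  rw [h2, h2, coeff_apply, chartInv, (extChartAt I x₀).left_inv hx]
  have h3 : (trivializationAt ℝ (Bundle.Trivial M ℝ) x₀).linearMapAt ℝ x = LinearMap.id :=
    Bundle.Trivial.linearMapAt_trivialization ℝ M ℝ x
  rw [h3]
  rfl

theorem contDiffOn_coeff {T : BilinField I M} {U : Set M} (hT : SmoothBilinOn T U) (x₀ : M) :
    ContDiffOn ℝ ∞ (coeff T x₀) (chartSet I x₀ U) := by
  have h1 : ContMDiffOn I 𝓘(ℝ, Coord m →L[ℝ] Coord m →L[ℝ] ℝ) ∞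
      (fun x => coeff T x₀ (extChartAt I x₀ x)) (U ∩ (extChartAt I x₀).source) := by
    intro x hx
    have hb : x ∈ (trivializationAt (Coord m →L[ℝ] Coord m →L[ℝ] ℝ)
      (fun x : M => TangentSpace I x →L[ℝ] TangentSpace I x →L[ℝ] ℝ) x₀).baseSet := by
      have := hx.2; rw [extChartAt_source] at this
      simpa [TangentBundle.trivializationAt_baseSet] using this
    have h := (Trivialization.contMDiffWithinAt_section _ hb).1 (hT x hx.1)
    exact (h.mono inter_subset_left).congr
      (fun z hz => (trivializationAt_eq_coeff T hz.2).symm)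
      (trivializationAt_eq_coeff T hx.2).symm
  have h2 : ContMDiffOn 𝓘(ℝ, Coord m) 𝓘(ℝ, Coord m →L[ℝ] Coord m →L[ℝ] ℝ) ∞
      (fun y => coeff T x₀ (extChartAt I x₀ ((extChartAt I x₀).symm y))) (chartSet I x₀ U) :=
    h1.comp ((contMDiffOn_extChartAt_symm x₀).mono inter_subset_left)
      fun y hy => ⟨hy.2, (extChartAt I x₀).map_target hy.1⟩
  exact h2.contDiffOn.congr fun y hy => by rw [(extChartAt I x₀).right_inv hy.1]

theorem smoothBilinOn_of_coeff {T : BilinField I M}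
    (hT : ∀ x : M, ∃ U, IsOpen U ∧ x ∈ U ∧ ContDiffOn ℝ ∞ (coeff T x) (chartSet I x U)) :
    SmoothBilinOn T univ := by
  intro x _
  obtain ⟨U, hU, hxU, h⟩ := hT x
  have hb : x ∈ (trivializationAt (Coord m →L[ℝ] Coord m →L[ℝ] ℝ)
      (fun x : M => TangentSpace I x →L[ℝ] TangentSpace I x →L[ℝ] ℝ) x).baseSet :=
    mem_baseSet_trivializationAt _ _ x
  refine ContMDiffAt.contMDiffWithinAt ((Trivialization.contMDiffAt_section_iff _ hb).2 ?_)
  have h1 : ContMDiffOn I 𝓘(ℝ, Coord m →L[ℝ] Coord m →L[ℝ] ℝ) ∞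
      (fun z => coeff T x (extChartAt I x z)) ((extChartAt I x).source ∩ U) :=
    h.contMDiffOn.comp ((contMDiffOn_extChartAt (x := x)).mono
      (by rw [extChartAt_source]; exact inter_subset_left)) fun z hz => mem_chartSet hz.1 hz.2
  have hn : (extChartAt I x).source ∩ U ∈ 𝓝 x :=
    Filter.inter_mem (extChartAt_source_mem_nhds x) (hU.mem_nhds hxU)
  refine (h1.contMDiffAt hn).congr_of_eventuallyEq ?_
  filter_upwards [hn] with z hz using trivializationAt_eq_coeff T hz.1

theorem RiemMetric.smoothBilinOn (g : RiemMetric I M) (U : Set M) : SmoothBilinOn g.inner U :=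
  g.contMDiff.contMDiffOn

theorem coeff_symm (g : RiemMetric I M) (x₀ : M) (y u v : Coord m) :
    coeff g.inner x₀ y u v = coeff g.inner x₀ y v u := g.symm _ _ _

theorem coeff_pos (g : RiemMetric I M) {x₀ : M} {y : Coord m}
    (hy : y ∈ (extChartAt I x₀).target) {u : Coord m} (hu : u ≠ 0) :
    0 < coeff g.inner x₀ y u u := by
  refine g.pos _ _ fun h => hu ?_
  exact (chartDiff_chartInv hy u).symm.trans
    ((congrArg (chartDiff I x₀ ((extChartAt I x₀).symm y)) h).trans (map_zero _))

/-- The coefficients of a Riemannian metric in a chart. -/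
theorem RiemMetric.metricOn (g : RiemMetric I M) (x₀ : M) {U : Set M} (hU : IsOpen U) :
    MetricOn (chartSet I x₀ U) (coeff g.inner x₀) :=
  ⟨uniqueDiffOn_chartSet x₀ hU, chartSet_dense x₀ hU, contDiffOn_coeff (g.smoothBilinOn U) x₀,
    fun y _ => coeff_symm g x₀ y, fun _ hy _ hu => coeff_pos g hy.1 hu⟩

end Charts

/-! ### Functions, gradients and geodesic compactifications in charts -/

theorem curv_congr {V : Type*} [NormedAddCommGroup V] [NormedSpace ℝ V] {O : Set V}
    {B B' : V → V →L[ℝ] V →L[ℝ] ℝ} (h : EqOn B B' O) {y : V} (hy : y ∈ O) :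
    curv O (chr O B) y = curv O (chr O B') y := by
  have h1 : EqOn (chr O B) (chr O B') O := fun z hz => by
    rw [chr, chr, h hz, fderivWithin_congr h (h hz)]
  ext u v w
  rw [curv, curv, fderivWithin_congr h1 (h1 hy), h1 hy]

section Charts

variable {m : ℕ} {H : Type*} [TopologicalSpace H] {I : ModelWithCorners ℝ (Coord m) H}
  {M : Type*} [TopologicalSpace M] [ChartedSpace H M]

/-- The gradient is dual to the differential. -/
theorem inner_grad {g : BilinField I M} {r : M → ℝ} {x : M} (hpos : ∀ u, u ≠ 0 → 0 < g x u u)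
    (hsymm : ∀ u v, g x u v = g x v u) (v : TangentSpace I x) :
    g x (grad g r x) v = diff I r x v := by
  let B : Coord m →L[ℝ] Coord m →L[ℝ] ℝ := g x
  let l : Coord m →L[ℝ] ℝ := diff I r x
  have hB : B.IsInvertible := isInvertible_of_pos hpos
  obtain ⟨e, he⟩ := hB
  have ha : ∀ w, B (e.symm l) w = l w := fun w => by rw [← he]; simp
  have h1 : grad g r x = e.symm l := sharp_eq (B := B) hpos hsymm ha
  rw [h1]
  exact ha v

variable [IsManifold I ∞ M]

theorem hasFDerivWithinAt_comp_symm {F : Type*} [NormedAddCommGroup F] [NormedSpace ℝ F]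
    {φ : M → F} {x₀ : M} {y : Coord m} (hy : y ∈ (extChartAt I x₀).target)
    {L : TangentSpace I ((extChartAt I x₀).symm y) →L[ℝ] F}
    (hφ : HasMFDerivAt I 𝓘(ℝ, F) φ ((extChartAt I x₀).symm y) L) :
    HasFDerivWithinAt (φ ∘ (extChartAt I x₀).symm)
      (L ∘L chartInv I x₀ y : Coord m →L[ℝ] F) (range I) y := by
  have : IsManifold I 1 M := IsManifold.of_le (n := ∞) (by simp)
  have h1 : HasMFDerivWithinAt 𝓘(ℝ, Coord m) I (extChartAt I x₀).symm (range I) y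
      (chartInv I x₀ y) := (mdifferentiableWithinAt_extChartAt_symm hy).hasMFDerivWithinAt
  exact (hφ.comp_hasMFDerivWithinAt y h1).hasFDerivWithinAt

theorem fderivWithin_comp_symm {F : Type*} [NormedAddCommGroup F] [NormedSpace ℝ F]
    {φ : M → F} {x₀ : M} {U : Set M} (hU : IsOpen U) {y : Coord m} (hy : y ∈ chartSet I x₀ U)
    {L : TangentSpace I ((extChartAt I x₀).symm y) →L[ℝ] F}
    (hφ : HasMFDerivAt I 𝓘(ℝ, F) φ ((extChartAt I x₀).symm y) L) (u : Coord m) :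
    fderivWithin ℝ (φ ∘ (extChartAt I x₀).symm) (chartSet I x₀ U) y u = L (chartInv I x₀ y u) := by
  have h := ((hasFDerivWithinAt_comp_symm hy.1 hφ).mono
    (fun z hz => extChartAt_target_subset_range x₀ hz.1)).fderivWithin
    (uniqueDiffOn_chartSet x₀ hU y hy)
  exact congrArg (fun L => L u) h

theorem contDiffOn_comp_symm {F : Type*} [NormedAddCommGroup F] [NormedSpace ℝ F] {φ : M → F}
    {U : Set M} (hφ : ContMDiffOn I 𝓘(ℝ, F) ∞ φ U) (x₀ : M) :
    ContDiffOn ℝ ∞ (φ ∘ (extChartAt I x₀).symm) (chartSet I x₀ U) :=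
  (hφ.comp ((contMDiffOn_extChartAt_symm x₀).mono inter_subset_left) fun _ hy => hy.2).contDiffOn

theorem chartInv_chartField (N : ∀ x : M, TangentSpace I x) {x₀ : M} {y : Coord m}
    (hy : y ∈ (extChartAt I x₀).target) :
    chartInv I x₀ y (chartField N x₀ y) = N ((extChartAt I x₀).symm y) :=
  chartInv_chartDiff hy _

theorem mem_interior_of_mem_target {x₀ : M} {y : Coord m} (hy : y ∈ (extChartAt I x₀).target) :
    (extChartAt I x₀).symm y ∈ I.interior M ↔ y ∈ interior (range I) := by
  have : IsManifold I 1 M := IsManifold.of_le (n := ∞) (by simp)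
  have h := I.isInteriorPoint_iff_of_mem_atlas (n := 1) (x := (extChartAt I x₀).symm y) (by simp)
    (chart_mem_atlas H x₀) (by simpa only [extChartAt_source] using (extChartAt I x₀).map_target hy)
  refine h.trans ?_
  change extChartAt I x₀ ((extChartAt I x₀).symm y) ∈ interior (extChartAt I x₀).target ↔ _
  rw [(extChartAt I x₀).right_inv hy, extChartAt_target, interior_inter,
    ((chartAt H x₀).open_target.preimage I.continuous_symm).interior_eq]
  rw [extChartAt_target] at hy
  exact ⟨fun h => h.2, fun h => ⟨hy.1, h⟩⟩

theorem RiemMetric.inner_grad (gbar : RiemMetric I M) (r : M → ℝ) (x : M) (v : TangentSpace I x) :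
    gbar.inner x (grad gbar.inner r x) v = diff I r x v :=
  HypPoincare.inner_grad (gbar.pos x) (gbar.symm x) v

theorem hasMFDerivAt_diff {r : M → ℝ} (hr : ContMDiff I 𝓘(ℝ, ℝ) ∞ r) (x : M) :
    HasMFDerivAt I 𝓘(ℝ, ℝ) r x (diff I r x) :=
  ((hr x).mdifferentiableAt (by simp)).hasMFDerivAt

theorem gradientOn_chart (gbar : RiemMetric I M) {r : M → ℝ} (hr : ContMDiff I 𝓘(ℝ, ℝ) ∞ r)
    {U : Set M} (hU : IsOpen U) (x₀ : M) :
    GradientOn (chartSet I x₀ U) (coeff gbar.inner x₀) (r ∘ (extChartAt I x₀).symm)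
      (chartField (grad gbar.inner r) x₀) := by
  refine ⟨gbar.metricOn x₀ hU, contDiffOn_comp_symm hr.contMDiffOn x₀, fun y hy v => ?_⟩
  rw [fderivWithin_comp_symm hU hy (hasMFDerivAt_diff hr _), ← gbar.inner_grad, coeff_apply,
    chartInv_chartField _ hy.1]

/-- The data of a hyperbolic metric `g` on the interior of `M` with a compactification
`gbar = r² g` such that `|dr| = 1` on the open set `U`. -/
structure IsGeodesicOn (g : BilinField I M) (r : M → ℝ) (gbar : RiemMetric I M)
    (U : Set M) : Prop where
  isOpen : IsOpen U
  defining : IsDefiningFunction I r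
  compactification : IsCompactification g r gbar
  unit : ∀ x ∈ U, normSqDiff gbar.inner r x = 1
  curvature : HasConstCurvature g (-1)

namespace IsGeodesicOn

variable {g : BilinField I M} {r : M → ℝ} {gbar : RiemMetric I M} {U : Set M}

theorem coeff_eq_conf (h : IsGeodesicOn g r gbar U) {x₀ : M} {y : Coord m}
    (hy : y ∈ interior (chartSet I x₀ U)) :
    coeff g x₀ y = conf (r ∘ (extChartAt I x₀).symm) (coeff gbar.inner x₀) y := by
  have hy1 := (interior_subset hy).1
  have hint := (mem_interior_of_mem_target hy1).2 (interior_chartSet_subset x₀ U hy)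
  ext u v
  have h1 := h.compactification _ hint
  have hr := h.defining.pos _ hint
  simp only [conf, smul_apply, coeff_apply, h1, smul_eq_mul, Function.comp]
  have h2 : r ((extChartAt I x₀).symm y) ^ 2 ≠ 0 := by positivity
  exact (inv_mul_cancel_left₀ h2 _).symm

/-- Passage to the local theory. The coefficients of `g` are compared with `conf` only on the
interior of the chart set, which is all that the curvature condition needs. -/
theorem hypOn (h : IsGeodesicOn g r gbar U) (x₀ : M) :
    HypOn (chartSet I x₀ U) (coeff gbar.inner x₀) (r ∘ (extChartAt I x₀).symm)
      (chartField (grad gbar.inner r) x₀) := by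
  have hpos : ∀ y ∈ interior (chartSet I x₀ U), 0 < (r ∘ (extChartAt I x₀).symm) y := fun y hy =>
    h.defining.pos _ ((mem_interior_of_mem_target (interior_subset hy).1).2
      (interior_chartSet_subset x₀ U hy))
  refine ⟨gradientOn_chart gbar h.defining.smooth h.isOpen x₀, fun y hy => ?_, hpos,
    fun y hy u v => ?_⟩
  · rw [coeff_apply, chartInv_chartField _ hy.1, RiemMetric.inner_grad]
    exact h.unit _ hy.2
  · have heq : EqOn (coeff g x₀) (conf (r ∘ (extChartAt I x₀).symm) (coeff gbar.inner x₀))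
        (interior (chartSet I x₀ U)) := fun z hz => h.coeff_eq_conf hz
    have hconf := ((gradientOn_chart gbar h.defining.smooth h.isOpen x₀).mono_open
      isOpen_interior interior_subset).conf_metricOn hpos
    have hg : MetricOn (interior (chartSet I x₀ U)) (coeff g x₀) :=
      ⟨hconf.uniq, hconf.dense, hconf.smooth.congr heq, fun z hz => by
        rw [heq hz]; exact hconf.symm z hz, fun z hz => by rw [heq hz]; exact hconf.pos z hz⟩
    have hc := h.curvature x₀ y ⟨(interior_subset hy).1, interior_chartSet_subset x₀ U hy⟩ u v
    rw [chartForm_eq, riemann_eq hg (by rwa [interior_interior])] at hc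
    rw [← curv_congr heq hy, ← heq hy]
    exact hc.trans (neg_one_mul _)

end IsGeodesicOn

end Charts

/-! ### The shape form on manifolds -/

section Maps

variable {m₁ m₂ : ℕ} {H₁ H₂ : Type*} [TopologicalSpace H₁] [TopologicalSpace H₂]
  {I₁ : ModelWithCorners ℝ (Coord m₁) H₁} {I₂ : ModelWithCorners ℝ (Coord m₂) H₂}
  {M₁ M₂ : Type*} [TopologicalSpace M₁] [ChartedSpace H₁ M₁] [TopologicalSpace M₂]
  [ChartedSpace H₂ M₂] [IsManifold I₁ ∞ M₁] [IsManifold I₂ ∞ M₂]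

theorem hasMFDerivAt_chart {x₀ x : M₂} (hx : x ∈ (extChartAt I₂ x₀).source) :
    HasMFDerivAt I₂ 𝓘(ℝ, Coord m₂) (extChartAt I₂ x₀) x (chartDiff I₂ x₀ x) := by
  have : IsManifold I₂ 1 M₂ := IsManifold.of_le (n := ∞) (by simp)
  exact (mdifferentiableAt_extChartAt (by rwa [← extChartAt_source I₂])).hasMFDerivAt

theorem fderivWithin_rep {f : M₁ → M₂} {V : Set M₁} (hV : IsOpen V) {x₁ : M₁} {x₂ : M₂}
    (hf : ContMDiff I₁ I₂ ∞ f) (hm : MapsTo f V (extChartAt I₂ x₂).source) {y : Coord m₁}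
    (hy : y ∈ chartSet I₁ x₁ V) (u : Coord m₁) :
    fderivWithin ℝ ((extChartAt I₂ x₂ ∘ f) ∘ (extChartAt I₁ x₁).symm) (chartSet I₁ x₁ V) y u =
      chartDiff I₂ x₂ (f ((extChartAt I₁ x₁).symm y))
        (mfderiv I₁ I₂ f ((extChartAt I₁ x₁).symm y) (chartInv I₁ x₁ y u)) :=
  fderivWithin_comp_symm hV hy ((hasMFDerivAt_chart (hm hy.2)).comp _
    ((hf _).mdifferentiableAt (by simp)).hasMFDerivAt) u

theorem contDiffOn_rep {f : M₁ → M₂} {V : Set M₁} {x₁ : M₁} {x₂ : M₂}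
    (hf : ContMDiff I₁ I₂ ∞ f) (hm : MapsTo f V (extChartAt I₂ x₂).source) :
    ContDiffOn ℝ ∞ ((extChartAt I₂ x₂ ∘ f) ∘ (extChartAt I₁ x₁).symm) (chartSet I₁ x₁ V) :=
  contDiffOn_comp_symm (contMDiffOn_extChartAt.comp hf.contMDiffOn
    fun z hz => by rw [← extChartAt_source I₂]; exact hm hz) x₁

theorem coeff_chartDiff (T : BilinField I₂ M₂) {x₀ x : M₂} (hx : x ∈ (extChartAt I₂ x₀).source)
    (u v : TangentSpace I₂ x) : coeff T x₀ (extChartAt I₂ x₀ x) (chartDiff I₂ x₀ x u)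
      (chartDiff I₂ x₀ x v) = T x u v := by
  -- The identity is proved at the point `e.symm (e x)`, with `e` the chart, and then transported to
  -- `x`, so that the dependent tangent space changes together with its base point.
  have h : ∀ u v : TangentSpace I₂ ((extChartAt I₂ x₀).symm (extChartAt I₂ x₀ x)),
      coeff T x₀ (extChartAt I₂ x₀ x) (chartDiff I₂ x₀ _ u) (chartDiff I₂ x₀ _ v) = T _ u v := by
    intro u v
    have hy := (extChartAt I₂ x₀).map_source hx
    rw [coeff_apply, chartInv_chartDiff hy, chartInv_chartDiff hy]
  rw [(extChartAt I₂ x₀).left_inv hx] at h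
  exact h u v

theorem isometricOn_rep {f : M₁ → M₂} {V : Set M₁} (hV : IsOpen V) {x₁ : M₁} {x₂ : M₂}
    {U : Set M₂} (hU : IsOpen U) (hf : ContMDiff I₁ I₂ ∞ f)
    (hm : MapsTo f V (extChartAt I₂ x₂).source) (hm' : MapsTo f V U)
    {g₁ : RiemMetric I₁ M₁} {g₂ : RiemMetric I₂ M₂}
    (hg : ∀ x ∈ V, ∀ u v : TangentSpace I₁ x,
      g₂.inner (f x) (mfderiv I₁ I₂ f x u) (mfderiv I₁ I₂ f x v) = g₁.inner x u v) :
    IsometricOn (chartSet I₁ x₁ V) (chartSet I₂ x₂ U) (coeff g₁.inner x₁) (coeff g₂.inner x₂)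
      ((extChartAt I₂ x₂ ∘ f) ∘ (extChartAt I₁ x₁).symm) := by
  refine ⟨g₁.metricOn x₁ hV, g₂.metricOn x₂ hU, contDiffOn_rep hf hm,
    fun y hy => mem_chartSet (hm hy.2) (hm' hy.2), fun y hy => ?_⟩
  ext u v
  rw [pull_apply, fderivWithin_rep hV hf hm hy, fderivWithin_rep hV hf hm hy,
    coeff_apply g₁.inner, ← hg _ hy.2]
  exact (coeff_chartDiff g₂.inner (hm hy.2) _ _).symm

end Maps

section ShapeField

variable {m : ℕ} {H : Type*} [TopologicalSpace H] {I : ModelWithCorners ℝ (Coord m) H}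
  {M : Type*} [TopologicalSpace M] [ChartedSpace H M]

theorem fderivWithin_chartSet {F : Type*} [NormedAddCommGroup F] [NormedSpace ℝ F]
    (f : Coord m → F) {x₀ : M} {U : Set M} (hU : IsOpen U) {y : Coord m}
    (hy : y ∈ chartSet I x₀ U) :
    fderivWithin ℝ f (chartSet I x₀ U) y = fderivWithin ℝ f (range I) y := by
  obtain ⟨O, hO, h⟩ := chartSet_eq (I := I) x₀ hU
  rw [h] at hy ⊢
  exact fderivWithin_inter (hO.mem_nhds hy.2)

/-- Derivatives within a set are local, so the shape operator does not depend on `U`. This permits a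
definition of `shapeField` without reference to `U`. -/
theorem shape_chartSet (B : Coord m → Coord m →L[ℝ] Coord m →L[ℝ] ℝ) (N : Coord m → Coord m)
    {x₀ : M} {U : Set M} (hU : IsOpen U) {y : Coord m} (hy : y ∈ chartSet I x₀ U) :
    shape (chartSet I x₀ U) (chr (chartSet I x₀ U) B) N y =
      shape (range I) (chr (range I) B) N y := by
  have h1 : ∀ z ∈ chartSet I x₀ U, chr (chartSet I x₀ U) B z = chr (range I) B z := fun z hz => by
    rw [chr, chr, fderivWithin_chartSet B hU hz]
  have h2 : fderivWithin ℝ (chr (chartSet I x₀ U) B) (chartSet I x₀ U) y =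
      fderivWithin ℝ (chr (range I) B) (range I) y := by
    rw [← fderivWithin_chartSet _ hU hy]
    exact fderivWithin_congr h1 (h1 y hy)
  rw [shape, shape, h1 y hy, h2]

theorem shapeForm_chartSet (B : Coord m → Coord m →L[ℝ] Coord m →L[ℝ] ℝ) (N : Coord m → Coord m)
    {x₀ : M} {U : Set M} (hU : IsOpen U) {y : Coord m} (hy : y ∈ chartSet I x₀ U) :
    BoundaryOn.shapeForm (chartSet I x₀ U) B N y = BoundaryOn.shapeForm (range I) B N y := by
  ext u v
  rw [BoundaryOn.shapeForm_apply, BoundaryOn.shapeForm_apply, shape_chartSet B N hU hy]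

variable [IsManifold I ∞ M]

theorem chartInv_self (x : M) (u : Coord m) : chartInv I x (extChartAt I x x) u = u := by
  have : IsManifold I 1 M := IsManifold.of_le (n := ∞) (by simp)
  exact congrArg (fun L => L u) (mfderivWithin_range_extChartAt_symm (I := I) (x := x))

theorem chartDiff_self (x : M) (u : Coord m) : chartDiff I x x u = u := by
  have : IsManifold I 1 M := IsManifold.of_le (n := ∞) (by simp)
  exact congrArg (fun L => L u) (mfderiv_extChartAt_self (I := I) (x := x))

theorem coeff_self (T : BilinField I M) (x : M) : coeff T x (extChartAt I x x) = T x := by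
  ext u v
  refine Eq.trans ?_ (coeff_chartDiff T (mem_extChartAt_source x) u v)
  exact (congrArg₂ (fun a b => coeff T x (extChartAt I x x) a b) (chartDiff_self x u)
    (chartDiff_self x v)).symm

/-- The coefficients in the chart at `x₀` of the shape form of the level sets of `r`. -/
def shapeCoeff (gbar : RiemMetric I M) (r : M → ℝ) (x₀ : M) :
    Coord m → Coord m →L[ℝ] Coord m →L[ℝ] ℝ :=
  BoundaryOn.shapeForm (range I) (coeff gbar.inner x₀) (chartField (grad gbar.inner r) x₀)

/-- The shape form of the level sets of `r`. -/
def shapeField (gbar : RiemMetric I M) (r : M → ℝ) : BilinField I M := fun x =>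
  let D : Coord m →L[ℝ] Coord m := chartDiff I x x
  let T : Coord m →L[ℝ] Coord m →L[ℝ] ℝ :=
    (shapeCoeff gbar r x (extChartAt I x x)).bilinearComp D D
  T

theorem IsGeodesicOn.mono {g : BilinField I M} {r : M → ℝ} {gbar : RiemMetric I M} {U V : Set M}
    (h : IsGeodesicOn g r gbar U) (hV : IsOpen V) (hVU : V ⊆ U) : IsGeodesicOn g r gbar V where
  isOpen := hV
  defining := h.defining
  compactification := h.compactification
  unit x hx := h.unit x (hVU hx)
  curvature := h.curvature

/-- The coefficients of the shape form do not depend on the chart. -/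
theorem IsGeodesicOn.shapeField_apply {g : BilinField I M} {r : M → ℝ} {gbar : RiemMetric I M}
    {U : Set M} (h : IsGeodesicOn g r gbar U) {x₀ x : M} (hx : x ∈ (extChartAt I x₀).source)
    (hxU : x ∈ U) (u v : TangentSpace I x) :
    shapeField gbar r x u v = shapeCoeff gbar r x₀ (extChartAt I x₀ x) (chartDiff I x₀ x u)
      (chartDiff I x₀ x v) := by
  set V := U ∩ (extChartAt I x₀).source with hV
  have hVo : IsOpen V := h.isOpen.inter (isOpen_extChartAt_source x₀)
  have hm : MapsTo (id : M → M) V (extChartAt I x₀).source := fun z hz => hz.2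
  have hm' : MapsTo (id : M → M) V U := fun z hz => hz.1
  have hy : extChartAt I x x ∈ chartSet I x V :=
    mem_chartSet (mem_extChartAt_source x) ⟨hxU, hx⟩
  have hiso := isometricOn_rep (x₁ := x) hVo h.isOpen contMDiff_id hm hm' (g₁ := gbar)
    (g₂ := gbar) (fun z _ u v => by simp [mfderiv_id])
  have hsymm : (extChartAt I x).symm (extChartAt I x x) = x :=
    (extChartAt I x).left_inv (mem_extChartAt_source x)
  have hψ : ((extChartAt I x₀ ∘ id) ∘ (extChartAt I x).symm) (extChartAt I x x) =
      extChartAt I x₀ x := by simp only [Function.comp, id, hsymm]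
  -- The transition map is an isometry that preserves `r`, so the shape operators in the two charts
  -- correspond.
  have hnat := HypOn.shape_naturality ((h.mono hVo inter_subset_left).hypOn x) (h.hypOn x₀) hiso
    (fun z hz => by
      simp only [Function.comp, id]
      rw [(extChartAt I x₀).left_inv hz.2.2]) rfl hy
  have hD : ∀ w : TangentSpace I x, fderivWithin ℝ
      ((extChartAt I x₀ ∘ id) ∘ (extChartAt I x).symm) (chartSet I x V) (extChartAt I x x)
      (chartDiff I x x w) = chartDiff I x₀ x w := by
    have : ∀ w : TangentSpace I ((extChartAt I x).symm (extChartAt I x x)), fderivWithin ℝ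
      ((extChartAt I x₀ ∘ id) ∘ (extChartAt I x).symm) (chartSet I x V) (extChartAt I x x)
      (chartDiff I x _ w) = chartDiff I x₀ _ w := by
      intro w
      rw [fderivWithin_rep hVo contMDiff_id hm hy, chartInv_chartDiff hy.1, mfderiv_id]
      rfl
    rw [hsymm] at this
    exact this
  have h0 := mem_chartSet hx hxU
  rw [shapeCoeff, ← shapeForm_chartSet _ _ h.isOpen h0, BoundaryOn.shapeForm_apply, ← hD u, ← hD v,
    ← hψ, hnat, ← hiso.apply hy, shape_chartSet _ _ hVo hy]
  rfl

end ShapeField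

/-! ### The tensor induced on the boundary -/

section BoundaryTensor

variable {n : ℕ} {X : Type*} [TopologicalSpace X] [ChartedSpace (EuclideanHalfSpace (n + 1)) X]
  {M : Type*} [TopologicalSpace M] [ChartedSpace (EuclideanSpace ℝ (Fin n)) M]
  [IsManifold (𝓡∂ (n + 1)) ∞ X] [IsManifold (𝓡 n) ∞ M]

/-- The tensor `P_γ`: the restriction of the shape form to the boundary. -/
def boundaryTensor (ι : M → X) (gbar : RiemMetric (𝓡∂ (n + 1)) X) (r : X → ℝ) :
    BilinField (𝓡 n) M := fun p =>
  let D : Coord n →L[ℝ] Coord (n + 1) := mfderiv (𝓡 n) (𝓡∂ (n + 1)) ι p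
  let S : Coord (n + 1) →L[ℝ] Coord (n + 1) →L[ℝ] ℝ := shapeField gbar r (ι p)
  let T : Coord n →L[ℝ] Coord n →L[ℝ] ℝ := S.bilinearComp D D
  T

theorem boundaryTensor_apply (ι : M → X) (gbar : RiemMetric (𝓡∂ (n + 1)) X) (r : X → ℝ) (p : M)
    (u v : TangentSpace (𝓡 n) p) : boundaryTensor ι gbar r p u v = shapeField gbar r (ι p)
      (mfderiv (𝓡 n) (𝓡∂ (n + 1)) ι p u) (mfderiv (𝓡 n) (𝓡∂ (n + 1)) ι p v) := rfl

/-- The geodesic compactification of a hyperbolic metric on `X` near the boundary `ι(M)`. -/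
structure IsGeodesicCompactification (ι : M → X) (g : BilinField (𝓡∂ (n + 1)) X)
    (γ : RiemMetric (𝓡 n) M) (r : X → ℝ) (gbar : RiemMetric (𝓡∂ (n + 1)) X) (U : Set X) : Prop
    extends IsGeodesicOn g r gbar U where
  inclusion : IsBoundaryInclusion (n := n) ι
  restrict : ∀ p, ∀ u v : TangentSpace (𝓡 n) p, gbar.inner (ι p)
    (mfderiv (𝓡 n) (𝓡∂ (n + 1)) ι p u) (mfderiv (𝓡 n) (𝓡∂ (n + 1)) ι p v) = γ.inner p u v
  boundary_subset : (𝓡∂ (n + 1)).boundary X ⊆ U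

/-- The inclusion of the boundary in charts at `p₀` and `x₀`. -/
def inclRep (ι : M → X) (p₀ : M) (x₀ : X) : Coord n → Coord (n + 1) :=
  (extChartAt (𝓡∂ (n + 1)) x₀ ∘ ι) ∘ (extChartAt (𝓡 n) p₀).symm

namespace IsGeodesicCompactification

variable {ι : M → X} {g : BilinField (𝓡∂ (n + 1)) X} {γ : RiemMetric (𝓡 n) M} {r : X → ℝ}
  {gbar : RiemMetric (𝓡∂ (n + 1)) X} {U : Set X}

theorem mem_boundary (h : IsGeodesicCompactification ι g γ r gbar U) (p : M) :
    ι p ∈ (𝓡∂ (n + 1)).boundary X := h.inclusion.range_eq ▸ mem_range_self p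

theorem incl_mem (h : IsGeodesicCompactification ι g γ r gbar U) (p : M) : ι p ∈ U :=
  h.boundary_subset (h.mem_boundary p)

theorem isOpen_preimage (h : IsGeodesicCompactification ι g γ r gbar U) (x₀ : X) :
    IsOpen (ι ⁻¹' (extChartAt (𝓡∂ (n + 1)) x₀).source) :=
  (isOpen_extChartAt_source x₀).preimage h.inclusion.smooth.continuous

theorem isOpen_chartSet (p₀ : M) {V : Set M} (hV : IsOpen V) : IsOpen (chartSet (𝓡 n) p₀ V) := by
  obtain ⟨O, hO, h⟩ := chartSet_eq (I := 𝓡 n) p₀ hV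
  rw [h, modelWithCornersSelf_coe, range_id, univ_inter]
  exact hO

theorem boundaryOn (h : IsGeodesicCompactification ι g γ r gbar U) (p₀ : M) (x₀ : X) :
    BoundaryOn (chartSet (𝓡 n) p₀ (ι ⁻¹' (extChartAt (𝓡∂ (n + 1)) x₀).source))
      (chartSet (𝓡∂ (n + 1)) x₀ U) (coeff γ.inner p₀) (coeff gbar.inner x₀) (inclRep ι p₀ x₀)
      (r ∘ (extChartAt (𝓡∂ (n + 1)) x₀).symm) (chartField (grad gbar.inner r) x₀) := by
  refine ⟨isometricOn_rep (h.isOpen_preimage x₀) h.isOpen h.inclusion.smooth (mapsTo_preimage _ _)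
    (fun p _ => h.incl_mem p) (fun p _ => h.restrict p), h.hypOn x₀, fun y hy => ?_, by simp⟩
  simp only [inclRep, Function.comp]
  rw [(extChartAt (𝓡∂ (n + 1)) x₀).left_inv hy.2]
  exact h.defining.zero _ (h.mem_boundary _)

theorem coeff_boundaryTensor (h : IsGeodesicCompactification ι g γ r gbar U) {p₀ : M} {x₀ : X}
    {y : Coord n} (hy : y ∈ chartSet (𝓡 n) p₀ (ι ⁻¹' (extChartAt (𝓡∂ (n + 1)) x₀).source))
    (u v : Coord n) : coeff (boundaryTensor ι gbar r) p₀ y u v =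
      pull (chartSet (𝓡 n) p₀ (ι ⁻¹' (extChartAt (𝓡∂ (n + 1)) x₀).source)) (inclRep ι p₀ x₀)
        (BoundaryOn.shapeForm (chartSet (𝓡∂ (n + 1)) x₀ U) (coeff gbar.inner x₀)
          (chartField (grad gbar.inner r) x₀)) y u v := by
  rw [coeff_apply, boundaryTensor_apply, h.shapeField_apply hy.2 (h.incl_mem _), pull_apply,
    inclRep,
    fderivWithin_rep (h.isOpen_preimage x₀) h.inclusion.smooth (mapsTo_preimage _ _) hy,
    fderivWithin_rep (h.isOpen_preimage x₀) h.inclusion.smooth (mapsTo_preimage _ _) hy,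
    shapeForm_chartSet _ _ h.isOpen]
  · rfl
  · exact mem_chartSet hy.2 (h.incl_mem _)

theorem mem_chartSet_self (p : M) : extChartAt (𝓡 n) p p ∈
    chartSet (𝓡 n) p (ι ⁻¹' (extChartAt (𝓡∂ (n + 1)) (ι p)).source) :=
  mem_chartSet (mem_extChartAt_source p) (mem_extChartAt_source (ι p))

theorem pull_shapeForm_self (h : IsGeodesicCompactification ι g γ r gbar U) (p : M)
    (u v : Coord n) :
    pull (chartSet (𝓡 n) p (ι ⁻¹' (extChartAt (𝓡∂ (n + 1)) (ι p)).source)) (inclRep ι p (ι p))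
        (BoundaryOn.shapeForm (chartSet (𝓡∂ (n + 1)) (ι p) U) (coeff gbar.inner (ι p))
          (chartField (grad gbar.inner r) (ι p))) (extChartAt (𝓡 n) p p) u v =
      boundaryTensor ι gbar r p u v :=
  (h.coeff_boundaryTensor (mem_chartSet_self p) u v).symm.trans
    (congrArg (fun L : Coord n →L[ℝ] Coord n →L[ℝ] ℝ => L u v) (coeff_self _ p))

theorem isSchoutenType (h : IsGeodesicCompactification ι g γ r gbar U) :
    IsSchoutenType γ (boundaryTensor ι gbar r) where
  symm p u v := (h.pull_shapeForm_self p u v).symm.trans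
    (((h.boundaryOn p (ι p)).pull_symm (mem_chartSet_self p) u v).trans
      (h.pull_shapeForm_self p v u))
  smooth := smoothBilinOn_of_coeff fun p => by
    refine ⟨_, h.isOpen_preimage (ι p), mem_extChartAt_source (ι p), ?_⟩
    have hB := h.boundaryOn p (ι p)
    refine (contDiffOn_pull hB.source.uniq hB.smooth (BoundaryOn.contDiffOn_shapeForm hB.hyp)
      hB.mapsTo).congr fun y hy => ?_
    ext u v
    exact h.coeff_boundaryTensor hy u v
  eq_schouten hn p u v := (h.pull_shapeForm_self p u v).symm.trans
    ((h.boundaryOn p (ι p)).schouten_eq (isOpen_chartSet p (h.isOpen_preimage (ι p))) hn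
      (mem_chartSet_self p) u v).symm
  trace_eq hn p := by
    have hs := (h.boundaryOn p (ι p)).metricTrace_eq_scalarCurv
      (isOpen_chartSet p (h.isOpen_preimage (ι p))) hn (mem_chartSet_self p)
    simp only [h.pull_shapeForm_self p, coeff_self] at hs
    exact hs
  divergence_eq hn p w := by
    rw [chartForm_eq, chartForm_eq]
    exact (h.boundaryOn p (ι p)).divergence_eq_scalarCurv
      (isOpen_chartSet p (h.isOpen_preimage (ι p))) hn
      (fun y hy u v => h.coeff_boundaryTensor hy u v) (mem_chartSet_self p) w

end IsGeodesicCompactification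

end BoundaryTensor

/-! ### Integral curves on manifolds -/

section IntegralCurves

open NNReal

/-- Derivatives are taken within an interval `S` that may end at `t₁`, so uniqueness is proved
separately to the right and to the left. -/
theorem eventually_eq_of_hasDerivWithinAt {E : Type*} [NormedAddCommGroup E] [NormedSpace ℝ E]
    {f : E → E} {D : Set E} {K : ℝ≥0} (hf : LipschitzOnWith K f D) {S : Set ℝ}
    (hS : S.OrdConnected) {a b : ℝ → E} {t₁ : ℝ} (ht₁ : t₁ ∈ S)
    (ha : ∀ᶠ t in 𝓝[S] t₁, a t ∈ D ∧ HasDerivWithinAt a (f (a t)) S t)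
    (hb : ∀ᶠ t in 𝓝[S] t₁, b t ∈ D ∧ HasDerivWithinAt b (f (b t)) S t) (h : a t₁ = b t₁) :
    ∀ᶠ t in 𝓝[S] t₁, a t = b t := by
  obtain ⟨η, hη, hball⟩ := Metric.mem_nhdsWithin_iff.1 (ha.and hb)
  refine Metric.mem_nhdsWithin_iff.2 ⟨η, hη, fun t ht => ?_⟩
  have hsub : ∀ τ ∈ uIcc t₁ t, τ ∈ Metric.ball t₁ η ∩ S := fun τ hτ =>
    ⟨by
      have h1 := abs_sub_left_of_mem_uIcc hτ
      rw [Metric.mem_ball, Real.dist_eq]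
      refine lt_of_le_of_lt h1 ?_
      have := ht.1
      rwa [Metric.mem_ball, Real.dist_eq] at this, hS.uIcc_subset ht₁ ht.2 hτ⟩
  rcases le_total t₁ t with hle | hle
  · rw [uIcc_of_le hle] at hsub
    have hS' : Icc t₁ t ⊆ S := fun τ hτ => (hsub τ hτ).2
    have hd : ∀ τ ∈ Ico t₁ t, S ∈ 𝓝[≥] τ := fun τ hτ =>
      Filter.mem_of_superset (Icc_mem_nhdsGE_of_mem hτ) hS'
    exact ODE_solution_unique_of_mem_Icc_right (v := fun _ => f) (s := fun _ => D)
      (fun _ _ => hf) (fun τ hτ => (hball (hsub τ hτ)).1.2.continuousWithinAt.mono hS')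
      (fun τ hτ => (hball (hsub τ (Ico_subset_Icc_self hτ))).1.2.mono_of_mem_nhdsWithin (hd τ hτ))
      (fun τ hτ => (hball (hsub τ (Ico_subset_Icc_self hτ))).1.1)
      (fun τ hτ => (hball (hsub τ hτ)).2.2.continuousWithinAt.mono hS')
      (fun τ hτ => (hball (hsub τ (Ico_subset_Icc_self hτ))).2.2.mono_of_mem_nhdsWithin (hd τ hτ))
      (fun τ hτ => (hball (hsub τ (Ico_subset_Icc_self hτ))).2.1) h ⟨hle, le_rfl⟩
  · rw [uIcc_of_ge hle] at hsub
    have hS' : Icc t t₁ ⊆ S := fun τ hτ => (hsub τ hτ).2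
    have hd : ∀ τ ∈ Ioc t t₁, S ∈ 𝓝[≤] τ := fun τ hτ =>
      Filter.mem_of_superset (Icc_mem_nhdsLE_of_mem hτ) hS'
    exact ODE_solution_unique_of_mem_Icc_left (v := fun _ => f) (s := fun _ => D)
      (fun _ _ => hf) (fun τ hτ => (hball (hsub τ hτ)).1.2.continuousWithinAt.mono hS')
      (fun τ hτ => (hball (hsub τ (Ioc_subset_Icc_self hτ))).1.2.mono_of_mem_nhdsWithin (hd τ hτ))
      (fun τ hτ => (hball (hsub τ (Ioc_subset_Icc_self hτ))).1.1)
      (fun τ hτ => (hball (hsub τ hτ)).2.2.continuousWithinAt.mono hS')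
      (fun τ hτ => (hball (hsub τ (Ioc_subset_Icc_self hτ))).2.2.mono_of_mem_nhdsWithin (hd τ hτ))
      (fun τ hτ => (hball (hsub τ (Ioc_subset_Icc_self hτ))).2.1) h ⟨le_rfl, hle⟩

variable {m : ℕ} {H : Type*} [TopologicalSpace H] {I : ModelWithCorners ℝ (Coord m) H}
  {M : Type*} [TopologicalSpace M] [ChartedSpace H M] [IsManifold I ∞ M]
  {v : ∀ x : M, TangentSpace I x}

theorem chartField_apply (v : ∀ x : M, TangentSpace I x) {x₀ x : M}
    (hx : x ∈ (extChartAt I x₀).source) :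
    chartField v x₀ (extChartAt I x₀ x) = chartDiff I x₀ x (v x) := by
  have h : (extChartAt I x₀).symm (extChartAt I x₀ x) = x := (extChartAt I x₀).left_inv hx
  unfold chartField
  rw [h]
  rfl

theorem hasDerivWithinAt_chart {c : ℝ → M} {S : Set ℝ} (hc : IsMIntegralCurveOn c v S) {t : ℝ}
    (ht : t ∈ S) {x₀ : M} (hx : c t ∈ (extChartAt I x₀).source) :
    HasDerivWithinAt (extChartAt I x₀ ∘ c) (chartField v x₀ (extChartAt I x₀ (c t))) S t := by
  have h := ((hasMFDerivAt_chart hx).comp_hasMFDerivWithinAt t (hc t ht)).hasFDerivWithinAt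
  rw [chartField_apply v hx]
  refine HasFDerivWithinAt.hasDerivWithinAt (f' := (chartDiff I x₀ (c t) : Coord m →L[ℝ] Coord m)
    ∘L ContinuousLinearMap.toSpanSingleton ℝ (v (c t) : Coord m)) ?_ |>.congr_deriv ?_
  · exact h
  exact congrArg (chartDiff I x₀ (c t)) (one_smul ℝ (v (c t)))

theorem isMIntegralCurveOn_of_chart {α : ℝ → Coord m} {S : Set ℝ} {x₀ : M}
    (hα : ∀ t ∈ S, α t ∈ (extChartAt I x₀).target ∧
      HasDerivWithinAt α (chartField v x₀ (α t)) S t) :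
    IsMIntegralCurveOn ((extChartAt I x₀).symm ∘ α) v S := by
  have : IsManifold I 1 M := IsManifold.of_le (n := ∞) (by simp)
  intro t ht
  obtain ⟨hy, hd⟩ := hα t ht
  have h1 : HasMFDerivWithinAt 𝓘(ℝ, Coord m) I (extChartAt I x₀).symm (range I) (α t)
      (chartInv I x₀ (α t)) := (mdifferentiableWithinAt_extChartAt_symm hy).hasMFDerivWithinAt
  have h2 := h1.comp t hd.hasFDerivWithinAt.hasMFDerivWithinAt
    (fun τ hτ => extChartAt_target_subset_range x₀ (hα τ hτ).1)
  have h3 : chartInv I x₀ (α t) (chartField v x₀ (α t)) = v ((extChartAt I x₀).symm (α t)) :=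
    chartInv_chartField v hy
  refine h2.congr_mfderiv (ContinuousLinearMap.ext_ring ?_)
  exact ((congrArg (chartInv I x₀ (α t)) (one_smul ℝ _)).trans h3).trans (one_smul ℝ _).symm

/-- Integral curves are unique, also at the boundary. -/
theorem eqOn_of_isMIntegralCurveOn [T2Space M]
    (hv : ∀ x₀ : M, ContDiffOn ℝ ∞ (chartField v x₀) (chartSet I x₀ univ)) {S : Set ℝ}
    (hS : S.OrdConnected) {a b : ℝ → M} (ha : IsMIntegralCurveOn a v S)
    (hb : IsMIntegralCurveOn b v S) {t₀ : ℝ} (ht₀ : t₀ ∈ S) (h : a t₀ = b t₀) : EqOn a b S := by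
  have hac : ContinuousOn a S := fun t ht => (ha t ht).continuousWithinAt
  have hbc : ContinuousOn b S := fun t ht => (hb t ht).continuousWithinAt
  have : PreconnectedSpace S := Subtype.preconnectedSpace hS.isPreconnected
  -- The coincidence set is closed by continuity and open by local uniqueness in a chart; `S` is
  -- connected.
  have hclopen : IsClopen {t : S | a t = b t} := by
    refine ⟨isClosed_eq hac.domRestrict hbc.domRestrict, isOpen_iff_mem_nhds.2 fun t₁ ht₁ => ?_⟩
    set x₀ := a t₁ with hx₀
    set e := extChartAt I x₀ with he
    have hy : e x₀ ∈ chartSet I x₀ univ := mem_chartSet (mem_extChartAt_source x₀) trivial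
    have hcd : ContDiffWithinAt ℝ 1 (chartField v x₀) (range I) (e x₀) :=
      ((hv x₀ _ hy).of_le (by simp)).mono_of_mem_nhdsWithin (chartSet_mem_nhdsWithin isOpen_univ hy)
    obtain ⟨K, D, hD, hlip⟩ := hcd.exists_lipschitzOnWith I.convex_range
    have key : ∀ c : ℝ → M, IsMIntegralCurveOn c v S → c t₁ = x₀ → ∀ᶠ t in 𝓝[S] (t₁ : ℝ),
        c t ∈ e.source ∧ (e ∘ c) t ∈ D ∧
          HasDerivWithinAt (e ∘ c) (chartField v x₀ ((e ∘ c) t)) S t := by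
      intro c hc hct
      have hcc : ContinuousWithinAt c S t₁ := (hc t₁ t₁.2).continuousWithinAt
      have h1 : ∀ᶠ t in 𝓝[S] (t₁ : ℝ), c t ∈ e.source :=
        hcc.eventually (by rw [hct]; exact extChartAt_source_mem_nhds x₀)
      have h2 : Filter.Tendsto (e ∘ c) (𝓝[S] (t₁ : ℝ)) (𝓝[range I] (e x₀)) := by
        refine tendsto_nhdsWithin_iff.2 ⟨?_, Filter.Eventually.of_forall fun t => ?_⟩
        · have h3 : ContinuousAt e (c t₁) := by rw [hct]; exact continuousAt_extChartAt x₀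
          have h4 := h3.comp_continuousWithinAt hcc
          rwa [ContinuousWithinAt, Function.comp_apply, hct] at h4
        · exact mem_range_self _
      filter_upwards [h1, h2 hD, self_mem_nhdsWithin] with t ht1 ht2 ht3
      exact ⟨ht1, ht2, hasDerivWithinAt_chart hc ht3 ht1⟩
    have hka := key a ha rfl
    have hkb := key b hb ht₁.symm
    have := eventually_eq_of_hasDerivWithinAt hlip hS t₁.2 (hka.mono fun t ht => ht.2)
      (hkb.mono fun t ht => ht.2) (by simp only [Function.comp, ht₁.out])
    rw [mem_nhds_subtype_iff_nhdsWithin]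
    refine Filter.mem_of_superset (this.and ((hka.and hkb).and self_mem_nhdsWithin)) ?_
    rintro t ⟨h1, ⟨h2, h3⟩, h4⟩
    exact ⟨⟨t, h4⟩, e.injOn h2.1 h3.1 h1, rfl⟩
  have := hclopen.eq_univ ⟨⟨t₀, ht₀⟩, h⟩
  intro t ht
  exact (this ▸ mem_univ (⟨t, ht⟩ : S) : (⟨t, ht⟩ : S) ∈ {t : S | a t = b t})

end IntegralCurves

/-! ### The gradient flow near the boundary -/

section Collar

variable {n : ℕ} {X : Type*} [TopologicalSpace X] [ChartedSpace (EuclideanHalfSpace (n + 1)) X]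
  [IsManifold (𝓡∂ (n + 1)) ∞ X]

theorem IsDefiningFunction.nonneg {r : X → ℝ} (h : IsDefiningFunction (𝓡∂ (n + 1)) r) (x : X) :
    0 ≤ r x := by
  rcases (𝓡∂ (n + 1)).isInteriorPoint_or_isBoundaryPoint x with hx | hx
  · exact (h.pos x hx).le
  · exact (h.zero x hx).ge

theorem mem_boundary_of_mem_target {x₀ : X} {y : Coord (n + 1)}
    (hy : y ∈ (extChartAt (𝓡∂ (n + 1)) x₀).target) :
    (extChartAt (𝓡∂ (n + 1)) x₀).symm y ∈ (𝓡∂ (n + 1)).boundary X ↔ y 0 = 0 := by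
  have h0 : y ∈ range (𝓡∂ (n + 1)) := extChartAt_target_subset_range x₀ hy
  rw [range_modelWithCornersEuclideanHalfSpace] at h0
  have h0' : 0 ≤ y 0 := h0
  rw [← ModelWithCorners.compl_interior, mem_compl_iff, mem_interior_of_mem_target hy,
    interior_range_modelWithCornersEuclideanHalfSpace]
  change ¬ (0 < y 0) ↔ _
  rw [not_lt]
  exact ⟨fun h => le_antisymm h h0', fun h => h.le⟩

theorem chartSet_halfSpace (x₀ : X) {U : Set X} (hU : IsOpen U) :
    ∃ O, IsOpen O ∧ chartSet (𝓡∂ (n + 1)) x₀ U = {y : Coord (n + 1) | 0 ≤ y 0} ∩ O := by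
  obtain ⟨O, hO, h⟩ := chartSet_eq (I := 𝓡∂ (n + 1)) x₀ hU
  rw [range_modelWithCornersEuclideanHalfSpace] at h
  exact ⟨O, hO, h⟩

/-- The derivative at `y` of a function in a direction in which it does not decrease. -/
theorem fderivWithin_nonneg {V : Type*} [NormedAddCommGroup V] [NormedSpace ℝ V] {f : V → ℝ}
    {s : Set V} {y w : V} (hf : DifferentiableWithinAt ℝ f s y)
    (hs : ∀ᶠ t : ℝ in 𝓝[>] 0, y + t • w ∈ s ∧ f y ≤ f (y + t • w)) :
    0 ≤ fderivWithin ℝ f s y w := by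
  have hT : {t : ℝ | y + t • w ∈ s} ∈ 𝓝[>] (0 : ℝ) := hs.mono fun t ht => ht.1
  have hline : HasDerivWithinAt (fun t : ℝ => y + t • w) w {t : ℝ | y + t • w ∈ s} 0 := by
    have := ((hasDerivAt_id (0 : ℝ)).smul_const w).const_add y
    simpa using this.hasDerivWithinAt
  have h0 : HasFDerivWithinAt f (fderivWithin ℝ f s y) s (y + (0 : ℝ) • w) := by
    simpa using hf.hasFDerivWithinAt
  have hd : HasDerivWithinAt (fun t : ℝ => f (y + t • w)) (fderivWithin ℝ f s y w) (Ioi 0) 0 :=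
    (h0.comp_hasDerivWithinAt (0 : ℝ) hline fun t ht => ht).mono_of_mem_nhdsWithin hT
  have hsl := hasDerivWithinAt_iff_tendsto_slope.1 hd
  rw [sdiff_singleton_eq_self (by simp)] at hsl
  refine ge_of_tendsto hsl ?_
  filter_upwards [hs, self_mem_nhdsWithin] with t ht ht0
  rw [slope_def_field, sub_zero, zero_smul, add_zero]
  exact div_nonneg (sub_nonneg.2 ht.2) (le_of_lt ht0)

/-- The gradient flow near the boundary point `x₀`, in the chart at `x₀`. -/
structure FlowChart (r : X → ℝ) (gbar : RiemMetric (𝓡∂ (n + 1)) X) (U : Set X) (x₀ : X)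
    (W : Set X) (δ : ℝ) (α : Coord (n + 1) → ℝ → Coord (n + 1))
    (J : Coord (n + 1) → ℝ → Coord (n + 1) →L[ℝ] Coord (n + 1)) : Prop where
  isOpen : IsOpen W
  mem : x₀ ∈ W
  subset_source : W ⊆ (extChartAt (𝓡∂ (n + 1)) x₀).source
  pos : 0 < δ
  start : ∀ x ∈ W, α (extChartAt (𝓡∂ (n + 1)) x₀ x) 0 = extChartAt (𝓡∂ (n + 1)) x₀ x
  flow : ∀ x ∈ W, FlowOn (chartSet (𝓡∂ (n + 1)) x₀ U) (chartField (grad gbar.inner r) x₀) δ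
    (α (extChartAt (𝓡∂ (n + 1)) x₀ x)) (J (extChartAt (𝓡∂ (n + 1)) x₀ x))
  deriv : ∀ x ∈ W, ∀ t ∈ Icc 0 δ, HasFDerivWithinAt (fun y => α y t)
    (J (extChartAt (𝓡∂ (n + 1)) x₀ x) t) (extChartAt (𝓡∂ (n + 1)) x₀ '' W)
    (extChartAt (𝓡∂ (n + 1)) x₀ x)
  reach : ∀ x ∈ W, r x < δ → ∃ c : ℝ → X, c 0 ∈ (𝓡∂ (n + 1)).boundary X ∧ c (r x) = x ∧
    IsMIntegralCurveOn (I := 𝓡∂ (n + 1)) c (grad gbar.inner r) (Icc 0 (r x))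

namespace IsGeodesicOn

variable {g : BilinField (𝓡∂ (n + 1)) X} {r : X → ℝ} {gbar : RiemMetric (𝓡∂ (n + 1)) X} {U : Set X}

/-- At the boundary the gradient points to the inside. -/
theorem chartField_grad_pos (h : IsGeodesicOn g r gbar U) {x₀ : X}
    (hb : x₀ ∈ (𝓡∂ (n + 1)).boundary X) (hx : x₀ ∈ U) :
    0 < chartField (grad gbar.inner r) x₀ (extChartAt (𝓡∂ (n + 1)) x₀ x₀) 0 := by
  obtain ⟨O, hO, hs⟩ := chartSet_halfSpace (n := n) x₀ h.isOpen
  have hhyp := h.hypOn x₀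
  have hy : extChartAt (𝓡∂ (n + 1)) x₀ x₀ ∈ chartSet (𝓡∂ (n + 1)) x₀ U :=
    mem_chartSet (mem_extChartAt_source x₀) hx
  set y := extChartAt (𝓡∂ (n + 1)) x₀ x₀
  set N := chartField (grad gbar.inner r) x₀
  -- Otherwise `-N` is an admissible direction at `x₀`. Since `r ≥ 0 = r x₀`, the derivative of `r`
  -- along it is nonnegative, whereas `dr(-N) = -1`.
  by_contra hneg
  have hsymm : (extChartAt (𝓡∂ (n + 1)) x₀).symm y = x₀ :=
    (extChartAt (𝓡∂ (n + 1)) x₀).left_inv (mem_extChartAt_source x₀)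
  have hy0 : y 0 = 0 := (mem_boundary_of_mem_target hy.1).1 (by rwa [hsymm])
  have hρ0 : (r ∘ (extChartAt (𝓡∂ (n + 1)) x₀).symm) y = 0 := by
    simp only [Function.comp, hsymm, h.defining.zero x₀ hb]
  have hev : ∀ᶠ t : ℝ in 𝓝[>] 0, y + t • (-N y) ∈ chartSet (𝓡∂ (n + 1)) x₀ U ∧
      (r ∘ (extChartAt (𝓡∂ (n + 1)) x₀).symm) y ≤
        (r ∘ (extChartAt (𝓡∂ (n + 1)) x₀).symm) (y + t • (-N y)) := by
    have hc : Continuous fun t : ℝ => y + t • (-N y) := by fun_prop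
    have hO' : ∀ᶠ t : ℝ in 𝓝[>] 0, y + t • (-N y) ∈ O :=
      (hc.tendsto 0).mono_left nhdsWithin_le_nhds (hO.mem_nhds (by
        rw [zero_smul, add_zero]; rw [hs] at hy; exact hy.2))
    filter_upwards [hO', self_mem_nhdsWithin] with t ht ht0
    refine ⟨?_, by rw [hρ0]; exact h.defining.nonneg _⟩
    rw [hs]
    refine ⟨?_, ht⟩
    have ht0' : 0 < t := ht0
    change 0 ≤ (y + t • (-N y)) 0
    simp only [PiLp.add_apply, PiLp.smul_apply, PiLp.neg_apply, hy0, smul_eq_mul, zero_add]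
    exact mul_nonneg ht0'.le (by linarith)
  have h1 := fderivWithin_nonneg (ContDiffOn.differentiableWithinAt' hhyp.smooth_fun hy) hev
  rw [← hhyp.grad y hy, map_neg, hhyp.unit y hy] at h1
  linarith

theorem exists_flowChart (h : IsGeodesicOn g r gbar U) {x₀ : X}
    (hb : x₀ ∈ (𝓡∂ (n + 1)).boundary X) (hx₀ : x₀ ∈ U) :
    ∃ W δ α J, FlowChart r gbar U x₀ W δ α J := by
  obtain ⟨O, hO, hs⟩ := chartSet_halfSpace (n := n) x₀ h.isOpen
  have hhyp := h.hypOn x₀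
  have hy₀ : extChartAt (𝓡∂ (n + 1)) x₀ x₀ ∈ chartSet (𝓡∂ (n + 1)) x₀ U :=
    mem_chartSet (mem_extChartAt_source x₀) hx₀
  have hN := hhyp.contDiffOn_grad
  set e := extChartAt (𝓡∂ (n + 1)) x₀ with he
  set N := chartField (grad gbar.inner r) x₀ with hNdef
  obtain ⟨R, hR, δ, hδ, α, J, hflow⟩ := exists_halfSpace_flow hO (hs ▸ hN) (hs ▸ hy₀)
    (h.chartField_grad_pos hb hx₀)
  rw [← hs] at hflow
  set W : Set X := U ∩ (e.source ∩ e ⁻¹' Metric.ball (e x₀) R) with hW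
  have hWmem : ∀ x ∈ W, e x ∈ Metric.closedBall (e x₀) R ∩ {y : Coord (n + 1) | 0 ≤ y 0} := by
    intro x hx
    refine ⟨Metric.ball_subset_closedBall hx.2.2, ?_⟩
    have : e x ∈ range (𝓡∂ (n + 1)) := mem_range_self _
    rwa [range_modelWithCornersEuclideanHalfSpace] at this
  refine ⟨W, δ, α, J, h.isOpen.inter (isOpen_extChartAt_preimage' x₀ Metric.isOpen_ball),
    ⟨hx₀, mem_extChartAt_source x₀, Metric.mem_ball_self hR⟩, fun x hx => hx.2.1, hδ,
    fun x hx => (hflow (e x) (hWmem x hx)).1, fun x hx => ?_, fun x hx t ht => ?_,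
    fun x hx hrx => ?_⟩
  · obtain ⟨h1, h2, h3, -⟩ := hflow (e x) (hWmem x hx)
    exact ⟨fun t ht => (h3 t ht).1, fun t ht => (h3 t ht).2.1, fun t ht => (h3 t ht).2.2.1, h2⟩
  · refine ((hflow (e x) (hWmem x hx)).2.2.1 t ht).2.2.2.mono ?_
    rintro _ ⟨z, hz, rfl⟩
    exact hWmem z hz
  · obtain ⟨h1, -, -, τ, hτ, hτ', h4⟩ := hflow (e x) (hWmem x hx)
    -- The backward trajectory from `x`, with time shifted so that it starts at `0` and arrives at
    -- `x` at time `τ`; along it `r` grows at unit speed.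
    set β : ℝ → Coord (n + 1) := fun t => α (e x) (t - τ) with hβ
    have hβd : ∀ t ∈ Icc 0 τ, β t ∈ chartSet (𝓡∂ (n + 1)) x₀ U ∧
        HasDerivWithinAt β (N (β t)) (Icc 0 τ) t := by
      intro t ht
      obtain ⟨h5, h6⟩ := h4 (t - τ) ⟨by linarith [ht.1], by linarith [ht.2]⟩
      refine ⟨h5, ?_⟩
      have h7 : HasDerivWithinAt (fun t : ℝ => t - τ) 1 (Icc 0 τ) t :=
        ((hasDerivAt_id t).sub_const τ).hasDerivWithinAt
      have h8 := HasDerivWithinAt.scomp (h := fun t : ℝ => t - τ) t h6 h7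
        (fun t ht => ⟨by linarith [ht.1], by linarith [ht.2]⟩)
      exact h8.congr_deriv (one_smul _ _)
    have hlast : β τ = e x := by simp [hβ, h1]
    have hτm : τ ∈ Icc 0 τ := ⟨hτ.1, le_rfl⟩
    have h0m : (0 : ℝ) ∈ Icc 0 τ := ⟨le_rfl, hτ.1⟩
    have hρ : (r ∘ e.symm) (β τ) = (r ∘ e.symm) (β 0) + τ :=
      eqOn_Icc_of_hasDerivWithinAt (f := fun t => (r ∘ e.symm) (β t))
        (g := fun t => (r ∘ e.symm) (β 0) + t) (f' := fun _ => 1) (fun t ht => by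
          have hy := (hβd t ht).1
          refine ((ContDiffOn.differentiableWithinAt' hhyp.smooth_fun
            hy).hasFDerivWithinAt.comp_hasDerivWithinAt t (hβd t ht).2
              fun t ht => (hβd t ht).1).congr_deriv ?_
          rw [← hhyp.grad _ hy, hhyp.unit _ hy])
        (fun t _ => ((hasDerivAt_id t).const_add _).hasDerivWithinAt) (by simp) τ hτm
    have hrx' : r x = r (e.symm (β 0)) + τ := by
      rw [hlast] at hρ
      simpa only [Function.comp, e.left_inv hx.2.1] using hρ
    have hnn := h.defining.nonneg (e.symm (β 0))
    have hbd : e.symm (β 0) ∈ (𝓡∂ (n + 1)).boundary X := by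
      rw [mem_boundary_of_mem_target (hβd 0 h0m).1.1]
      -- If the trajectory had lasted for the full time `δ`, then `r x ≥ δ`, contrary to assumption;
      -- so it stopped at the boundary, and `τ = r x`.
      rcases hτ' with h9 | h9
      · linarith
      · simpa [hβ] using h9
    have hrτ : r x = τ := by rw [hrx', h.defining.zero _ hbd, zero_add]
    refine ⟨e.symm ∘ β, hbd, ?_, ?_⟩
    · rw [hrτ, Function.comp_apply, hlast, e.left_inv hx.2.1]
    · rw [hrτ]
      exact isMIntegralCurveOn_of_chart fun t ht => ⟨(hβd t ht).1.1, (hβd t ht).2⟩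

end IsGeodesicOn

end Collar

/-! ### The collar of the boundary -/

section GlobalCollar

variable {n : ℕ} {X : Type*} [TopologicalSpace X] [ChartedSpace (EuclideanHalfSpace (n + 1)) X]
  {M : Type*} [TopologicalSpace M] [ChartedSpace (EuclideanSpace ℝ (Fin n)) M]
  [IsManifold (𝓡∂ (n + 1)) ∞ X] [IsManifold (𝓡 n) ∞ M]

/-- The curve `t ↦ Φ_t(p)` and the differentials of the maps `Φ_t` at `p`, in the chart at `x₀`. -/
structure CollarRep (ι : M → X) (r : X → ℝ) (gbar : RiemMetric (𝓡∂ (n + 1)) X) (U : Set X)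
    (ε : ℝ) (Φ : M → ℝ → X) (p : M) (x₀ : X) (δ : ℝ) (α : ℝ → Coord (n + 1))
    (J : ℝ → Coord (n + 1) →L[ℝ] Coord (n + 1)) : Prop where
  le : ε ≤ δ
  mem : ι p ∈ (extChartAt (𝓡∂ (n + 1)) x₀).source
  flow : FlowOn (chartSet (𝓡∂ (n + 1)) x₀ U) (chartField (grad gbar.inner r) x₀) δ α J
  start : α 0 = extChartAt (𝓡∂ (n + 1)) x₀ (ι p)
  mem_source : ∀ t ∈ Ico 0 ε, Φ p t ∈ (extChartAt (𝓡∂ (n + 1)) x₀).source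
  chart_eq : ∀ t ∈ Ico 0 ε, extChartAt (𝓡∂ (n + 1)) x₀ (Φ p t) = α t
  transport_eq : ∀ t ∈ Ico 0 ε, ∀ u, chartDiff (𝓡∂ (n + 1)) x₀ (Φ p t) (transport Φ t p u) =
    J t (chartDiff (𝓡∂ (n + 1)) x₀ (ι p) (mfderiv (𝓡 n) (𝓡∂ (n + 1)) ι p u))

variable {ι : M → X} {g : BilinField (𝓡∂ (n + 1)) X} {γ : RiemMetric (𝓡 n) M} {r : X → ℝ}
  {gbar : RiemMetric (𝓡∂ (n + 1)) X} {U : Set X}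

theorem FlowChart.isMIntegralCurveOn {x₀ : X} {W : Set X} {δ : ℝ}
    {α : Coord (n + 1) → ℝ → Coord (n + 1)}
    {J : Coord (n + 1) → ℝ → Coord (n + 1) →L[ℝ] Coord (n + 1)}
    (hF : FlowChart r gbar U x₀ W δ α J) {x : X} (hx : x ∈ W) :
    IsMIntegralCurveOn (I := 𝓡∂ (n + 1)) (fun t => (extChartAt (𝓡∂ (n + 1)) x₀).symm
      (α (extChartAt (𝓡∂ (n + 1)) x₀ x) t)) (grad gbar.inner r) (Icc 0 δ) :=
  isMIntegralCurveOn_of_chart fun t ht =>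
    ⟨((hF.flow x hx).mem t ht).1, (hF.flow x hx).deriv t ht⟩

theorem FlowChart.fun_eq (h : IsGeodesicOn g r gbar U) {x₀ : X} {W : Set X} {δ : ℝ}
    {α : Coord (n + 1) → ℝ → Coord (n + 1)}
    {J : Coord (n + 1) → ℝ → Coord (n + 1) →L[ℝ] Coord (n + 1)}
    (hF : FlowChart r gbar U x₀ W δ α J) {x : X} (hx : x ∈ W) (hr : r x = 0) :
    ∀ t ∈ Icc 0 δ, r ((extChartAt (𝓡∂ (n + 1)) x₀).symm
      (α (extChartAt (𝓡∂ (n + 1)) x₀ x) t)) = t := by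
  refine (hF.flow x hx).fun_eq (h.hypOn x₀) ?_
  rw [Function.comp_apply, hF.start x hx, (extChartAt (𝓡∂ (n + 1)) x₀).left_inv
    (hF.subset_source hx), hr]

/-- The representation of the maps `Φ_t` in a flow chart. -/
theorem FlowChart.collarRep (h : IsGeodesicCompactification ι g γ r gbar U) {x₀ : X} {W : Set X}
    {δ : ℝ} {α : Coord (n + 1) → ℝ → Coord (n + 1)}
    {J : Coord (n + 1) → ℝ → Coord (n + 1) →L[ℝ] Coord (n + 1)}
    (hF : FlowChart r gbar U x₀ W δ α J) {ε : ℝ} (hε : ε ≤ δ) {Φ : M → ℝ → X}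
    (hΦ : ∀ p, ι p ∈ W → ∀ t ∈ Ico 0 ε, Φ p t = (extChartAt (𝓡∂ (n + 1)) x₀).symm
      (α (extChartAt (𝓡∂ (n + 1)) x₀ (ι p)) t)) {p : M} (hp : ι p ∈ W) :
    CollarRep ι r gbar U ε Φ p x₀ δ (α (extChartAt (𝓡∂ (n + 1)) x₀ (ι p)))
      (J (extChartAt (𝓡∂ (n + 1)) x₀ (ι p))) ∧
    ∀ t ∈ Ico 0 ε, MDifferentiableAt (𝓡 n) (𝓡∂ (n + 1)) (fun p => Φ p t) p := by
  have : IsManifold (𝓡∂ (n + 1)) 1 X := IsManifold.of_le (n := ∞) (by simp)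
  set e := extChartAt (𝓡∂ (n + 1)) x₀ with he
  have hsub : Ico 0 ε ⊆ Icc 0 δ := fun t ht => ⟨ht.1, ht.2.le.trans hε⟩
  have hsrc : ∀ p, ι p ∈ W → ∀ t ∈ Ico 0 ε, Φ p t ∈ e.source ∧ e (Φ p t) = α (e (ι p)) t := by
    intro p hp t ht
    have hm := ((hF.flow _ hp).mem t (hsub ht)).1
    rw [hΦ p hp t ht]
    exact ⟨e.map_target hm, e.right_inv hm⟩
  have hn : ι ⁻¹' W ∈ 𝓝 p := (hF.isOpen.preimage h.inclusion.smooth.continuous).mem_nhds hp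
  have hG : ∀ t ∈ Ico 0 ε, HasMFDerivAt (𝓡 n) 𝓘(ℝ, Coord (n + 1))
      (fun p => α (e (ι p)) t) p ((J (e (ι p)) t : Coord (n + 1) →L[ℝ] Coord (n + 1)) ∘L
        ((chartDiff (𝓡∂ (n + 1)) x₀ (ι p)) ∘L (mfderiv (𝓡 n) (𝓡∂ (n + 1)) ι p))) := by
    intro t ht
    have h1 : HasMFDerivAt (𝓡 n) 𝓘(ℝ, Coord (n + 1)) (e ∘ ι) p
        ((chartDiff (𝓡∂ (n + 1)) x₀ (ι p)) ∘L (mfderiv (𝓡 n) (𝓡∂ (n + 1)) ι p)) :=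
      (hasMFDerivAt_chart (hF.subset_source hp)).comp p
        ((h.inclusion.smooth p).mdifferentiableAt (by simp)).hasMFDerivAt
    have h2 : HasMFDerivWithinAt 𝓘(ℝ, Coord (n + 1)) 𝓘(ℝ, Coord (n + 1)) (fun y => α y t)
        (e '' W) ((e ∘ ι) p) (J (e (ι p)) t) :=
      (hF.deriv _ hp t (hsub ht)).hasMFDerivWithinAt
    exact (h2.comp p (h1.hasMFDerivWithinAt (s := ι ⁻¹' W))
      (fun q hq => mem_image_of_mem e hq)).hasMFDerivAt hn
  have hdiff : ∀ t ∈ Ico 0 ε, MDifferentiableAt (𝓡 n) (𝓡∂ (n + 1)) (fun p => Φ p t) p := by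
    intro t ht
    have hm := ((hF.flow _ hp).mem t (hsub ht)).1
    have h1 : MDifferentiableWithinAt 𝓘(ℝ, Coord (n + 1)) (𝓡∂ (n + 1)) e.symm
        (range (𝓡∂ (n + 1))) (α (e (ι p)) t) := mdifferentiableWithinAt_extChartAt_symm hm
    have hmaps : ι ⁻¹' W ⊆ (fun p => α (e (ι p)) t) ⁻¹' range (𝓡∂ (n + 1)) := fun q hq =>
      extChartAt_target_subset_range x₀ ((hF.flow _ hq).mem t (hsub ht)).1
    have h2 := (h1.comp p ((hG t ht).mdifferentiableAt.mdifferentiableWithinAt (s := ι ⁻¹' W))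
      hmaps).mdifferentiableAt hn
    exact h2.congr_of_eventuallyEq (Filter.eventually_of_mem hn fun q hq => hΦ q hq t ht)
  refine ⟨⟨hε, hF.subset_source hp, hF.flow _ hp, hF.start _ hp, fun t ht => (hsrc p hp t ht).1,
    fun t ht => (hsrc p hp t ht).2, fun t ht u => ?_⟩, hdiff⟩
  have h1 : HasMFDerivAt (𝓡 n) 𝓘(ℝ, Coord (n + 1)) (e ∘ fun p => Φ p t) p
      ((chartDiff (𝓡∂ (n + 1)) x₀ (Φ p t)) ∘L (transport Φ t p)) :=
    (hasMFDerivAt_chart (hsrc p hp t ht).1).comp p (hdiff t ht).hasMFDerivAt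
  have h2 := (hG t ht).congr_of_eventuallyEq (f₁ := e ∘ fun p => Φ p t)
    (Filter.eventually_of_mem hn fun q hq => (hsrc q hq t ht).2)
  exact congrArg (fun L => L u) (hasMFDerivAt_unique h1 h2)

/-- The gradient flow of `r` defines a collar of the boundary. -/
theorem IsGeodesicCompactification.exists_collar [T2Space X] [CompactSpace X]
    (h : IsGeodesicCompactification ι g γ r gbar U) :
    ∃ ε > 0, ∃ Φ : M → ℝ → X, IsNormalCollar ι r gbar ε Φ ∧
      ∀ p, ∃ x₀ δ α J, CollarRep ι r gbar U ε Φ p x₀ δ α J := by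
  have hcpt : IsCompact ((𝓡∂ (n + 1)).boundary X) := by
    have : IsManifold (𝓡∂ (n + 1)) 1 X := IsManifold.of_le (n := ∞) (by simp)
    exact ((𝓡∂ (n + 1)).isClosed_boundary (n := 1) (by simp)).isCompact
  choose W δ α J hF using fun x : (𝓡∂ (n + 1)).boundary X =>
    h.exists_flowChart x.2 (h.boundary_subset x.2)
  obtain ⟨s, hs⟩ := hcpt.elim_finite_subcover W (fun i => (hF i).isOpen)
    (fun x hx => mem_iUnion.2 ⟨⟨x, hx⟩, (hF ⟨x, hx⟩).mem⟩)
  have hv := fun x₀ : X =>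
    (gradientOn_chart gbar h.defining.smooth isOpen_univ x₀).contDiffOn_grad
  -- Outside the finitely many flow charts `r` is positive on a compact set. Below `ε₀` every point
  -- therefore lies in a flow chart.
  obtain ⟨ε₀, hε₀, hε₀'⟩ : ∃ ε₀, 0 < ε₀ ∧ ∀ x ∈ (⋃ i ∈ s, W i)ᶜ, ε₀ ≤ r x := by
    refine IsCompact.exists_forall_le' (IsClosed.isCompact ?_)
      h.defining.smooth.continuous.continuousOn fun x hx => h.defining.pos x ?_
    · exact (isOpen_biUnion fun i _ => (hF i).isOpen).isClosed_compl
    · rw [← ModelWithCorners.compl_boundary]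
      exact fun hb => hx (hs hb)
  obtain ⟨ε, ⟨hε1, hε2⟩, hε⟩ : ∃ ε, ((∀ i ∈ s, ε ≤ δ i) ∧ ε ≤ ε₀) ∧ 0 < ε := by
    have h1 : ∀ a : ℝ, 0 < a → ∀ᶠ ε in 𝓝[>] (0 : ℝ), ε ≤ a := fun a ha =>
      Filter.mem_of_superset (Ioc_mem_nhdsGT ha) fun x hx => hx.2
    have := (((Finset.eventually_all s).2 fun i _ => h1 (δ i) (hF i).pos).and
      (h1 ε₀ hε₀)).and (self_mem_nhdsWithin : Ioi (0 : ℝ) ∈ 𝓝[>] (0 : ℝ))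
    exact this.exists
  have hcov : ∀ p : M, ∃ i ∈ s, ι p ∈ W i := fun p => by
    simpa using hs (h.mem_boundary p)
  choose i his hiW using hcov
  have hr0 : ∀ p, r (ι p) = 0 := fun p => h.defining.zero _ (h.mem_boundary p)
  set c : (𝓡∂ (n + 1)).boundary X → M → ℝ → X := fun i p t =>
    (extChartAt (𝓡∂ (n + 1)) (i : X)).symm (α i (extChartAt (𝓡∂ (n + 1)) (i : X) (ι p)) t) with hc
  have hsub : ∀ i ∈ s, Ico 0 ε ⊆ Icc 0 (δ i) := fun i hi t ht => ⟨ht.1, ht.2.le.trans (hε1 i hi)⟩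
  have hcint : ∀ i ∈ s, ∀ p, ι p ∈ W i →
      IsMIntegralCurveOn (I := 𝓡∂ (n + 1)) (c i p) (grad gbar.inner r) (Ico 0 ε) :=
    fun i hi p hp => ((hF i).isMIntegralCurveOn hp).mono (hsub i hi)
  have hc0 : ∀ i p, ι p ∈ W i → c i p 0 = ι p := fun i p hp => by
    simp only [hc, (hF i).start _ hp]
    exact (extChartAt (𝓡∂ (n + 1)) (i : X)).left_inv ((hF i).subset_source hp)
  have hcr : ∀ i ∈ s, ∀ p, ι p ∈ W i → ∀ t ∈ Ico 0 ε, r (c i p t) = t := fun i hi p hp t ht =>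
    (hF i).fun_eq h.toIsGeodesicOn hp (hr0 p) t (hsub i hi ht)
  have h0m : (0 : ℝ) ∈ Ico 0 ε := ⟨le_rfl, hε⟩
  set Φ : M → ℝ → X := fun p => c (i p) p with hΦ
  have hΦint : ∀ p, IsMIntegralCurveOn (I := 𝓡∂ (n + 1)) (Φ p) (grad gbar.inner r) (Ico 0 ε) :=
    fun p => hcint _ (his p) p (hiW p)
  have hΦr : ∀ p, ∀ t ∈ Ico 0 ε, r (Φ p t) = t := fun p => hcr _ (his p) p (hiW p)
  have hΦ0 : ∀ p, Φ p 0 = ι p := fun p => hc0 _ p (hiW p)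
  -- The choice of chart `i p` need not be locally constant. By uniqueness `Φ` agrees with the flow
  -- of every chart of the subcover that contains `ι p`, which gives differentiability in `p`.
  have hΦc : ∀ i ∈ s, ∀ p, ι p ∈ W i → ∀ t ∈ Ico 0 ε, Φ p t = c i p t := fun i hi p hp =>
    eqOn_of_isMIntegralCurveOn hv ordConnected_Ico (hΦint p) (hcint i hi p hp) h0m
      (by rw [hΦ0, hc0 i p hp])
  have hrep := fun p => (hF (i p)).collarRep h (hε1 _ (his p)) (hΦc _ (his p)) (hiW p)
  refine ⟨ε, hε, Φ, ⟨hΦ0, hΦint, ⟨?_, ?_, ?_⟩, fun t ht p => (hrep p).2 t ht⟩,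
    fun p => ⟨_, _, _, _, (hrep p).1⟩⟩
  · rintro ⟨p, t⟩ ⟨-, ht⟩
    change r (Φ p t) < ε
    rw [hΦr p t ht]
    exact ht.2
  -- Injectivity: `t` is recovered as the value of `r`, and two integral curves that meet at the
  -- same time have the same starting point.
  · rintro ⟨p, t⟩ ⟨-, ht⟩ ⟨q, t'⟩ ⟨-, ht'⟩ heq
    have heq' : Φ p t = Φ q t' := heq
    have htt : t = t' := by rw [← hΦr p t ht, ← hΦr q t' ht', heq']
    subst htt
    have := eqOn_of_isMIntegralCurveOn hv ordConnected_Ico (hΦint p) (hΦint q) ht heq' h0m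
    rw [hΦ0, hΦ0] at this
    rw [h.inclusion.isEmbedding.injective this]
  · intro x hx
    have hx' : r x < ε := hx
    obtain ⟨j, hj, hjW⟩ : ∃ j ∈ s, x ∈ W j := by
      by_contra hcon
      refine absurd (hε₀' x fun hmem => hcon (by simpa using hmem)) (by linarith)
    obtain ⟨b, hb0, hbx, hbint⟩ := (hF j).reach x hjW (hx'.trans_le (hε1 j hj))
    rw [← h.inclusion.range_eq] at hb0
    obtain ⟨p, hp⟩ := hb0
    have hrn := h.defining.nonneg x
    have := eqOn_of_isMIntegralCurveOn hv ordConnected_Icc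
      ((hΦint p).mono (Icc_subset_Ico_right hx')) hbint (t₀ := 0) ⟨le_rfl, hrn⟩
      (by rw [hΦ0, hp]) ⟨hrn, le_rfl⟩
    exact ⟨(p, r x), ⟨trivial, hrn, hx'⟩, this.trans hbx⟩

end GlobalCollar

/-! ### The second fundamental form of the level sets -/

/-- The Lie derivative of `ρ⁻² B` in the direction `-ρ N`. -/
theorem HypOn.lie_conf {V : Type*} [NormedAddCommGroup V] [NormedSpace ℝ V] [FiniteDimensional ℝ V]
    {s : Set V} {B : V → V →L[ℝ] V →L[ℝ] ℝ} {ρ : V → ℝ} {N : V → V} (h : HypOn s B ρ N) {y : V}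
    (hy : y ∈ interior s) {u v : V} (hu : fderivWithin ℝ ρ s y u = 0)
    (hv : fderivWithin ℝ ρ s y v = 0) :
    fderiv ℝ (fun z => conf ρ B z u v) y (-(ρ y • N y))
      + conf ρ B y (fderiv ℝ (fun z => -(ρ z • N z)) y u) v
      + conf ρ B y u (fderiv ℝ (fun z => -(ρ z • N z)) y v) =
    2 * ((ρ y ^ 2)⁻¹ * B y u v + BoundaryOn.shapeForm s B N y u v) := by
  have hys := interior_subset hy
  have hn := mem_interior_iff_mem_nhds.1 hy
  have hO := h.gradientOn_interior
  have hρ := h.pos_int y hy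
  have h1 : ∀ w, fderiv ℝ (fun z => conf ρ B z u v) y w = (ρ y ^ 2)⁻¹ *
      (fderivWithin ℝ B s y w u v - 2 * (ρ y)⁻¹ * B y (N y) w * B y u v) := by
    intro w
    have hc := ContDiffOn.differentiableWithinAt' (hO.conf_metricOn h.pos_int).smooth hy
    rw [← fderivWithin_of_isOpen_subset isOpen_interior interior_subset hy,
      ← hO.fderivWithin_conf h.pos_int hy,
      ← fderivWithin_apply_const₂ (isOpen_interior.uniqueDiffOn y hy) hc,
      fderivWithin_of_mem_nhds (isOpen_interior.mem_nhds hy)]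
  have h2 : ∀ w, fderivWithin ℝ ρ s y w = 0 →
      fderiv ℝ (fun z => -(ρ z • N z)) y w = -(ρ y • fderivWithin ℝ N s y w) := by
    intro w hw
    have hρd := (ContDiffOn.differentiableWithinAt' h.smooth_fun hys).hasFDerivWithinAt
    have hNd := (ContDiffOn.differentiableWithinAt' h.contDiffOn_grad hys).hasFDerivWithinAt
    have hd : HasFDerivAt (fun z => -(ρ z • N z)) _ y :=
      ((hρd.smul hNd).neg).hasFDerivAt hn
    rw [hd.fderiv]
    simp [hw]
  -- The Lie derivative of `B` along `N` is twice the Hessian of `ρ`, that is `-2 ρ` times the shape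
  -- form.
  have h3 : B y (fderivWithin ℝ N s y u) v + B y u (fderivWithin ℝ N s y v)
      + fderivWithin ℝ B s y (N y) u v = -(2 * ρ y * BoundaryOn.shapeForm s B N y u v) := by
    have e1 := h.cov_eq hys u
    have e2 := h.cov_eq hys v
    rw [cov_apply, ← eq_sub_iff_add_eq] at e1 e2
    rw [e1, e2, h.compat hys, h.chr_symm hys (N y) u, h.chr_symm hys (N y) v]
    simp only [map_sub, map_neg, map_smul, sub_apply, neg_apply, smul_apply, smul_eq_mul,
      BoundaryOn.shapeForm_apply, h.symm y hys u (shape s (chr s B) N y v), h.shape_symm hys v u]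
    ring
  rw [h1, h2 u hu, h2 v hv]
  simp only [conf, map_neg, map_smul, neg_apply, smul_apply, smul_eq_mul, h.unit y hys]
  have h4 : fderivWithin ℝ B s y (N y) u v = -(2 * ρ y * BoundaryOn.shapeForm s B N y u v)
      - B y (fderivWithin ℝ N s y u) v - B y u (fderivWithin ℝ N s y v) := by linarith
  rw [h4]
  field_simp
  ring

section SecondFundamentalForm

variable {m : ℕ} {H : Type*} [TopologicalSpace H] {I : ModelWithCorners ℝ (Coord m) H}
  {M : Type*} [TopologicalSpace M] [ChartedSpace H M] [IsManifold I ∞ M]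
  {g : BilinField I M} {r : M → ℝ} {gbar : RiemMetric I M} {U : Set M}

/-- The Lie derivative in terms of coefficients in the chart. -/
theorem lieDeriv_of_eventuallyEq {N : ∀ x : M, TangentSpace I x} {T : BilinField I M} {x : M}
    {T' : Coord m → Coord m →L[ℝ] Coord m →L[ℝ] ℝ} {N' : Coord m → Coord m}
    (hT : coeff T x =ᶠ[𝓝 (extChartAt I x x)] T')
    (hN : chartField N x =ᶠ[𝓝 (extChartAt I x x)] N') (u v : Coord m) :
    lieDeriv N T x u v = fderiv ℝ (fun z => T' z u v) (extChartAt I x x) (N' (extChartAt I x x))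
      + T' (extChartAt I x x) (fderiv ℝ N' (extChartAt I x x) u) v
      + T' (extChartAt I x x) u (fderiv ℝ N' (extChartAt I x x) v) := by
  have h1 : (fun z => coeff T x z u v) =ᶠ[𝓝 (extChartAt I x x)] fun z => T' z u v :=
    hT.mono fun z hz => congrArg (fun L : Coord m →L[ℝ] Coord m →L[ℝ] ℝ => L u v) hz
  rw [← h1.fderiv_eq, ← hN.fderiv_eq, ← hN.eq_of_nhds, ← hT.eq_of_nhds]
  unfold lieDeriv
  rw [chartForm_eq]

theorem fderivWithin_chartSet_self (hr : ContMDiff I 𝓘(ℝ, ℝ) ∞ r) (hU : IsOpen U) {x : M}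
    (hxU : x ∈ U) (w : TangentSpace I x) :
    fderivWithin ℝ (r ∘ (extChartAt I x).symm) (chartSet I x U) (extChartAt I x x) w =
      diff I r x w := by
  rw [fderivWithin_chartSet _ hU (mem_chartSet (mem_extChartAt_source x) hxU)]
  have key : ∀ L : Coord m →L[ℝ] ℝ, HasFDerivWithinAt (r ∘ (extChartAt I x).symm) L (range I)
      (extChartAt I x x) → ∀ w, fderivWithin ℝ (r ∘ (extChartAt I x).symm) (range I)
        (extChartAt I x x) w = L w := fun L hL w => by
    rw [hL.fderivWithin (I.uniqueDiffOn _ (mem_range_self _))]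
  exact key (diff I r x) (hasMFDerivAt_diff hr x).2 w

namespace IsGeodesicOn

theorem eq_smul (h : IsGeodesicOn g r gbar U) {x : M} (hx : x ∈ I.interior M)
    (u v : TangentSpace I x) : g x u v = (r x ^ 2)⁻¹ * gbar.inner x u v := by
  have hr := h.defining.pos x hx
  rw [h.compactification x hx]
  simp only [smul_apply, smul_eq_mul]
  field_simp

/-- Passing from `gbar` to `g = r⁻² gbar` multiplies the gradient by `r²`, so `|dr|² = r²` for `g`;
normalization leaves the factor `r`. -/
theorem outwardNormal_eq (h : IsGeodesicOn g r gbar U) {x : M} (hx : x ∈ I.interior M)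
    (hxU : x ∈ U) : outwardNormal g r x = -(r x • grad gbar.inner r x) := by
  have hr := h.defining.pos x hx
  have hpos : ∀ u : TangentSpace I x, u ≠ 0 → 0 < g x u u := fun u hu => by
    rw [h.eq_smul hx]
    have := gbar.pos x u hu
    positivity
  have hsymm : ∀ u v : TangentSpace I x, g x u v = g x v u := fun u v => by
    rw [h.eq_smul hx, h.eq_smul hx, gbar.symm]
  have ha : ∀ v : TangentSpace I x, g x (r x ^ 2 • grad gbar.inner r x) v = diff I r x v :=
    fun v => by
      rw [h.eq_smul hx, ← gbar.inner_grad, map_smul, smul_apply, smul_eq_mul,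
        inv_mul_cancel_left₀ (by positivity)]
  have hgrad : grad g r x = r x ^ 2 • grad gbar.inner r x := by
    let B : Coord m →L[ℝ] Coord m →L[ℝ] ℝ := g x
    exact sharp_eq (B := B) hpos hsymm ha
  have h1 : diff I r x (grad gbar.inner r x) = 1 := h.unit x hxU
  rw [outwardNormal, normSqDiff, hgrad, map_smul, h1, smul_eq_mul, mul_one,
    Real.sqrt_sq hr.le, smul_smul]
  congr 2
  field_simp

theorem mem_interior_chartSet (h : IsGeodesicOn g r gbar U) {x : M} (hx : x ∈ I.interior M)
    (hxU : x ∈ U) : extChartAt I x x ∈ interior (chartSet I x U) := by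
  have hys : extChartAt I x x ∈ chartSet I x U := mem_chartSet (mem_extChartAt_source x) hxU
  obtain ⟨O, hO, hs⟩ := chartSet_eq (I := I) x h.isOpen
  rw [hs] at hys ⊢
  rw [interior_inter, hO.interior_eq]
  refine ⟨(mem_interior_of_mem_target (mem_extChartAt_target x)).1 ?_, hys.2⟩
  rwa [(extChartAt I x).left_inv (mem_extChartAt_source x)]

theorem coeff_eventuallyEq (h : IsGeodesicOn g r gbar U) {x : M} (hx : x ∈ I.interior M)
    (hxU : x ∈ U) : coeff g x =ᶠ[𝓝 (extChartAt I x x)]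
      conf (r ∘ (extChartAt I x).symm) (coeff gbar.inner x) := by
  filter_upwards [isOpen_interior.mem_nhds (h.mem_interior_chartSet hx hxU)] with z hz
  exact h.coeff_eq_conf hz

theorem chartField_outwardNormal_eventuallyEq (h : IsGeodesicOn g r gbar U) {x : M}
    (hx : x ∈ I.interior M) (hxU : x ∈ U) :
    chartField (outwardNormal g r) x =ᶠ[𝓝 (extChartAt I x x)] fun z =>
      -((r ∘ (extChartAt I x).symm) z • chartField (grad gbar.inner r) x z) := by
  filter_upwards [isOpen_interior.mem_nhds (h.mem_interior_chartSet hx hxU)] with z hz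
  have hz' := interior_subset hz
  have hzi := (mem_interior_of_mem_target hz'.1).2 (interior_chartSet_subset x U hz)
  refine (congrArg (chartDiff I x ((extChartAt I x).symm z))
    (h.outwardNormal_eq hzi hz'.2)).trans ?_
  rw [map_neg, map_smul]
  rfl

theorem shapeForm_self (h : IsGeodesicOn g r gbar U) {x : M} (hxU : x ∈ U) (u v : Coord m) :
    BoundaryOn.shapeForm (chartSet I x U) (coeff gbar.inner x)
      (chartField (grad gbar.inner r) x) (extChartAt I x x) u v = shapeField gbar r x u v := by
  have e : shapeField gbar r x u v = shapeCoeff gbar r x (extChartAt I x x) u v :=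
    (h.shapeField_apply (mem_extChartAt_source x) hxU u v).trans
      (congrArg₂ (fun a b => shapeCoeff gbar r x (extChartAt I x x) a b)
        (chartDiff_self x u) (chartDiff_self x v))
  rw [shapeForm_chartSet _ _ h.isOpen (mem_chartSet (mem_extChartAt_source x) hxU)]
  exact e.symm

theorem lieDeriv_outwardNormal (h : IsGeodesicOn g r gbar U) {x : M} (hx : x ∈ I.interior M)
    (hxU : x ∈ U) {u v : Coord m} (hu : diff I r x u = 0) (hv : diff I r x v = 0) :
    lieDeriv (outwardNormal g r) g x u v =
      2 * ((r x ^ 2)⁻¹ * gbar.inner x u v + shapeField gbar r x u v) := by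
  have hρ : (r ∘ (extChartAt I x).symm) (extChartAt I x x) = r x :=
    congrArg r ((extChartAt I x).left_inv (mem_extChartAt_source x))
  have hco : coeff gbar.inner x (extChartAt I x x) u v = gbar.inner x u v :=
    congrArg (fun L : Coord m →L[ℝ] Coord m →L[ℝ] ℝ => L u v) (coeff_self _ x)
  rw [← h.shapeForm_self hxU, ← hρ, ← hco]
  exact (lieDeriv_of_eventuallyEq (h.coeff_eventuallyEq hx hxU)
    (h.chartField_outwardNormal_eventuallyEq hx hxU) u v).trans
    ((h.hypOn x).lie_conf (h.mem_interior_chartSet hx hxU)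
      ((fderivWithin_chartSet_self h.defining.smooth h.isOpen hxU u).trans hu)
      ((fderivWithin_chartSet_self h.defining.smooth h.isOpen hxU v).trans hv))

/-- The second fundamental form of the level sets of `r` in terms of the shape form. -/
theorem secondFundForm_eq (h : IsGeodesicOn g r gbar U) {x : M} (hx : x ∈ I.interior M)
    (hxU : x ∈ U) {u v : TangentSpace I x} (hu : diff I r x u = 0) (hv : diff I r x v = 0) :
    secondFundForm g r x u v = -((r x ^ 2)⁻¹ * gbar.inner x u v + shapeField gbar r x u v) := by
  rw [secondFundForm, h.lieDeriv_outwardNormal hx hxU hu hv]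
  ring

end IsGeodesicOn

end SecondFundamentalForm

/-! ### The normal form of the metric -/

section NormalForm

variable {n : ℕ} {X : Type*} [TopologicalSpace X] [ChartedSpace (EuclideanHalfSpace (n + 1)) X]
  {M : Type*} [TopologicalSpace M] [ChartedSpace (EuclideanSpace ℝ (Fin n)) M]
  [IsManifold (𝓡∂ (n + 1)) ∞ X] [IsManifold (𝓡 n) ∞ M]
  {ι : M → X} {g : BilinField (𝓡∂ (n + 1)) X} {γ : RiemMetric (𝓡 n) M} {r : X → ℝ}
  {gbar : RiemMetric (𝓡∂ (n + 1)) X} {U : Set X}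

/-- The differential of the inclusion of the boundary, in the chart at `x₀`. -/
def inclDiff (ι : M → X) (x₀ : X) (p : M) : Coord n →L[ℝ] Coord (n + 1) :=
  let D : Coord n →L[ℝ] Coord (n + 1) := mfderiv (𝓡 n) (𝓡∂ (n + 1)) ι p
  let E : Coord (n + 1) →L[ℝ] Coord (n + 1) := chartDiff (𝓡∂ (n + 1)) x₀ (ι p)
  E ∘L D

theorem RiemMetric.metricSquare_eq (γ : RiemMetric (𝓡 n) M) (P : BilinField (𝓡 n) M) {p : M}
    {u v a b : TangentSpace (𝓡 n) p} (ha : ∀ w, P p u w = γ.inner p a w)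
    (hb : ∀ w, P p v w = γ.inner p b w) :
    metricSquare (fun x y => γ.inner p x y) (fun x y => P p x y) u v = γ.inner p a b := by
  let B : Coord n →L[ℝ] Coord n →L[ℝ] ℝ := γ.inner p
  let P' : Coord n → Coord n → ℝ := fun x y => P p x y
  exact HypPoincare.metricSquare_eq (B := B) (P := P') (γ.pos p) (γ.symm p) ha hb

namespace IsGeodesicCompactification

theorem fderivWithin_inclRep_self (h : IsGeodesicCompactification ι g γ r gbar U) {p : M} {x₀ : X}
    (hp : ι p ∈ (extChartAt (𝓡∂ (n + 1)) x₀).source) (u : Coord n) :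
    fderivWithin ℝ (inclRep ι p x₀)
      (chartSet (𝓡 n) p (ι ⁻¹' (extChartAt (𝓡∂ (n + 1)) x₀).source)) (extChartAt (𝓡 n) p p) u =
      inclDiff ι x₀ p u := by
  rw [inclRep, fderivWithin_rep (h.isOpen_preimage x₀) h.inclusion.smooth (mapsTo_preimage _ _)
    (mem_chartSet (mem_extChartAt_source p) hp)]
  exact (congrArg (fun w => inclDiff ι x₀ ((extChartAt (𝓡 n) p).symm (extChartAt (𝓡 n) p p)) w)
    (chartInv_self p u)).trans (congrArg (fun q => inclDiff ι x₀ q u)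
      ((extChartAt (𝓡 n) p).left_inv (mem_extChartAt_source p)))

theorem inclRep_self (ι : M → X) (p : M) (x₀ : X) : inclRep ι p x₀ (extChartAt (𝓡 n) p p) =
    extChartAt (𝓡∂ (n + 1)) x₀ (ι p) := by
  simp only [inclRep, Function.comp, (extChartAt (𝓡 n) p).left_inv (mem_extChartAt_source p)]

theorem coeff_inclDiff (h : IsGeodesicCompactification ι g γ r gbar U) {p : M} {x₀ : X}
    (hp : ι p ∈ (extChartAt (𝓡∂ (n + 1)) x₀).source) (u v : TangentSpace (𝓡 n) p) :
    coeff gbar.inner x₀ (extChartAt (𝓡∂ (n + 1)) x₀ (ι p)) (inclDiff ι x₀ p u)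
      (inclDiff ι x₀ p v) = γ.inner p u v :=
  (coeff_chartDiff gbar.inner hp _ _).trans (h.restrict p u v)

theorem coeff_shape_inclDiff (h : IsGeodesicCompactification ι g γ r gbar U) {p : M} {x₀ : X}
    (hp : ι p ∈ (extChartAt (𝓡∂ (n + 1)) x₀).source) (u v : TangentSpace (𝓡 n) p) :
    coeff gbar.inner x₀ (extChartAt (𝓡∂ (n + 1)) x₀ (ι p))
      (shape (chartSet (𝓡∂ (n + 1)) x₀ U)
        (chr (chartSet (𝓡∂ (n + 1)) x₀ U) (coeff gbar.inner x₀))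
        (chartField (grad gbar.inner r) x₀) (extChartAt (𝓡∂ (n + 1)) x₀ (ι p))
        (inclDiff ι x₀ p u)) (inclDiff ι x₀ p v) = boundaryTensor ι gbar r p u v := by
  rw [boundaryTensor_apply, h.shapeField_apply hp (h.incl_mem p), shapeCoeff,
    ← shapeForm_chartSet _ _ h.isOpen (mem_chartSet hp (h.incl_mem p)), BoundaryOn.shapeForm_apply]
  rfl

/-- The shape operator of the boundary. -/
theorem exists_shape_inclDiff (h : IsGeodesicCompactification ι g γ r gbar U) {p : M} {x₀ : X}
    (hp : ι p ∈ (extChartAt (𝓡∂ (n + 1)) x₀).source) :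
    ∃ A : TangentSpace (𝓡 n) p → TangentSpace (𝓡 n) p, ∀ u : TangentSpace (𝓡 n) p,
    shape (chartSet (𝓡∂ (n + 1)) x₀ U)
        (chr (chartSet (𝓡∂ (n + 1)) x₀ U) (coeff gbar.inner x₀))
        (chartField (grad gbar.inner r) x₀) (extChartAt (𝓡∂ (n + 1)) x₀ (ι p))
        (inclDiff ι x₀ p u) = inclDiff ι x₀ p (A u) := by
  have hm := fun u : Coord n =>
    (h.boundaryOn p x₀).map_bshape (mem_chartSet (mem_extChartAt_source p) hp) u
  simp only [h.fderivWithin_inclRep_self hp, inclRep_self] at hm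
  exact ⟨_, hm⟩

theorem exists_shape (h : IsGeodesicCompactification ι g γ r gbar U) (p : M) :
    ∃ A : TangentSpace (𝓡 n) p → TangentSpace (𝓡 n) p, ∀ u w : TangentSpace (𝓡 n) p,
      boundaryTensor ι gbar r p u w = γ.inner p (A u) w := by
  obtain ⟨A, hA⟩ := h.exists_shape_inclDiff (mem_extChartAt_source (ι p))
  exact ⟨A, fun u w => by
    rw [← h.coeff_shape_inclDiff (mem_extChartAt_source (ι p)), hA,
      h.coeff_inclDiff (mem_extChartAt_source (ι p))]⟩

/-- The shape operator preserves the tangent space of the boundary, so this product of normal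
curvature data can be computed on `M`, where it is the square of `P`. -/
theorem coeff_shape_shape (h : IsGeodesicCompactification ι g γ r gbar U) {p : M} {x₀ : X}
    (hp : ι p ∈ (extChartAt (𝓡∂ (n + 1)) x₀).source) (u v : TangentSpace (𝓡 n) p) :
    coeff gbar.inner x₀ (extChartAt (𝓡∂ (n + 1)) x₀ (ι p))
      (shape (chartSet (𝓡∂ (n + 1)) x₀ U)
        (chr (chartSet (𝓡∂ (n + 1)) x₀ U) (coeff gbar.inner x₀))
        (chartField (grad gbar.inner r) x₀) (extChartAt (𝓡∂ (n + 1)) x₀ (ι p))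
        (inclDiff ι x₀ p u))
      (shape (chartSet (𝓡∂ (n + 1)) x₀ U)
        (chr (chartSet (𝓡∂ (n + 1)) x₀ U) (coeff gbar.inner x₀))
        (chartField (grad gbar.inner r) x₀) (extChartAt (𝓡∂ (n + 1)) x₀ (ι p))
        (inclDiff ι x₀ p v)) =
      metricSquare (fun x y => γ.inner p x y) (fun x y => boundaryTensor ι gbar r p x y) u v := by
  obtain ⟨A, hA⟩ := h.exists_shape_inclDiff hp
  have hPA : ∀ u w : TangentSpace (𝓡 n) p, boundaryTensor ι gbar r p u w = γ.inner p (A u) w :=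
    fun u w => by
      rw [← h.coeff_shape_inclDiff hp, hA, h.coeff_inclDiff hp]
  rw [hA, hA]
  exact (h.coeff_inclDiff hp _ _).trans
    (γ.metricSquare_eq (boundaryTensor ι gbar r) (hPA u) (hPA v)).symm

theorem normal_inclDiff (h : IsGeodesicCompactification ι g γ r gbar U) {p : M} {x₀ : X}
    (hp : ι p ∈ (extChartAt (𝓡∂ (n + 1)) x₀).source) (u : TangentSpace (𝓡 n) p) :
    coeff gbar.inner x₀ (extChartAt (𝓡∂ (n + 1)) x₀ (ι p))
      (chartField (grad gbar.inner r) x₀ (extChartAt (𝓡∂ (n + 1)) x₀ (ι p)))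
      (inclDiff ι x₀ p u) = 0 := by
  have hm := fun u : Coord n =>
    (h.boundaryOn p x₀).normal_tangent (mem_chartSet (mem_extChartAt_source p) hp) u
  simp only [h.fderivWithin_inclRep_self hp, inclRep_self] at hm
  exact hm u

theorem injective_inclDiff (h : IsGeodesicCompactification ι g γ r gbar U) {p : M} {x₀ : X}
    (hp : ι p ∈ (extChartAt (𝓡∂ (n + 1)) x₀).source) :
    Function.Injective (inclDiff (n := n) ι x₀ p) := by
  refine (injective_iff_map_eq_zero _).2 fun u hu => ?_
  by_contra hne
  have := γ.pos p u hne
  have h2 := h.coeff_inclDiff hp u u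
  rw [hu, map_zero] at h2
  exact this.ne h2

end IsGeodesicCompactification

/-! ### Metric, shape form and principal directions along the collar. -/

namespace CollarRep

variable {ε : ℝ} {Φ : M → ℝ → X} {p : M} {x₀ : X} {δ : ℝ} {α : ℝ → Coord (n + 1)}
  {J : ℝ → Coord (n + 1) →L[ℝ] Coord (n + 1)} {t : ℝ}

theorem mem_Icc (hc : CollarRep ι r gbar U ε Φ p x₀ δ α J) (ht : t ∈ Ioo 0 ε) : t ∈ Icc 0 δ :=
  ⟨ht.1.le, ht.2.le.trans hc.le⟩

theorem symm_eq (hc : CollarRep ι r gbar U ε Φ p x₀ δ α J) (ht : t ∈ Ioo 0 ε) :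
    (extChartAt (𝓡∂ (n + 1)) x₀).symm (α t) = Φ p t := by
  rw [← hc.chart_eq t (Ioo_subset_Ico_self ht),
    (extChartAt (𝓡∂ (n + 1)) x₀).left_inv (hc.mem_source t (Ioo_subset_Ico_self ht))]

theorem mem_nhd (hc : CollarRep ι r gbar U ε Φ p x₀ δ α J) (ht : t ∈ Ioo 0 ε) : Φ p t ∈ U := by
  rw [← hc.symm_eq ht]
  exact (hc.flow.mem t (hc.mem_Icc ht)).2

theorem fun_start (h : IsGeodesicCompactification ι g γ r gbar U)
    (hc : CollarRep ι r gbar U ε Φ p x₀ δ α J) :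
    (r ∘ (extChartAt (𝓡∂ (n + 1)) x₀).symm) (α 0) = 0 := by
  rw [hc.start, Function.comp_apply, (extChartAt (𝓡∂ (n + 1)) x₀).left_inv hc.mem]
  exact h.defining.zero _ (h.mem_boundary p)

theorem fun_eq (h : IsGeodesicCompactification ι g γ r gbar U)
    (hc : CollarRep ι r gbar U ε Φ p x₀ δ α J) (ht : t ∈ Ioo 0 ε) : r (Φ p t) = t := by
  rw [← hc.symm_eq ht]
  exact hc.flow.fun_eq (h.hypOn x₀) (hc.fun_start h) t (hc.mem_Icc ht)

theorem mem_interior (h : IsGeodesicCompactification ι g γ r gbar U)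
    (hc : CollarRep ι r gbar U ε Φ p x₀ δ α J) (ht : t ∈ Ioo 0 ε) :
    Φ p t ∈ (𝓡∂ (n + 1)).interior X := by
  rw [← ModelWithCorners.compl_boundary]
  intro hb
  have := h.defining.zero _ hb
  rw [hc.fun_eq h ht] at this
  exact ht.1.ne' this

theorem transport_apply (hc : CollarRep ι r gbar U ε Φ p x₀ δ α J) (ht : t ∈ Ioo 0 ε)
    (u : TangentSpace (𝓡 n) p) : chartDiff (𝓡∂ (n + 1)) x₀ (Φ p t) (transport Φ t p u) =
      J t (inclDiff ι x₀ p u) := hc.transport_eq t (Ioo_subset_Ico_self ht) u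

/-- The induced metric `g_r` of the compactification. -/
theorem inner_transport (h : IsGeodesicCompactification ι g γ r gbar U)
    (hc : CollarRep ι r gbar U ε Φ p x₀ δ α J) (ht : t ∈ Ioo 0 ε) (u v : TangentSpace (𝓡 n) p) :
    gbar.inner (Φ p t) (transport Φ t p u) (transport Φ t p v) =
      γ.inner p u v - t ^ 2 * boundaryTensor ι gbar r p u v + t ^ 4 / 4 *
        metricSquare (fun x y => γ.inner p x y) (fun x y => boundaryTensor ι gbar r p x y) u v := by
  have key := hc.flow.inner_eq (h.hypOn x₀) (hc.fun_start h) (inclDiff ι x₀ p u)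
    (inclDiff ι x₀ p v) t (hc.mem_Icc ht)
  rw [hc.start, h.coeff_shape_shape hc.mem, h.coeff_shape_inclDiff hc.mem,
    h.coeff_inclDiff hc.mem, ← hc.transport_apply ht, ← hc.transport_apply ht,
    ← hc.chart_eq t (Ioo_subset_Ico_self ht),
    coeff_chartDiff gbar.inner (hc.mem_source t (Ioo_subset_Ico_self ht))] at key
  exact key

theorem shapeField_transport (h : IsGeodesicCompactification ι g γ r gbar U)
    (hc : CollarRep ι r gbar U ε Φ p x₀ δ α J) (ht : t ∈ Ioo 0 ε) (u v : TangentSpace (𝓡 n) p) :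
    shapeField gbar r (Φ p t) (transport Φ t p u) (transport Φ t p v) =
      boundaryTensor ι gbar r p u v - t ^ 2 / 2 *
        metricSquare (fun x y => γ.inner p x y) (fun x y => boundaryTensor ι gbar r p x y) u v := by
  have key := hc.flow.inner_shape (h.hypOn x₀) (hc.fun_start h) (inclDiff ι x₀ p u)
    (inclDiff ι x₀ p v) t (hc.mem_Icc ht)
  rw [h.shapeField_apply (hc.mem_source t (Ioo_subset_Ico_self ht)) (hc.mem_nhd ht),
    hc.transport_apply ht, hc.transport_apply ht, shapeCoeff,
    ← shapeForm_chartSet _ _ h.isOpen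
      (mem_chartSet (hc.mem_source t (Ioo_subset_Ico_self ht)) (hc.mem_nhd ht)),
    BoundaryOn.shapeForm_apply, hc.chart_eq t (Ioo_subset_Ico_self ht), key, hc.start,
    h.coeff_shape_shape hc.mem, h.coeff_shape_inclDiff hc.mem]

theorem diff_transport (h : IsGeodesicCompactification ι g γ r gbar U)
    (hc : CollarRep ι r gbar U ε Φ p x₀ δ α J) (ht : t ∈ Ioo 0 ε) (u : TangentSpace (𝓡 n) p) :
    diff (𝓡∂ (n + 1)) r (Φ p t) (transport Φ t p u) = 0 := by
  have key := hc.flow.inner_normal (h.hypOn x₀) (inclDiff ι x₀ p u) t (hc.mem_Icc ht)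
  rw [hc.start, h.normal_inclDiff hc.mem, ← hc.transport_apply ht,
    ← hc.chart_eq t (Ioo_subset_Ico_self ht),
    chartField_apply _ (hc.mem_source t (Ioo_subset_Ico_self ht)),
    coeff_chartDiff gbar.inner (hc.mem_source t (Ioo_subset_Ico_self ht))] at key
  rw [← gbar.inner_grad, key]

theorem injective_transport (h : IsGeodesicCompactification ι g γ r gbar U)
    (hc : CollarRep ι r gbar U ε Φ p x₀ δ α J) (ht : t ∈ Ioo 0 ε) :
    Function.Injective (transport (n := n) Φ t p) := by
  intro u v huv
  refine h.injective_inclDiff hc.mem (hc.flow.injective (uniqueDiffOn_chartSet x₀ h.isOpen)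
    (h.hypOn x₀).contDiffOn_grad (hc.mem_Icc ht) ?_)
  exact (hc.transport_apply ht u).symm.trans ((congrArg _ huv).trans (hc.transport_apply ht v))

theorem inner_grad_transport (h : IsGeodesicCompactification ι g γ r gbar U)
    (hc : CollarRep ι r gbar U ε Φ p x₀ δ α J) (ht : t ∈ Ioo 0 ε) (a b : ℝ)
    (u v : TangentSpace (𝓡 n) p) :
    gbar.inner (Φ p t) (a • grad gbar.inner r (Φ p t) + transport Φ t p u)
      (b • grad gbar.inner r (Φ p t) + transport Φ t p v) =
        a * b + gbar.inner (Φ p t) (transport Φ t p u) (transport Φ t p v) := by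
  have h1 : gbar.inner (Φ p t) (grad gbar.inner r (Φ p t)) (grad gbar.inner r (Φ p t)) = 1 :=
    (gbar.inner_grad r _ _).trans (h.unit _ (hc.mem_nhd ht))
  have h2 : ∀ w : TangentSpace (𝓡 n) p,
      gbar.inner (Φ p t) (grad gbar.inner r (Φ p t)) (transport Φ t p w) = 0 := fun w =>
    (gbar.inner_grad r _ _).trans (hc.diff_transport h ht w)
  have h3 : ∀ w : TangentSpace (𝓡 n) p,
      gbar.inner (Φ p t) (transport Φ t p w) (grad gbar.inner r (Φ p t)) = 0 := fun w =>
    (gbar.symm _ _ _).trans (h2 w)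
  simp only [map_add, map_smul, add_apply, smul_apply, smul_eq_mul, h1, h2, h3]
  ring

/-- The tangent space of the level set is the image of `dΦ_t`. -/
theorem range_transport (h : IsGeodesicCompactification ι g γ r gbar U)
    (hc : CollarRep ι r gbar U ε Φ p x₀ δ α J) (ht : t ∈ Ioo 0 ε) :
    LinearMap.range (transport (n := n) Φ t p).toLinearMap =
      LinearMap.ker (diff (𝓡∂ (n + 1)) r (Φ p t)).toLinearMap := by
  let W : Coord n →ₗ[ℝ] Coord (n + 1) := (transport (n := n) Φ t p).toLinearMap
  let L : Coord (n + 1) →ₗ[ℝ] ℝ := (diff (𝓡∂ (n + 1)) r (Φ p t)).toLinearMap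
  change LinearMap.range W = LinearMap.ker L
  have hL : L ≠ 0 := fun h0 => by
    have h1 : L (grad gbar.inner r (Φ p t)) = 1 := h.unit _ (hc.mem_nhd ht)
    rw [h0] at h1
    exact zero_ne_one h1
  have hsurj : LinearMap.range L = ⊤ := LinearMap.range_eq_top.2 (LinearMap.surjective hL)
  have h1 := LinearMap.finrank_range_add_finrank_ker L
  rw [hsurj] at h1
  have h2 := LinearMap.finrank_range_of_inj (f := W) (hc.injective_transport h ht)
  refine Submodule.eq_of_le_of_finrank_eq ?_ ?_
  · rintro _ ⟨u, rfl⟩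
    exact hc.diff_transport h ht u
  · simp only [finrank_top, Module.finrank_self, finrank_euclideanSpace, Fintype.card_fin] at h1 h2
    omega

/-- Eigenvectors of `P_γ` induce principal directions of the level sets. -/
theorem isPrincipalFrame (h : IsGeodesicCompactification ι g γ r gbar U)
    (hc : CollarRep ι r gbar U ε Φ p x₀ δ α J) (ht : t ∈ Ioo 0 ε)
    {e : Fin n → TangentSpace (𝓡 n) p} {lam : Fin n → ℝ}
    (he : IsEigenframe ⊤ (fun u v => γ.inner p u v) (fun u v => boundaryTensor ι gbar r p u v)
      e lam) :
    ∃ κ : Fin n → ℝ, IsPrincipalFrame g r (Φ p t) (fun i => transport Φ t p (e i)) κ ∧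
      ∀ i, κ i ≠ 1 ∧ 1 - t ^ 2 / 2 * lam i = 2 / (1 - κ i) := by
  have hinj := hc.injective_transport h ht
  have hP : ∀ i w, boundaryTensor ι gbar r p (e i) w = lam i * γ.inner p (e i) w := fun i w =>
    he.eigen i w trivial
  have hQ : ∀ i (w : TangentSpace (𝓡 n) p), metricSquare (fun x y => γ.inner p x y)
      (fun x y => boundaryTensor ι gbar r p x y) (e i) w = lam i ^ 2 * γ.inner p (e i) w := by
    intro i w
    obtain ⟨A, hA⟩ := h.exists_shape p
    have ha : ∀ v, boundaryTensor ι gbar r p (e i) v = γ.inner p (lam i • e i) v := fun v => by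
      rw [hP, map_smul, smul_apply, smul_eq_mul]
    rw [γ.metricSquare_eq (boundaryTensor ι gbar r) ha (hA w), map_smul, smul_apply,
      smul_eq_mul, γ.symm, ← hA, h.isSchoutenType.symm, hP]
    ring
  have hne : ∀ i, transport Φ t p (e i) ≠ 0 := fun i h0 =>
    he.linearIndependent.ne_zero i (hinj (h0.trans (map_zero _).symm))
  -- On an eigenvector the polynomial `1 - t² λ + t⁴ λ² / 4` is the square of `1 - t² λ / 2`.
  have hg : ∀ i w, gbar.inner (Φ p t) (transport Φ t p (e i)) (transport Φ t p w) =
      (1 - t ^ 2 / 2 * lam i) ^ 2 * γ.inner p (e i) w := fun i w => by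
    rw [hc.inner_transport h ht, hP, hQ]
    ring
  have hs : ∀ i w, shapeField gbar r (Φ p t) (transport Φ t p (e i)) (transport Φ t p w) =
      lam i * (1 - t ^ 2 / 2 * lam i) * γ.inner p (e i) w := fun i w => by
    rw [hc.shapeField_transport h ht, hP, hQ]
    ring
  -- Since `dΦ_t` is injective, the induced metric cannot degenerate on `e i`.
  have hμ : ∀ i, 1 - t ^ 2 / 2 * lam i ≠ 0 := fun i h0 => by
    have h1 := gbar.pos (Φ p t) _ (hne i)
    rw [hg, h0] at h1
    simp at h1
  have ht0 : t ≠ 0 := ht.1.ne'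
  -- With `m = 1 - t² λ / 2`, the second fundamental form is `-(t⁻² m² + λ m) γ` and `g` is `t⁻² m²
  -- γ` on this direction. The quotient is `κ = -(m + t² λ) / m`, whence `1 - κ = 2 / m`.
  refine ⟨fun i => -((1 + t ^ 2 / 2 * lam i) / (1 - t ^ 2 / 2 * lam i)), ⟨?_, ?_, ?_⟩, fun i => ?_⟩
  · exact he.linearIndependent.map' (transport (n := n) Φ t p).toLinearMap
      (LinearMap.ker_eq_bot.2 hinj)
  · rw [← hc.range_transport h ht, LinearMap.range_eq_map, ← he.span_eq, Submodule.map_span,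
      ← range_comp]
    rfl
  · intro i w hw
    obtain ⟨w, rfl⟩ : w ∈ LinearMap.range (transport (n := n) Φ t p).toLinearMap := by
      rwa [hc.range_transport h ht]
    change secondFundForm g r (Φ p t) (transport Φ t p (e i)) (transport Φ t p w) =
      _ * g (Φ p t) (transport Φ t p (e i)) (transport Φ t p w)
    rw [h.secondFundForm_eq (hc.mem_interior h ht) (hc.mem_nhd ht) (hc.diff_transport h ht _)
      (hc.diff_transport h ht _), h.eq_smul (hc.mem_interior h ht), hg, hs, hc.fun_eq h ht]
    have hm := hμ i
    generalize hm' : 1 - t ^ 2 / 2 * lam i = m at hm ⊢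
    have hlam : lam i = 2 * (1 - m) / t ^ 2 := by
      rw [← hm']
      field_simp
      ring
    rw [hlam]
    field_simp
    ring
  · have h1 : 1 - -((1 + t ^ 2 / 2 * lam i) / (1 - t ^ 2 / 2 * lam i)) =
        2 / (1 - t ^ 2 / 2 * lam i) := by
      rw [sub_neg_eq_add, eq_div_iff (hμ i), add_mul, div_mul_cancel₀ _ (hμ i)]
      ring
    refine ⟨fun h0 => ?_, by rw [h1, div_div_cancel₀ two_ne_zero]⟩
    beta_reduce at h0
    rw [h0, sub_self] at h1
    exact div_ne_zero two_ne_zero (hμ i) h1.symm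

end CollarRep

theorem IsGeodesicCompactification.hasNormalForm (h : IsGeodesicCompactification ι g γ r gbar U)
    {ε : ℝ} {Φ : M → ℝ → X} (hΦ : ∀ p, ∃ x₀ δ α J, CollarRep ι r gbar U ε Φ p x₀ δ α J) :
    HasNormalForm g γ r gbar (boundaryTensor ι gbar r) ε Φ := by
  intro p t ht a b u v
  obtain ⟨x₀, δ, α, J, hc⟩ := hΦ p
  rw [h.eq_smul (hc.mem_interior h ht), hc.inner_grad_transport h ht, hc.inner_transport h ht,
    hc.fun_eq h ht]

end NormalForm

end HypPoincare

end

/-! ### The normal form of a hyperbolic conformally compact metric and its curvature radii. -/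

theorem theorem1p1 {n : ℕ} (hn : 2 ≤ n)
    {X : Type*} [TopologicalSpace X] [T2Space X] [CompactSpace X]
    [ChartedSpace (EuclideanHalfSpace (n + 1)) X] [IsManifold (𝓡∂ (n + 1)) ∞ X]
    {M : Type*} [TopologicalSpace M] [ChartedSpace (EuclideanSpace ℝ (Fin n)) M]
    [IsManifold (𝓡 n) ∞ M]
    (ι : M → X) (hι : IsBoundaryInclusion (n := n) ι)
    (g : BilinField (𝓡∂ (n + 1)) X) (hg : IsHyperbolicPoincare g)
    (γ : RiemMetric (𝓡 n) M) (r : X → ℝ) (gbar : RiemMetric (𝓡∂ (n + 1)) X)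
    (hr : IsGeodesicDefiningFunction ι g γ r gbar) :
    ∃ P : BilinField (𝓡 n) M, IsSchoutenType γ P ∧
      ∃ ε > 0, ∃ Φ : M → ℝ → X, IsNormalCollar ι r gbar ε Φ ∧ HasNormalForm g γ r gbar P ε Φ ∧
        ∀ p, ∀ t ∈ Ioo 0 ε, ∀ (e : Fin n → TangentSpace (𝓡 n) p) (lam : Fin n → ℝ),
          IsEigenframe ⊤ (fun u v => γ.inner p u v) (fun u v => P p u v) e lam →
          ∃ κ : Fin n → ℝ, IsPrincipalFrame g r (Φ p t) (fun i => transport Φ t p (e i)) κ ∧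
            ∀ i, κ i ≠ 1 ∧ 1 - t ^ 2 / 2 * lam i = 2 / (1 - κ i) := by
  obtain ⟨U, hU, hbU, hunit⟩ := hr.unit
  have h : IsGeodesicCompactification ι g γ r gbar U :=
    { isOpen := hU
      defining := hr.defining
      compactification := hr.compactification
      unit := hunit
      curvature := hg.hyperbolic
      inclusion := hι
      restrict := hr.restrict
      boundary_subset := hbU }
  obtain ⟨ε, hε, Φ, hΦ, hrep⟩ := h.exists_collar
  refine ⟨boundaryTensor ι gbar r, h.isSchoutenType, ε, hε, Φ, hΦ, h.hasNormalForm hrep, ?_⟩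
  intro p t ht e lam he
  obtain ⟨x₀, δ, α, J, hc⟩ := hrep p
  exact hc.isPrincipalFrame h ht he
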